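/- Let $I=[0,1]$ and let $C(I)$ be the Polish space of all continuous maps $f\colon I\to I$ with the topology of uniform convergence. Call $f,g\in C(I)$ orientation-preservingly conjugate if there is an increasing homeomorphism $h\colon I\to I$ with $h\circ f=g\circ h$. For equivalence relations $E$, $F$ on standard Borel spaces $X$, $Y$, say that $E$ is Borel reducible to $F$ if there is a Borel map $\varphi\colon X\to Y$ such that $x\,E\,x'\iff\varphi(x)\,F\,\varphi(x')$ for all $x,x'\in X$, and that $E$ and $F$ are Borel bireducible if each is Borel reducible to the other. Let $S_\infty$ be the Polish group of all permutations of $\mathbb N$ with the topology of pointwise convergence. An $S_\infty$-orbit equivalence relation is the orbit equivalence relation of a continuous action of $S_\infty$ on a Polish space (regarded as a standard Borel space); it is called universal if every $S_\infty$-orbit equivalence relation is Borel reducible to it. **Theorem.** A universal $S_\infty$-orbit equivalence relation $E_{S_\infty}$ exists (it is then unique up to Borel bireducibility), and orientation-preserving conjugacy on $C(I)$ is Borel bireducible to every such $E_{S_\infty}$. -/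

import Mathlib

open scoped unitInterval

/-- `E` is Borel reducible to `F`: there is a Borel map `φ` with
`x E x' ↔ φ x F φ x'` for all `x, x'`. -/
def BorelReducible {X Y : Type*} [MeasurableSpace X] [MeasurableSpace Y]
    (E : Setoid X) (F : Setoid Y) : Prop :=
  ∃ φ : X → Y, Measurable φ ∧ ∀ x x' : X, E x x' ↔ F (φ x) (φ x')

/-- `E` and `F` are Borel bireducible. -/
def BorelBireducible {X Y : Type*} [MeasurableSpace X] [MeasurableSpace Y]
    (E : Setoid X) (F : Setoid Y) : Prop :=
  BorelReducible E F ∧ BorelReducible F E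

/-- The topology of pointwise convergence on `S_∞`, the group of all permutations of `ℕ`:
the subspace topology inherited from `ℕ → ℕ`, where `ℕ` is discrete. -/
instance permNatTopology : TopologicalSpace (Equiv.Perm ℕ) :=
  TopologicalSpace.induced (fun g : Equiv.Perm ℕ => (g : ℕ → ℕ)) inferInstance

/-- `E` is the orbit equivalence relation of a continuous action of `S_∞` on a Polish space
whose Borel sets are the measurable sets of `Y`. In particular `Y` is standard Borel. -/
def IsSInftyOrbitRel {Y : Type} [MeasurableSpace Y] (E : Setoid Y) : Prop :=
  ∃ (_ : TopologicalSpace Y) (_ : PolishSpace Y) (_ : BorelSpace Y)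
    (_ : MulAction (Equiv.Perm ℕ) Y),
    ContinuousSMul (Equiv.Perm ℕ) Y ∧ E = MulAction.orbitRel (Equiv.Perm ℕ) Y

/-- `E` is a universal `S_∞`-orbit equivalence relation: it is an `S_∞`-orbit equivalence
relation to which every `S_∞`-orbit equivalence relation is Borel reducible. These conditions
determine `E_{S_∞}` up to Borel bireducibility. Since every standard Borel space is isomorphic
to one in `Type`, nothing is lost by quantifying over `Type`. -/
def IsUniversalSInftyOrbitRel {Y : Type} [MeasurableSpace Y] (E : Setoid Y) : Prop :=
  IsSInftyOrbitRel E ∧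
    ∀ (Z : Type) [MeasurableSpace Z] (F : Setoid Z), IsSInftyOrbitRel F → BorelReducible F E

/-- The Borel structure of `C(I)`, the space of continuous self-maps of `I = [0,1]`, for the
compact-open topology, which is the topology of uniform convergence. -/
instance intervalMapMeasurableSpace : MeasurableSpace C(I, I) := borel _

/-- Orientation preserving conjugacy of interval maps: `f` and `g` are equivalent if
`h ∘ f = g ∘ h` for some increasing homeomorphism `h` of `I`. -/
def orientedConjugacy : Setoid C(I, I) where
  r f g := ∃ h : I ≃ₜ I, StrictMono h ∧ ∀ x : I, h (f x) = g (h x)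
  iseqv :=
    { refl := fun f => ⟨Homeomorph.refl I, fun _ _ hxy => hxy, fun _ => rfl⟩
      symm := by
        rintro f g ⟨h, hm, hc⟩
        refine ⟨h.symm, fun x y hxy => ?_, fun x => ?_⟩
        · rw [← hm.lt_iff_lt]
          simpa using hxy
        · apply h.injective
          simp [hc]
      trans := by
        rintro f g k ⟨h, hm, hc⟩ ⟨h', hm', hc'⟩
        exact ⟨h.trans h', hm'.comp hm, fun x => by simp [hc, hc']⟩ }

open Set Filter Topology

/-! Isomorphism of countable relational structures, `RelStructure.iso`, serves as a concrete
universal relation, and conjugacy is compared with it in both directions.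

Universality. For a continuous action, record which basic open sets of permutations contain an
element moving x into which basic open sets of the space. This is an injective equivariant map into
structures (`RelStructure.vaught_smul`, `RelStructure.injective_vaught`), hence a reduction of orbit
equivalence.

From maps to structures. A map f generates a countable invariant set: the endpoints of I, the local
extreme values, forward images, the ends of level sets over points already generated, the ends of
the fixed-point sets of iterates, and the ends of the gaps of the closure of all these. On a gap f
is constant or a monotone homeomorphism onto a gap, and each iterate fixes the gap pointwise or has
no fixed point in it (`adequate_structuralSet`). The code of f consists of the order on this set,
the action of f on it, and the directions in which iterates move points between its members. An
isomorphism of codes matches cuts, and continuity settles the limit points. Across gaps,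
homeomorphisms must be chosen equivariantly: a choice can be pushed forward and pulled back along f,
so the only obstruction is a periodic gap. There the return maps are increasing with equal sign,
hence conjugate (`OrderIso.exists_conj`). Zorn's lemma assembles the choices
(`exists_invariant_section`), giving `Matched.orientedConjugacy`.

From structures to maps. Order the finite sequences in `ColoredRat` lexicographically and colour
each by an initial part of the atomic type of its tuple of colours. Colours determine length, and
length together with order determines the parent, so a colour-preserving automorphism is a
back-and-forth system (`RelStructure.iso_of_orderIso`). Each sequence then becomes an interval in I
on which the map moves points to the right, with as many interior fixed points as its colour says.
Distinct intervals are separated by infinitely many fixed points, so a conjugacy recovers the order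
and the colours (`Weighting.exists_orderIso_of_orientedConjugacy`). -/

theorem BorelReducible.trans {X Y Z : Type*} [MeasurableSpace X] [MeasurableSpace Y]
    [MeasurableSpace Z] {E : Setoid X} {F : Setoid Y} {G : Setoid Z}
    (h₁ : BorelReducible E F) (h₂ : BorelReducible F G) : BorelReducible E G := by
  obtain ⟨φ, hφ, hE⟩ := h₁
  obtain ⟨ψ, hψ, hF⟩ := h₂
  exact ⟨ψ ∘ φ, hψ.comp hφ, fun x x' => (hE x x').trans (hF _ _)⟩

/-! ### Countable structures and the logic action -/

/-- The space of countable structures on `ℕ` with countably many relations of every arity. -/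
def RelStructure : Type := ℕ × List ℕ → Bool

namespace RelStructure

instance : TopologicalSpace RelStructure := inferInstanceAs (TopologicalSpace (ℕ × List ℕ → Bool))
instance : SecondCountableTopology RelStructure :=
  inferInstanceAs (SecondCountableTopology (ℕ × List ℕ → Bool))
instance : TopologicalSpace.IsCompletelyMetrizableSpace RelStructure :=
  inferInstanceAs (TopologicalSpace.IsCompletelyMetrizableSpace (ℕ × List ℕ → Bool))
instance : PolishSpace RelStructure := inferInstance
instance : MeasurableSpace RelStructure := inferInstanceAs (MeasurableSpace (ℕ × List ℕ → Bool))
instance : BorelSpace RelStructure := inferInstanceAs (BorelSpace (ℕ × List ℕ → Bool))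

/-- The logic action. -/
instance : MulAction (Equiv.Perm ℕ) RelStructure where
  smul h y := fun p => y (p.1, p.2.map h.symm)
  one_smul y := by
    funext p
    change y (p.1, p.2.map _) = y p
    congr 1
    ext1
    · rfl
    · exact List.map_id p.2
  mul_smul g h y := by
    funext p
    change y (p.1, p.2.map _) = y (p.1, (p.2.map _).map _)
    rw [List.map_map]
    rfl

theorem smul_apply (h : Equiv.Perm ℕ) (y : RelStructure) (n : ℕ) (s : List ℕ) :
    (h • y) (n, s) = y (n, s.map h.symm) := rfl

theorem isOpen_setOf_apply_eq (i j : ℕ) : IsOpen {h : Equiv.Perm ℕ | h i = j} :=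
  have : Continuous fun h : Equiv.Perm ℕ => h i :=
    (continuous_apply i).comp continuous_induced_dom
  (isOpen_discrete {j}).preimage this

theorem isOpen_setOf_map_symm_eq (s t : List ℕ) :
    IsOpen {h : Equiv.Perm ℕ | s.map h.symm = t} := by
  induction s generalizing t with
  | nil => simp
  | cons a s ih =>
    cases t with
    | nil => simp
    | cons b t =>
      have : {h : Equiv.Perm ℕ | (a :: s).map h.symm = b :: t} =
          {h | h b = a} ∩ {h | s.map h.symm = t} := by
        ext h
        simp [Equiv.symm_apply_eq]
        intro _
        exact eq_comm
      rw [this]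
      exact (isOpen_setOf_apply_eq b a).inter (ih t)

instance : ContinuousSMul (Equiv.Perm ℕ) RelStructure where
  continuous_smul := by
    refine continuous_pi fun p => ?_
    refine continuous_discrete_rng.2 fun b => ?_
    -- A coordinate of `h • y` reads only finitely many values of the inverse of `h`, so the product
    -- splits into clopen pieces according to the tuple `t` read.
    have : (fun a : Equiv.Perm ℕ × RelStructure => (a.1 • a.2) p) ⁻¹' {b} =
        ⋃ t : List ℕ, {h : Equiv.Perm ℕ | p.2.map h.symm = t} ×ˢ
          {y : RelStructure | y (p.1, t) = b} := by
      ext a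
      simp only [mem_preimage, mem_singleton_iff, mem_iUnion, mem_prod, mem_ofPred_eq,
        exists_eq_left']
      rfl
    rw [this]
    refine isOpen_iUnion fun t => (isOpen_setOf_map_symm_eq _ t).prod ?_
    exact (isOpen_discrete {b}).preimage
      (continuous_apply (A := fun _ : ℕ × List ℕ => Bool) (p.1, t))

/-- Isomorphism of countable structures. -/
abbrev iso : Setoid RelStructure := MulAction.orbitRel (Equiv.Perm ℕ) RelStructure

theorem isSInftyOrbitRel_iso : IsSInftyOrbitRel iso :=
  ⟨inferInstance, inferInstance, inferInstance, inferInstance, inferInstance, rfl⟩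

theorem iso_iff {y y' : RelStructure} :
    iso y y' ↔ ∃ π : Equiv.Perm ℕ, ∀ n s, y (n, s) = y' (n, s.map π) := by
  rw [MulAction.orbitRel_apply]
  constructor
  · rintro ⟨π, rfl⟩
    exact ⟨π⁻¹, fun n s => rfl⟩
  · rintro ⟨π, h⟩
    refine ⟨π⁻¹, ?_⟩
    funext p
    exact (h p.1 p.2).symm

/-! ### Every orbit equivalence relation reduces to isomorphism -/

section Universal

variable {Z : Type} [MulAction (Equiv.Perm ℕ) Z]

/-- The permutations sending `s` to the initial segment of `ℕ` of the same length. -/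
def enumerators (s : List ℕ) : Set (Equiv.Perm ℕ) :=
  {g | s.map g = List.range s.length}

open Classical in
/-- The structure recording which basic open sets of group elements move `x` into the open sets
of the sequence `U`. -/
noncomputable def vaught (U : ℕ → Set Z) (x : Z) : RelStructure := fun p =>
  decide (∃ g ∈ enumerators p.2, g • x ∈ U p.1)

/-- Right multiplication by `h` carries the enumerators of `s` onto those of `s.map h.symm`, which
is exactly the reindexing in the logic action. -/
theorem vaught_smul (U : ℕ → Set Z) (h : Equiv.Perm ℕ) (x : Z) :
    vaught U (h • x) = h • vaught U x := by
  funext ⟨n, s⟩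
  rw [smul_apply]
  simp only [vaught, decide_eq_decide]
  constructor
  · rintro ⟨g, hg, hx⟩
    refine ⟨g * h, ?_, by rwa [mul_smul]⟩
    simp only [enumerators, mem_ofPred_eq, List.map_map, List.length_map] at hg ⊢
    rw [← hg]
    congr 1
    ext i
    simp
  · rintro ⟨g, hg, hx⟩
    refine ⟨g * h⁻¹, ?_, by rwa [mul_smul, inv_smul_smul]⟩
    simp only [enumerators, mem_ofPred_eq, List.map_map, List.length_map] at hg ⊢
    rw [← hg]
    rfl

variable [TopologicalSpace Z] [ContinuousSMul (Equiv.Perm ℕ) Z]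

/-- The quantifier over uncountably many permutations is harmless: it is a union of open sets. -/
theorem measurable_vaught [MeasurableSpace Z] [BorelSpace Z] {U : ℕ → Set Z}
    (hU : ∀ n, IsOpen (U n)) : Measurable (vaught U) := by
  refine measurable_pi_lambda _ fun p => measurable_to_bool ?_
  have : (fun x => vaught U x p) ⁻¹' {true} =
      ⋃ g ∈ enumerators p.2, (fun x : Z => g • x) ⁻¹' U p.1 := by
    ext x
    simp [vaught]
  rw [this]
  exact (isOpen_biUnion fun g _ => (hU p.1).preimage (continuous_const_smul g)).measurableSet

/-- The enumerators of `List.range k` are the permutations fixing every number below `k`, and these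
form a neighbourhood basis at the identity. -/
theorem exists_enumerators_range_subset {V : Set (Equiv.Perm ℕ)} (hV : V ∈ 𝓝 1) :
    ∃ k, enumerators (List.range k) ⊆ V := by
  rw [nhds_induced, mem_comap] at hV
  obtain ⟨W, hW, hWV⟩ := hV
  rw [nhds_pi, Filter.mem_pi] at hW
  obtain ⟨A, hA, t, ht, hAt⟩ := hW
  obtain ⟨k, hk⟩ := hA.bddAbove
  refine ⟨k + 1, fun g hg => hWV (hAt fun i hi => ?_)⟩
  have hi' : i < k + 1 := Nat.lt_succ_of_le (hk hi)
  have hgi : g i = i := by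
    have h := congrArg (fun l => l[i]?) hg
    simpa [hi'] using h
  change g i ∈ t i
  rw [hgi]
  exact mem_of_mem_nhds (ht i)

/-- If `x ≠ x'`, regularity gives a basic set around `x` whose closure omits `x'`. Permutations near
the identity keep `x'` outside it, while the identity itself keeps `x` inside, so one coordinate
differs. -/
theorem injective_vaught [T3Space Z] {U : ℕ → Set Z}
    (hU : TopologicalSpace.IsTopologicalBasis (range U)) :
    Function.Injective (vaught U) := by
  intro x x' h
  by_contra hne
  obtain ⟨_, ⟨n, rfl⟩, hx, hcl⟩ :=
    hU.exists_closure_subset (isOpen_compl_singleton.mem_nhds (show x ∈ {x'}ᶜ from hne))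
  have hV : {g : Equiv.Perm ℕ | g • x' ∈ (closure (U n))ᶜ} ∈ 𝓝 1 := by
    refine IsOpen.mem_nhds (isClosed_closure.isOpen_compl.preimage
      (continuous_id.smul continuous_const)) ?_
    simp only [mem_ofPred_eq, one_smul]
    exact fun hx' => hcl hx' rfl
  obtain ⟨k, hk⟩ := exists_enumerators_range_subset hV
  have h1 := congrFun h (n, List.range k)
  simp only [vaught, decide_eq_decide] at h1
  obtain ⟨g, hg, hgx⟩ := h1.1 ⟨1, by simp [enumerators], by simpa using hx⟩
  exact hk hg (subset_closure hgx)

end Universal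

/-- An injective equivariant map reduces orbit equivalence: a group element relating two images
relates the points themselves. -/
theorem borelReducible_iso {Z : Type} [MeasurableSpace Z] {F : Setoid Z}
    (hF : IsSInftyOrbitRel F) : BorelReducible F iso := by
  obtain ⟨_, _, _, _, _, rfl⟩ := hF
  obtain ⟨b, hbc, -, hb⟩ := TopologicalSpace.exists_countable_basis Z
  -- The empty set makes the basis nonempty, so that it is the range of a sequence even when the
  -- space is empty.
  have hb' : TopologicalSpace.IsTopologicalBasis (insert ∅ b) :=
    hb.insert_empty
  obtain ⟨U, hU⟩ := (hbc.insert ∅).exists_eq_range (insert_nonempty ∅ b)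
  rw [hU] at hb'
  refine ⟨vaught U, measurable_vaught fun n => hb'.isOpen (mem_range_self n), fun x x' => ?_⟩
  rw [MulAction.orbitRel_apply, MulAction.orbitRel_apply]
  constructor
  · rintro ⟨g, rfl⟩
    exact ⟨g, (vaught_smul U g x').symm⟩
  · rintro ⟨g, hg⟩
    refine ⟨g, injective_vaught hb' ?_⟩
    rw [← hg]
    exact vaught_smul U g x'

theorem isUniversalSInftyOrbitRel_iso : IsUniversalSInftyOrbitRel iso :=
  ⟨isSInftyOrbitRel_iso, fun _ _ _ => borelReducible_iso⟩

end RelStructure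

/-! ### Equivariant choice over a self-map -/

/-- Equivariant sections exist as soon as they exist over forward orbits. -/
theorem exists_invariant_section {S Γ : Type*} (c : S → S) (τ : Γ → Γ) (p : S → Γ)
    (hp : ∀ s, p (c s) = τ (p s)) (good : S → Prop) (hc : ∀ s, good s → good (c s))
    (Δ : Set Γ) (hτ : ∀ γ ∈ Δ, τ γ ∈ Δ)
    (lift : ∀ γ ∈ Δ, ∀ s, good s → p s = τ γ → ∃ t, good t ∧ p t = γ ∧ c t = s)
    (orbit : ∀ γ ∈ Δ, ∃ i s, good s ∧ p s = τ^[i] γ ∧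
      ∀ m n, τ^[m] (p s) = τ^[n] (p s) → c^[m] s = c^[n] s) :
    ∃ D : Set S, (∀ s ∈ D, good s) ∧ (∀ s ∈ D, c s ∈ D) ∧ InjOn p D ∧ ∀ γ ∈ Δ, ∃ s ∈ D, p s = γ := by
  have hpn : ∀ n s, p (c^[n] s) = τ^[n] (p s) := fun n s =>
    (Function.Semiconj.iterate_right (f := p) (ga := c) (gb := τ) hp n) s
  have hcn : ∀ n s, good s → good (c^[n] s) := fun n s hs => by
    induction n with
    | zero => exact hs
    | succ n ih => rw [Function.iterate_succ_apply']; exact hc _ ih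
  -- The order is by inclusion on forward-invariant sets of good points meeting each fibre of `p` at
  -- most once. Maximality will force every fibre over `Δ` to be met.
  obtain ⟨D, hD⟩ := zorn_subset
    {D : Set S | (∀ s ∈ D, good s) ∧ (∀ s ∈ D, c s ∈ D) ∧ InjOn p D} (by
      intro C hC hchain
      refine ⟨⋃₀ C, ⟨?_, ?_, ?_⟩, fun s hs => subset_sUnion_of_mem hs⟩
      · rintro s ⟨D, hD, hs⟩
        exact (hC hD).1 s hs
      · rintro s ⟨D, hD, hs⟩
        exact ⟨D, hD, (hC hD).2.1 s hs⟩
      · rintro s ⟨D, hD, hs⟩ t ⟨D', hD', ht⟩ hst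
        rcases hchain.total hD hD' with h | h
        · exact (hC hD').2.2 (h hs) ht hst
        · exact (hC hD).2.2 hs (h ht) hst)
  obtain ⟨⟨hgood, hinv, hinj⟩, hmax⟩ := hD
  refine ⟨D, hgood, hinv, hinj, ?_⟩
  have extend : ∀ E : Set S, (∀ s ∈ E, good s) → (∀ s ∈ E, c s ∈ D ∪ E) → InjOn p E →
      (∀ s ∈ E, ∀ t ∈ D, p s ≠ p t) → E ⊆ D := by
    intro E h1 h2 h3 h4
    refine subset_union_right.trans (hmax (y := D ∪ E) ⟨?_, ?_, ?_⟩ subset_union_left)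
    · rintro s (hs | hs)
      exacts [hgood s hs, h1 s hs]
    · rintro s (hs | hs)
      exacts [Or.inl (hinv s hs), h2 s hs]
    · rintro s (hs | hs) t (ht | ht) hst
      exacts [hinj hs ht hst, (h4 t ht s hs hst.symm).elim, (h4 s hs t ht hst).elim, h3 hs ht hst]
  -- Once a later iterate of `γ` is covered, `lift` supplies a point one step earlier whose image
  -- already lies in `D`. Adding it preserves invariance, so maximality puts it in `D`.
  have back : ∀ i, ∀ γ ∈ Δ, (∃ s ∈ D, p s = τ^[i] γ) → ∃ s ∈ D, p s = γ := by
    intro i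
    induction i with
    | zero => exact fun γ _ h => h
    | succ i ih =>
      intro γ hγ h
      rw [Function.iterate_succ_apply] at h
      obtain ⟨s, hs, hsγ⟩ := ih (τ γ) (hτ γ hγ) h
      by_contra hne
      push Not at hne
      obtain ⟨t, htg, htp, htc⟩ := lift γ hγ s (hgood s hs) hsγ
      refine hne t (extend {t} ?_ ?_ (injOn_singleton _ _) ?_ rfl) htp
      · rintro _ rfl
        exact htg
      · rintro _ rfl
        exact Or.inl (htc ▸ hs)
      · rintro _ rfl t' ht' h
        exact hne t' ht' (h ▸ htp)
  intro γ hγ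
  obtain ⟨i, s, hs, hsp, hsc⟩ := orbit γ hγ
  -- Either the forward orbit meets what is already covered and one pulls back, or the whole orbit
  -- of `s` can be added. In the latter case injectivity on that orbit is the hypothesis `orbit`.
  by_cases hex : ∃ n, ∃ t ∈ D, p t = τ^[n] (p s)
  · obtain ⟨n, t, ht, htp⟩ := hex
    refine back (n + i) γ hγ ⟨t, ht, ?_⟩
    rw [htp, hsp, Function.iterate_add_apply]
  · push Not at hex
    refine back i γ hγ ⟨s, ?_, hsp⟩
    refine extend (range fun n => c^[n] s) ?_ ?_ ?_ ?_ ⟨0, rfl⟩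
    · rintro _ ⟨n, rfl⟩
      exact hcn n s hs
    · rintro _ ⟨n, rfl⟩
      exact Or.inr ⟨n + 1, Function.iterate_succ_apply' _ _ _⟩
    · rintro _ ⟨m, rfl⟩ _ ⟨n, rfl⟩ h
      simp only [hpn] at h
      exact hsc m n h
    · rintro _ ⟨n, rfl⟩ t ht h
      exact hex n t ht (h.symm.trans (hpn n s))

/-! ### Conjugacy of increasing homeomorphisms of the line -/

/-- An increasing homeomorphism of the line without fixed points, moving points to the right, is
conjugate to a translation. -/
theorem OrderIso.exists_conj_add_one (F : ℝ ≃o ℝ) (hF : ∀ x, x < F x) :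
    ∃ e : ℝ ≃o ℝ, ∀ r, e (r + 1) = F (e r) := by
  have hF0 : 0 < F 0 := hF 0
  have hstep : ∀ n : ℤ, ∀ x, (F ^ (n + 1)) x = (F ^ n) (F x) := fun n x => by
    rw [zpow_add_one]; rfl
  have hstep' : ∀ n : ℤ, ∀ x, (F ^ (n + 1)) x = F ((F ^ n) x) := fun n x => by
    rw [add_comm, zpow_one_add]; rfl
  have hmono : StrictMono fun n : ℤ => (F ^ n) 0 :=
    strictMono_int_of_lt_succ fun n => by
      rw [hstep]
      exact (F ^ n).strictMono hF0
  -- The fundamental domain `[0, 1)` is sent affinely to `[0, F 0)`, and the rest is forced by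
  -- equivariance.
  set E : ℝ → ℝ := fun r => (F ^ ⌊r⌋) (Int.fract r * F 0) with hE
  have hE_lo : ∀ r, (F ^ ⌊r⌋) 0 ≤ E r := fun r =>
    (F ^ ⌊r⌋).monotone (mul_nonneg (Int.fract_nonneg r) hF0.le)
  have hE_hi : ∀ r, E r < (F ^ (⌊r⌋ + 1)) 0 := fun r => by
    rw [hstep]
    refine (F ^ ⌊r⌋).strictMono ?_
    exact (mul_lt_mul_of_pos_right (Int.fract_lt_one r) hF0).trans_eq (one_mul _)
  have hEmono : StrictMono E := by
    intro r r' h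
    rcases (Int.floor_mono h.le).eq_or_lt with h' | h'
    · simp only [hE]
      rw [← h']
      refine (F ^ ⌊r⌋).strictMono (mul_lt_mul_of_pos_right ?_ hF0)
      rw [Int.fract, Int.fract, h']
      linarith
    · exact (hE_hi r).trans_le ((hmono.monotone h').trans (hE_lo r'))
  -- A bounded monotone orbit would converge to a fixed point of `F`.
  have hunb : ∀ x, ∃ n : ℕ, x < (F ^ n) 0 := by
    intro x
    rcases tendsto_atTop_of_monotone (f := fun n : ℕ => (F ^ n) 0) (by
      intro a b hab
      have := hmono.monotone (Int.ofNat_le.2 hab)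
      simpa using this) with h | ⟨l, h⟩
    · exact ((h.eventually_gt_atTop x).exists)
    · exfalso
      have h2 : Tendsto (fun n : ℕ => F ((F ^ n) 0)) atTop (𝓝 (F l)) :=
        (F.continuous.tendsto l).comp h
      have h3 : Tendsto (fun n : ℕ => (F ^ (n + 1)) 0) atTop (𝓝 l) :=
        h.comp (tendsto_add_atTop_nat 1)
      have h4 : (fun n : ℕ => (F ^ (n + 1)) 0) = fun n : ℕ => F ((F ^ n) 0) := by
        funext n
        rw [pow_succ']
        rfl
      rw [h4] at h3
      exact (hF l).ne (tendsto_nhds_unique h3 h2)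
  have hunb' : ∀ x, ∃ n : ℕ, (F⁻¹ ^ n) 0 ≤ x := by
    intro x
    have hinv : ∀ x, F (F⁻¹ x) = x := fun x => F.apply_symm_apply x
    rcases tendsto_atTop_of_antitone (f := fun n : ℕ => (F⁻¹ ^ n) 0) (by
      refine antitone_nat_of_succ_le fun n => ?_
      rw [pow_succ', ← hinv ((F⁻¹ ^ n) 0)]
      exact (hF _).le) with h | ⟨l, h⟩
    · exact ((h.eventually_le_atBot x).exists)
    · exfalso
      have h3 : Tendsto (fun n : ℕ => (F⁻¹ ^ (n + 1)) 0) atTop (𝓝 l) :=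
        h.comp (tendsto_add_atTop_nat 1)
      have h2 : Tendsto (fun n : ℕ => F ((F⁻¹ ^ (n + 1)) 0)) atTop (𝓝 (F l)) :=
        (F.continuous.tendsto l).comp h3
      have h4 : (fun n : ℕ => F ((F⁻¹ ^ (n + 1)) 0)) = fun n : ℕ => (F⁻¹ ^ n) 0 := by
        funext n
        rw [pow_succ']
        exact hinv _
      rw [h4] at h2
      exact (hF l).ne (tendsto_nhds_unique h h2)
  have hsurj : Function.Surjective E := by
    intro x
    obtain ⟨N, hN⟩ := hunb x
    obtain ⟨N', hN'⟩ := hunb' x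
    -- This `n` locates the translate of the fundamental domain containing `x`.
    obtain ⟨n, hn, hn'⟩ := Int.exists_greatest_of_bdd (P := fun n : ℤ => (F ^ n) 0 ≤ x)
      ⟨N, fun z hz => by
        by_contra hlt
        have := hmono (not_le.1 hlt)
        simp only [zpow_natCast] at this
        linarith⟩ ⟨-N', by simpa [zpow_neg] using hN'⟩
    have hn1 : x < (F ^ (n + 1)) 0 := by
      by_contra hlt
      have := hn' _ (not_lt.1 hlt)
      omega
    have hinv : ∀ y, (F ^ n) ((F ^ n).symm y) = y := fun y => (F ^ n).apply_symm_apply y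
    set t := (F ^ n).symm x with ht
    have ht0 : 0 ≤ t := by
      rw [ht, (F ^ n).le_symm_apply]
      exact hn
    have ht1 : t < F 0 := by
      rw [ht, (F ^ n).symm_apply_lt, ← hstep]
      exact hn1
    have hq0 : 0 ≤ t / F 0 := div_nonneg ht0 hF0.le
    have hq1 : t / F 0 < 1 := (div_lt_one hF0).2 ht1
    have hfl : ⌊(n : ℝ) + t / F 0⌋ = n := by
      rw [Int.floor_intCast_add, Int.floor_eq_zero_iff.2 ⟨hq0, hq1⟩, add_zero]
    refine ⟨n + t / F 0, ?_⟩
    simp only [hE]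
    rw [hfl, Int.fract, hfl, add_sub_cancel_left, div_mul_cancel₀ _ hF0.ne', hinv]
  refine ⟨hEmono.orderIsoOfSurjective E hsurj, fun r => ?_⟩
  simp only [StrictMono.coe_orderIsoOfSurjective, hE]
  rw [Int.floor_add_one, Int.fract_add_one, hstep']

/-- Both maps are conjugate to translation by one, so composing the two conjugacies suffices. -/
theorem OrderIso.exists_conj_of_lt {α β : Type*} [Preorder α] [Preorder β] (eα : α ≃o ℝ)
    (eβ : β ≃o ℝ) (F : α ≃o α) (G : β ≃o β) (hF : ∀ x, x < F x) (hG : ∀ y, y < G y) :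
    ∃ e : α ≃o β, ∀ x, e (F x) = G (e x) := by
  obtain ⟨u, hu⟩ := ((eα.symm.trans F).trans eα).exists_conj_add_one fun x => by
    simpa using eα.strictMono (hF (eα.symm x))
  obtain ⟨v, hv⟩ := ((eβ.symm.trans G).trans eβ).exists_conj_add_one fun x => by
    simpa using eβ.strictMono (hG (eβ.symm x))
  refine ⟨((eα.trans u.symm).trans v).trans eβ.symm, fun x => ?_⟩
  have h1 := hu (u.symm (eα x))
  simp only [OrderIso.apply_symm_apply, OrderIso.trans_apply, OrderIso.symm_apply_apply] at h1
  have h2 := hv (u.symm (eα x))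
  simp only [OrderIso.trans_apply] at h2
  simp only [OrderIso.trans_apply]
  rw [← h1, OrderIso.symm_apply_apply, h2, OrderIso.symm_apply_apply]

/-- Increasing self-homeomorphisms of lines which are both trivial, both move all points to the
right or both move all points to the left are conjugate. -/
theorem OrderIso.exists_conj {α β : Type*} [Preorder α] [Preorder β] (eα : α ≃o ℝ)
    (eβ : β ≃o ℝ) (F : α ≃o α) (G : β ≃o β)
    (h : ((∀ x, F x = x) ∧ ∀ y, G y = y) ∨ ((∀ x, x < F x) ∧ ∀ y, y < G y) ∨
      ((∀ x, F x < x) ∧ ∀ y, G y < y)) :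
    ∃ e : α ≃o β, ∀ x, e (F x) = G (e x) := by
  rcases h with ⟨hF, hG⟩ | ⟨hF, hG⟩ | ⟨hF, hG⟩
  · exact ⟨eα.trans eβ.symm, fun x => by rw [hF, hG]⟩
  · exact exists_conj_of_lt eα eβ F G hF hG
  -- Inverses of maps moving points left move points right, and a conjugacy of the inverses
  -- conjugates the maps.
  · obtain ⟨e, he⟩ := exists_conj_of_lt eα eβ F.symm G.symm
      (fun x => by simpa using hF (F.symm x)) (fun x => by simpa using hG (G.symm x))
    refine ⟨e, fun x => ?_⟩
    have := he (F x)
    rw [OrderIso.symm_apply_apply] at this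
    rw [this, OrderIso.apply_symm_apply]

/-! ### Matching the cuts of two sequences -/

section Cuts

variable {X : Type*} [LinearOrder X] {a b c : ℕ → X} {x y z : X}

/-- The cut of `x` in `a` corresponds to the cut of `y` in `b`. -/
def SameCut (a b : ℕ → X) (x y : X) : Prop := ∀ i, (a i < x ↔ b i < y) ∧ (x < a i ↔ y < b i)

theorem SameCut.refl (a : ℕ → X) (x : X) : SameCut a a x x := fun _ => ⟨Iff.rfl, Iff.rfl⟩

theorem SameCut.symm (h : SameCut a b x y) : SameCut b a y x := fun i => ⟨(h i).1.symm, (h i).2.symm⟩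

theorem SameCut.trans (h : SameCut a b x y) (h' : SameCut b c y z) : SameCut a c x z := fun i =>
  ⟨(h i).1.trans (h' i).1, (h i).2.trans (h' i).2⟩

theorem SameCut.of_imp (h₁ : ∀ i, a i < x → b i < y) (h₂ : ∀ i, x < a i → y < b i)
    (h₃ : ∀ i, a i = x → b i = y) : SameCut a b x y := by
  intro i
  rcases lt_trichotomy (a i) x with h | h | h
  · exact ⟨⟨h₁ i, fun _ => h⟩, ⟨h₂ i, fun h' => absurd (h₁ i h) h'.not_gt⟩⟩
  · exact ⟨⟨h₁ i, fun h' => absurd (h₃ i h) h'.ne⟩, ⟨h₂ i, fun h' => absurd (h₃ i h) h'.ne'⟩⟩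
  · exact ⟨⟨h₁ i, fun h' => absurd (h₂ i h) h'.not_gt⟩, ⟨h₂ i, fun _ => h⟩⟩

theorem SameCut.eq_iff (h : SameCut a b x y) (i : ℕ) : x = a i ↔ y = b i := by
  rw [eq_iff_le_not_lt, eq_iff_le_not_lt, ← not_lt, ← not_lt, (h i).1, (h i).2]

/-- The points with the same cut as `x`. -/
def cutCell (a : ℕ → X) (x : X) : Set X := {x' | SameCut a a x x'}

theorem mem_cutCell_self (a : ℕ → X) (x : X) : x ∈ cutCell a x := SameCut.refl a x

theorem cutCell_eq (h : SameCut a a x y) : cutCell a x = cutCell a y :=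
  Set.ext fun _ => ⟨fun h' => h.symm.trans h', fun h' => h.trans h'⟩

theorem sameCut_of_cutCell_eq (h : cutCell a x = cutCell a y) : SameCut a a x y := by
  have : y ∈ cutCell a x := h ▸ mem_cutCell_self a y
  exact this

/-- `a i < a j` are consecutive. -/
def Consecutive (a : ℕ → X) (i j : ℕ) : Prop := a i < a j ∧ ∀ k, ¬(a i < a k ∧ a k < a j)

/-- `x` is a two-sided limit of points of `a`, and not one of them. -/
structure TwoSided (a : ℕ → X) (x : X) : Prop where
  notMem : ∀ i, a i ≠ x
  left : ∃ i, a i < x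
  right : ∃ i, x < a i
  limit_left : ∀ u < x, ∃ k, u < a k ∧ a k < x
  limit_right : ∀ v, x < v → ∃ k, x < a k ∧ a k < v

/-- Every cut of `a` is one of a point of `a`, of a gap, or of a two-sided limit. -/
def CutClassified (a : ℕ → X) (x : X) : Prop :=
  (∃ i, x = a i) ∨ (∃ i j, Consecutive a i j ∧ x ∈ Ioo (a i) (a j)) ∨ TwoSided a x

variable (hlt : ∀ i j, a i < a j ↔ b i < b j)
include hlt

theorem eq_iff_eq_of_lt_iff_lt (i j : ℕ) : a i = a j ↔ b i = b j := by
  rw [eq_iff_le_not_lt, eq_iff_le_not_lt, ← not_lt, ← not_lt, hlt, hlt]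

theorem Consecutive.congr {i j : ℕ} (h : Consecutive a i j) : Consecutive b i j := by
  refine ⟨(hlt _ _).1 h.1, fun k hk => h.2 k ?_⟩
  rwa [hlt, hlt]

theorem sameCut_apply_iff (i : ℕ) : SameCut a b (a i) y ↔ y = b i := by
  refine ⟨fun h => (h.eq_iff i).1 rfl, ?_⟩
  rintro rfl
  exact fun j => ⟨hlt j i, hlt i j⟩

/-- No term of the sequence lies strictly between consecutive ones, so the comparisons with the two
ends decide all the others. -/
theorem sameCut_gap_iff {i j : ℕ} (h : Consecutive a i j) (hx : x ∈ Ioo (a i) (a j)) :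
    SameCut a b x y ↔ y ∈ Ioo (b i) (b j) := by
  refine ⟨fun hxy => ⟨(hxy i).1.1 hx.1, (hxy j).2.1 hx.2⟩, fun hy => SameCut.of_imp ?_ ?_ ?_⟩
  · intro k hk
    have : a k ≤ a i := not_lt.1 fun h' => h.2 k ⟨h', hk.trans hx.2⟩
    exact (not_lt.1 fun h' => this.not_gt ((hlt _ _).2 h')).trans_lt hy.1
  · intro k hk
    have : a j ≤ a k := not_lt.1 fun h' => h.2 k ⟨hx.1.trans hk, h'⟩
    exact hy.2.trans_le (not_lt.1 fun h' => this.not_gt ((hlt _ _).2 h'))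
  · rintro k rfl
    exact (h.2 k hx).elim

omit hlt in
theorem cutCell_apply (i : ℕ) : cutCell a (a i) = {a i} :=
  Set.ext fun _ => sameCut_apply_iff (fun _ _ => Iff.rfl) i

omit hlt in
theorem cutCell_gap {i j : ℕ} (h : Consecutive a i j) (hx : x ∈ Ioo (a i) (a j)) :
    cutCell a x = Ioo (a i) (a j) :=
  Set.ext fun _ => sameCut_gap_iff (fun _ _ => Iff.rfl) h hx

omit hlt in
theorem TwoSided.eq_of_sameCut (h : TwoSided a x) (hxy : SameCut a a x y) : x = y := by
  rcases lt_trichotomy x y with h' | h' | h'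
  · obtain ⟨k, hk, hk'⟩ := h.limit_right y h'
    exact absurd ((hxy k).1.2 hk') hk.not_gt
  · exact h'
  · obtain ⟨k, hk, hk'⟩ := h.limit_left y h'
    exact absurd ((hxy k).2.2 hk) hk'.not_gt

omit hlt in
theorem TwoSided.cutCell_eq (h : TwoSided a x) : cutCell a x = {x} :=
  Set.ext fun _ => ⟨fun h' => (h.eq_of_sameCut h').symm, fun h' => h' ▸ SameCut.refl a x⟩

/-- The kind of a cut is visible in the order pattern: if `y` were a term of `b` or in a gap of `b`,
then `x` would be the corresponding term of `a` or lie in the corresponding gap. -/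
theorem TwoSided.congr (h : TwoSided a x) (hxy : SameCut a b x y) (hy : CutClassified b y) :
    TwoSided b y := by
  rcases hy with ⟨i, rfl⟩ | ⟨i, j, hij, hy⟩ | hy
  · exact absurd ((hxy.eq_iff i).2 rfl).symm (h.notMem i)
  · have hij' := Consecutive.congr (fun i j => (hlt i j).symm) hij
    obtain ⟨k, hk, hk'⟩ := h.limit_left _ ((hxy i).1.2 hy.1)
    exact (hij'.2 k ⟨hk, hk'.trans ((hxy j).2.2 hy.2)⟩).elim
  · exact hy

variable [TopologicalSpace X] [OrderTopology X] {f g : X → X}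

/-- Were `g y < b m`, continuity would give a term `b k` near `y` with `g (b k) < b m`. At terms the
inequality `a m ≤ f (a k)` transfers, a contradiction. Only a weak inequality survives this passage
to the limit. -/
theorem TwoSided.le_image {m : ℕ} (hf : ∀ j, ∃ k, f (a j) = a k ∧ g (b j) = b k)
    (hg : Continuous g) (hxy : SameCut a b x y) (hy : TwoSided b y)
    (h : ∃ p q, a p < x ∧ x < a q ∧ ∀ j, a p < a j → a j < a q → a m ≤ f (a j)) : b m ≤ g y := by
  obtain ⟨p, q, hp, hq, hpq⟩ := h
  by_contra hlt'
  have hN : g ⁻¹' Iio (b m) ∩ Ioo (b p) (b q) ∈ 𝓝 y :=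
    inter_mem (hg.continuousAt.preimage_mem_nhds (Iio_mem_nhds (not_le.1 hlt')))
      (Ioo_mem_nhds ((hxy p).1.1 hp) ((hxy q).2.1 hq))
  obtain ⟨i, hi⟩ := hy.left
  obtain ⟨l, hl, hlN⟩ := exists_Ioc_subset_of_mem_nhds hN ⟨_, hi⟩
  obtain ⟨k, hk, hk'⟩ := hy.limit_left l hl
  obtain ⟨hk1, hk2, hk3⟩ := hlN ⟨hk, hk'.le⟩
  obtain ⟨n, hn, hn'⟩ := hf k
  have h1 := hpq k ((hlt _ _).2 hk2) ((hlt _ _).2 hk3)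
  rw [hn, ← not_lt, hlt, not_lt, ← hn'] at h1
  exact h1.not_gt hk1

/-- Strictness comes from a term above `a k` that bounds `f` from below near `x`. If some term lies
strictly between `a k` and `f x`, it serves. Otherwise `f x` is itself a term, and values of `f` at
nearby terms, being terms above `a k`, cannot lie below it. -/
theorem TwoSided.lt_image {k : ℕ} (hf : ∀ j, ∃ k, f (a j) = a k ∧ g (b j) = b k)
    (hfc : Continuous f) (hg : Continuous g) (hx : TwoSided a x) (hxy : SameCut a b x y)
    (hy : TwoSided b y) (hfx : CutClassified a (f x)) (hk : a k < f x) : b k < g y := by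
  have key : ∀ U ∈ 𝓝 (f x), ∃ p q, a p < x ∧ x < a q ∧ ∀ j, a p < a j → a j < a q → f (a j) ∈ U := by
    intro U hU
    obtain ⟨i, hi⟩ := hx.left
    obtain ⟨j, hj⟩ := hx.right
    obtain ⟨u, v, ⟨hu, hv⟩, huv⟩ := (mem_nhds_iff_exists_Ioo_subset' ⟨_, hi⟩ ⟨_, hj⟩).1
      (hfc.continuousAt.preimage_mem_nhds hU)
    obtain ⟨p, hp, hp'⟩ := hx.limit_left u hu
    obtain ⟨q, hq, hq'⟩ := hx.limit_right v hv
    exact ⟨p, q, hp', hq, fun j hj hj' => huv ⟨hp.trans hj, hj'.trans hq'⟩⟩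
  by_cases hex : ∃ k', a k < a k' ∧ a k' < f x
  · obtain ⟨k', h1, h2⟩ := hex
    refine ((hlt _ _).1 h1).trans_le (TwoSided.le_image hlt hf hg hxy hy ?_)
    obtain ⟨p, q, hp, hq, hpq⟩ := key _ (Ioi_mem_nhds h2)
    exact ⟨p, q, hp, hq, fun j hj hj' => (hpq j hj hj').le⟩
  rcases hfx with ⟨m, hm⟩ | ⟨i, j, hij, hfx⟩ | hfx
  · rw [hm] at hk
    refine ((hlt _ _).1 hk).trans_le (TwoSided.le_image hlt hf hg hxy hy ?_)
    obtain ⟨p, q, hp, hq, hpq⟩ := key _ (Ioi_mem_nhds (hm ▸ hk))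
    refine ⟨p, q, hp, hq, fun j hj hj' => ?_⟩
    obtain ⟨n, hn, -⟩ := hf j
    have h1 := hpq j hj hj'
    rw [hn] at h1 ⊢
    exact not_lt.1 fun h' => hex ⟨n, h1, hm ▸ h'⟩
  -- Terms near `x` have terms as images, which would fall inside the gap.
  · obtain ⟨p, q, hp, hq, hpq⟩ := key _ (Ioo_mem_nhds hfx.1 hfx.2)
    obtain ⟨l, hl, hl'⟩ := hx.limit_left _ hp
    obtain ⟨n, hn, -⟩ := hf l
    have := hpq l hl (hl'.trans hq)
    rw [hn] at this
    exact (hij.2 n this).elim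
  · obtain ⟨k', h⟩ := hfx.limit_left _ hk
    exact (hex ⟨k', h⟩).elim

end Cuts

section Dual

variable {X : Type*} [LinearOrder X] {a b : ℕ → X} {x y : X}

theorem SameCut.dual (h : SameCut a b x y) : SameCut (X := Xᵒᵈ) a b x y := fun i =>
  ⟨(h i).2, (h i).1⟩

theorem TwoSided.dual (h : TwoSided a x) : TwoSided (X := Xᵒᵈ) a x :=
  ⟨h.notMem, h.right, h.left, fun u hu => (h.limit_right u hu).imp fun _ => And.symm,
    fun u hu => (h.limit_left u hu).imp fun _ => And.symm⟩

theorem Consecutive.dual {i j : ℕ} (h : Consecutive a i j) : Consecutive (X := Xᵒᵈ) a j i :=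
  ⟨h.1, fun k hk => h.2 k hk.symm⟩

theorem CutClassified.dual (h : CutClassified a x) : CutClassified (X := Xᵒᵈ) a x := by
  rcases h with h | ⟨i, j, hij, hx⟩ | h
  · exact Or.inl h
  · exact Or.inr (Or.inl ⟨j, i, hij.dual, hx.2, hx.1⟩)
  · exact Or.inr (Or.inr h.dual)

variable [TopologicalSpace X] [OrderTopology X] {f g : X → X}

theorem TwoSided.image_lt (hlt : ∀ i j, a i < a j ↔ b i < b j) {k : ℕ}
    (hf : ∀ j, ∃ k, f (a j) = a k ∧ g (b j) = b k)
    (hfc : Continuous f) (hg : Continuous g) (hx : TwoSided a x) (hxy : SameCut a b x y)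
    (hy : TwoSided b y) (hfx : CutClassified a (f x)) (hk : f x < a k) : g y < b k :=
  TwoSided.lt_image (X := Xᵒᵈ) (f := f) (g := g) (a := a) (b := b) (fun i j => hlt j i) hf hfc hg
    hx.dual hxy.dual hy.dual hfx.dual hk

theorem TwoSided.sameCut_image (hlt : ∀ i j, a i < a j ↔ b i < b j)
    (hf : ∀ j, ∃ k, f (a j) = a k ∧ g (b j) = b k)
    (hfc : Continuous f) (hg : Continuous g) (hx : TwoSided a x) (hxy : SameCut a b x y)
    (hy : TwoSided b y) (hfx : CutClassified a (f x)) (hgy : CutClassified b (g y)) :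
    SameCut a b (f x) (g y) := by
  have hlt' := fun i j => (hlt i j).symm
  have hf' : ∀ j, ∃ k, g (b j) = b k ∧ f (a j) = a k := fun j => (hf j).imp fun _ => And.symm
  exact fun i => ⟨⟨TwoSided.lt_image hlt hf hfc hg hx hxy hy hfx,
      TwoSided.lt_image hlt' hf' hg hfc hy hxy.symm hx hgy⟩,
    ⟨TwoSided.image_lt hlt hf hfc hg hx hxy hy hfx,
      TwoSided.image_lt hlt' hf' hg hfc hy hxy.symm hx hgy⟩⟩

end Dual

/-! ### Adequate sets and matched sequences -/

/-- `A` is an invariant set of points of `I` which determines the dynamics of `f`. -/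
structure Adequate (f : C(I, I)) (A : Set I) : Prop where
  zero_mem : 0 ∈ A
  one_mem : 1 ∈ A
  map_mem : ∀ x ∈ A, f x ∈ A
  gap : ∀ x, x ∉ closure A → ∃ u ∈ A, ∃ v ∈ A, x ∈ Ioo u v ∧ ∀ t ∈ Ioo u v, t ∉ A
  mono : ∀ u ∈ A, ∀ v ∈ A, u < v → (∀ t ∈ Ioo u v, t ∉ A) →
    (∀ x ∈ Icc u v, f x = f u) ∨
      ((StrictMonoOn f (Icc u v) ∨ StrictAntiOn f (Icc u v)) ∧ ∀ x ∈ Ioo u v, f x ∉ A)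
  per : ∀ u ∈ A, ∀ v ∈ A, u < v → (∀ t ∈ Ioo u v, t ∉ A) → ∀ n,
    (∀ x ∈ Ioo u v, f^[n] x = x) ∨ ∀ x ∈ Ioo u v, f^[n] x ≠ x

/-- The relations recording the dynamics of `f` on a set of points. -/
def codeRel (f : C(I, I)) : ℕ → I → I → Prop
  | 0, x, y => x < y
  | 1, x, y => f x = y
  -- For `x < y` only the first disjunct can hold, for `y < x` only the second. A single relation
  -- thus records both upward and downward motion, according to the order of its arguments.
  | n + 2, x, y => (∃ t, x < t ∧ t < y ∧ t < f^[n] t) ∨ ∃ t, y < t ∧ t < x ∧ f^[n] t < t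

/-- The sequences `a` and `b` carry the same structure for `f` and `g`. -/
structure Matched (f g : C(I, I)) (a b : ℕ → I) : Prop where
  left : Adequate f (range a)
  right : Adequate g (range b)
  rel : ∀ n i j, codeRel f n (a i) (a j) ↔ codeRel g n (b i) (b j)

/-- A closure point approached from one side only would be an end of a gap, and the ends of gaps
belong to the set. -/
theorem Adequate.cutClassified {f : C(I, I)} {a : ℕ → I} (h : Adequate f (range a)) (x : I) :
    CutClassified a x := by
  by_cases hx : x ∈ range a
  · obtain ⟨i, rfl⟩ := hx
    exact Or.inl ⟨i, rfl⟩
  right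
  by_cases hc : x ∈ closure (range a)
  · right
    -- A point of an interval free of terms lies in a gap with ends in the sequence. That gap cannot
    -- contain `x`, which is a limit of terms.
    have hnear : ∀ u v, u < v → (∀ k, ¬(u < a k ∧ a k < v)) → ∀ z ∈ Ioo u v,
        ∃ i j, a i < z ∧ z < a j ∧ ¬(a i < x ∧ x < a j) := by
      intro u v huv hk z hz
      have hz' : z ∉ closure (range a) := by
        rw [mem_closure_iff]
        push Not
        refine ⟨Ioo u v, isOpen_Ioo, hz, ?_⟩
        rw [← not_nonempty_iff_eq_empty]
        rintro ⟨_, ht, ⟨k, rfl⟩⟩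
        exact hk k ht
      obtain ⟨_, ⟨i, rfl⟩, _, ⟨j, rfl⟩, hij, hd⟩ := h.gap z hz'
      refine ⟨i, j, hij.1, hij.2, fun hx' => ?_⟩
      obtain ⟨t, ht, ht'⟩ := mem_closure_iff.1 hc _ isOpen_Ioo hx'
      exact hd t ht ht'
    have hne : ∀ i, a i ≠ x := fun i hi => hx ⟨i, hi⟩
    refine ⟨hne, ?_, ?_, ?_, ?_⟩
    · obtain ⟨i, hi⟩ := h.zero_mem
      exact ⟨i, lt_of_le_of_ne (hi ▸ unitInterval.nonneg') (hne i)⟩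
    · obtain ⟨i, hi⟩ := h.one_mem
      exact ⟨i, lt_of_le_of_ne (hi ▸ unitInterval.le_one') (hne i).symm⟩
    · intro u hu
      by_contra! hk
      obtain ⟨z, hz⟩ := exists_between hu
      obtain ⟨i, j, hi, hj, hij⟩ := hnear u x hu (fun k hk' => (hk k hk'.1).not_gt hk'.2) z hz
      refine hij ⟨hi.trans hz.2, lt_of_le_of_ne (hk j (hz.1.trans hj)) (hne j).symm⟩
    · intro v hv
      by_contra! hk
      obtain ⟨z, hz⟩ := exists_between hv
      obtain ⟨i, j, hi, hj, hij⟩ := hnear x v hv (fun k hk' => (hk k hk'.1).not_gt hk'.2) z hz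
      refine hij ⟨lt_of_le_of_ne (not_lt.1 fun h' => (hk i h').not_gt (hi.trans hz.2)) (hne i),
        hz.1.trans hj⟩
  · left
    obtain ⟨_, ⟨i, rfl⟩, _, ⟨j, rfl⟩, hij, hd⟩ := h.gap x hc
    exact ⟨i, j, ⟨hij.1.trans hij.2, fun k hk => hd _ hk ⟨k, rfl⟩⟩, hij⟩

theorem TwoSided.mem_closure {X : Type*} [LinearOrder X] [TopologicalSpace X] [OrderTopology X]
    {a : ℕ → X} {x : X} (h : TwoSided a x) : x ∈ closure (range a) := by
  rw [mem_closure_iff_nhds]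
  intro U hU
  obtain ⟨i, hi⟩ := h.left
  obtain ⟨l, hl, hlU⟩ := exists_Ioc_subset_of_mem_nhds hU ⟨_, hi⟩
  obtain ⟨k, hk, hk'⟩ := h.limit_left l hl
  exact ⟨a k, hlU ⟨hk, hk'.le⟩, k, rfl⟩

theorem Adequate.map_mem_closure {f : C(I, I)} {A : Set I} (h : Adequate f A) {x : I}
    (hx : x ∈ closure A) : f x ∈ closure A :=
  closure_mono (image_subset_iff.2 h.map_mem)
    (image_closure_subset_closure_image f.continuous (mem_image_of_mem f hx))

theorem Adequate.cutCell_image_of_twoSided {f : C(I, I)} {a : ℕ → I} (h : Adequate f (range a))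
    {x : I} (hx : TwoSided a x) : cutCell a (f x) = {f x} := by
  rcases h.cutClassified (f x) with ⟨i, hi⟩ | ⟨i, j, hij, hfx⟩ | hfx
  · rw [hi, cutCell_apply]
  · obtain ⟨_, ht, k, rfl⟩ :=
      mem_closure_iff.1 (h.map_mem_closure hx.mem_closure) _ isOpen_Ioo hfx
    exact (hij.2 k ht).elim
  · exact hfx.cutCell_eq

namespace Matched

variable {f g : C(I, I)} {a b : ℕ → I} (M : Matched f g a b) {x y : I}
include M

theorem symm : Matched g f b a := ⟨M.right, M.left, fun n i j => (M.rel n i j).symm⟩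

theorem lt_iff (i j : ℕ) : a i < a j ↔ b i < b j := M.rel 0 i j

theorem map (j : ℕ) : ∃ k, f (a j) = a k ∧ g (b j) = b k := by
  obtain ⟨k, hk⟩ := M.left.map_mem _ ⟨j, rfl⟩
  exact ⟨k, hk.symm, (M.rel 1 j k).1 hk.symm⟩

theorem exists_sameCut (x : I) : ∃ y, SameCut a b x y := by
  rcases M.left.cutClassified x with ⟨i, rfl⟩ | ⟨i, j, hij, hx⟩ | hx
  · exact ⟨b i, (sameCut_apply_iff M.lt_iff i).2 rfl⟩
  · obtain ⟨y, hy⟩ := exists_between ((M.lt_iff i j).1 hij.1)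
    exact ⟨y, (sameCut_gap_iff M.lt_iff hij hx).2 hy⟩
  · have hle : ∀ k, x < a k → sSup (b '' {i | a i < x}) ≤ b k := by
      intro k hk
      refine sSup_le ?_
      rintro _ ⟨i, hi, rfl⟩
      exact ((M.lt_iff i k).1 (lt_trans hi hk)).le
    -- Two-sidedness inserts a further term on each side of `x`, which makes the comparisons with
    -- the supremum strict.
    refine ⟨sSup (b '' {i | a i < x}), SameCut.of_imp ?_ ?_ fun i hi => (hx.notMem i hi).elim⟩
    · intro i hi
      obtain ⟨k, hk, hk'⟩ := hx.limit_left _ hi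
      exact ((M.lt_iff i k).1 hk).trans_le (le_sSup ⟨k, hk', rfl⟩)
    · intro i hi
      obtain ⟨k, hk, hk'⟩ := hx.limit_right _ hi
      exact (hle k hk).trans_lt ((M.lt_iff k i).1 hk')

/-- Comparing the values at the two ends tells the constant, increasing and decreasing cases apart,
and the code determines that comparison. The image of a gap is again a gap because no interior value
belongs to the set. -/
theorem gap_image {i j : ℕ} (hij : Consecutive a i j) :
    (∃ m, (∀ x ∈ Icc (a i) (a j), f x = a m) ∧ ∀ y ∈ Icc (b i) (b j), g y = b m) ∨
    ∃ m n, Consecutive a m n ∧ f '' Ioo (a i) (a j) = Ioo (a m) (a n) ∧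
      g '' Ioo (b i) (b j) = Ioo (b m) (b n) ∧
      ((StrictMonoOn f (Ioo (a i) (a j)) ∧ StrictMonoOn g (Ioo (b i) (b j))) ∨
        (StrictAntiOn f (Ioo (a i) (a j)) ∧ StrictAntiOn g (Ioo (b i) (b j)))) := by
  have hij' := Consecutive.congr M.lt_iff hij
  have hle := hij.1.le
  have hle' := hij'.1.le
  obtain ⟨m, hm, hm'⟩ := M.map i
  obtain ⟨n, hn, hn'⟩ := M.map j
  have hgap : ∀ {c : ℕ → I}, Consecutive c i j → ∀ t ∈ Ioo (c i) (c j), t ∉ range c := by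
    rintro c hc _ ht ⟨k, rfl⟩
    exact hc.2 k ht
  have hF := M.left.mono _ ⟨i, rfl⟩ _ ⟨j, rfl⟩ hij.1 (hgap hij)
  have hG := M.right.mono _ ⟨i, rfl⟩ _ ⟨j, rfl⟩ hij'.1 (hgap hij')
  have hmn := M.lt_iff m n
  have hnm := M.lt_iff n m
  have si : ∀ {c : ℕ → I}, c i ≤ c j → c i ∈ Icc (c i) (c j) ∧ c j ∈ Icc (c i) (c j) :=
    fun h => ⟨left_mem_Icc.2 h, right_mem_Icc.2 h⟩
  have monoImage : ∀ {F : C(I, I)} {u v : I}, u < v → StrictMonoOn F (Icc u v) →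
      F '' Ioo u v = Ioo (F u) (F v) := by
    intro F u v huv hF
    refine Subset.antisymm ?_ (intermediate_value_Ioo huv.le F.continuous.continuousOn)
    rintro _ ⟨t, ht, rfl⟩
    exact ⟨hF (left_mem_Icc.2 huv.le) (Ioo_subset_Icc_self ht) ht.1,
      hF (Ioo_subset_Icc_self ht) (right_mem_Icc.2 huv.le) ht.2⟩
  have antiImage : ∀ {F : C(I, I)} {u v : I}, u < v → StrictAntiOn F (Icc u v) →
      F '' Ioo u v = Ioo (F v) (F u) := by
    intro F u v huv hF
    refine Subset.antisymm ?_ (intermediate_value_Ioo' huv.le F.continuous.continuousOn)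
    rintro _ ⟨t, ht, rfl⟩
    exact ⟨hF (Ioo_subset_Icc_self ht) (right_mem_Icc.2 huv.le) ht.2,
      hF (left_mem_Icc.2 huv.le) (Ioo_subset_Icc_self ht) ht.1⟩
  have consec : ∀ p q, a p < a q → f '' Ioo (a i) (a j) = Ioo (a p) (a q) →
      (∀ x ∈ Ioo (a i) (a j), f x ∉ range a) → Consecutive a p q := by
    refine fun p q hpq him hno => ⟨hpq, fun k hk => ?_⟩
    have : a k ∈ f '' Ioo (a i) (a j) := him ▸ hk
    obtain ⟨t, ht, htk⟩ := this
    exact hno t ht ⟨k, htk.symm⟩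
  have sub := @Ioo_subset_Icc_self I _
  rcases hF with hF | ⟨hF | hF, hno⟩
  · have h1 : a n = a m := by rw [← hm, ← hn]; exact hF _ (si hle).2
    have h2 : b n = b m := (eq_iff_eq_of_lt_iff_lt M.lt_iff n m).1 h1
    rcases hG with hG | ⟨hG | hG, -⟩
    · exact Or.inl ⟨m, fun x hx => (hF x hx).trans hm, fun x hx => (hG x hx).trans hm'⟩
    · have := hG (si hle').1 (si hle').2 hij'.1
      rw [hm', hn', h2] at this
      exact (lt_irrefl _ this).elim
    · have := hG (si hle').1 (si hle').2 hij'.1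
      rw [hm', hn', h2] at this
      exact (lt_irrefl _ this).elim
  · have h1 : a m < a n := by rw [← hm, ← hn]; exact hF (si hle).1 (si hle).2 hij.1
    have h2 := hmn.1 h1
    rcases hG with hG | ⟨hG | hG, -⟩
    · have := hG _ (si hle').2
      rw [hm', hn'] at this
      exact (h2.ne' this).elim
    · right
      have hi := monoImage hij.1 hF
      have hi' := monoImage hij'.1 hG
      rw [hm, hn] at hi
      rw [hm', hn'] at hi'
      exact ⟨m, n, consec m n h1 hi hno, hi, hi', Or.inl ⟨hF.mono sub, hG.mono sub⟩⟩
    · have := hG (si hle').1 (si hle').2 hij'.1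
      rw [hm', hn'] at this
      exact (this.not_gt h2).elim
  · have h1 : a n < a m := by rw [← hm, ← hn]; exact hF (si hle).1 (si hle).2 hij.1
    have h2 := hnm.1 h1
    rcases hG with hG | ⟨hG | hG, -⟩
    · have := hG _ (si hle').2
      rw [hm', hn'] at this
      exact (h2.ne this).elim
    · have := hG (si hle').1 (si hle').2 hij'.1
      rw [hm', hn'] at this
      exact (this.not_gt h2).elim
    · right
      have hi := antiImage hij.1 hF
      have hi' := antiImage hij'.1 hG
      rw [hm, hn] at hi
      rw [hm', hn'] at hi'
      exact ⟨n, m, consec n m h1 hi hno, hi, hi', Or.inr ⟨hF.mono sub, hG.mono sub⟩⟩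

theorem sameCut_image (h : SameCut a b x y) : SameCut a b (f x) (g y) := by
  rcases M.left.cutClassified x with ⟨i, rfl⟩ | ⟨i, j, hij, hx⟩ | hx
  · obtain ⟨k, hk, hk'⟩ := M.map i
    rw [(h.eq_iff i).1 rfl, hk, hk']
    exact (sameCut_apply_iff M.lt_iff k).2 rfl
  · have hy := (sameCut_gap_iff M.lt_iff hij hx).1 h
    rcases M.gap_image hij with ⟨m, hf, hg⟩ | ⟨m, n, hmn, hf, hg, -⟩
    · rw [hf x (Ioo_subset_Icc_self hx), hg y (Ioo_subset_Icc_self hy)]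
      exact (sameCut_apply_iff M.lt_iff m).2 rfl
    · exact (sameCut_gap_iff M.lt_iff hmn (hf ▸ mem_image_of_mem f hx)).2
        (hg ▸ mem_image_of_mem g hy)
  · exact TwoSided.sameCut_image M.lt_iff M.map f.continuous g.continuous hx h
      (hx.congr M.lt_iff h (M.right.cutClassified y)) (M.left.cutClassified _)
      (M.right.cutClassified _)

theorem sameCut_iterate (h : SameCut a b x y) (n : ℕ) : SameCut a b (f^[n] x) (g^[n] y) := by
  induction n with
  | zero => exact h
  | succ n ih =>
    rw [Function.iterate_succ_apply', Function.iterate_succ_apply']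
    exact M.sameCut_image ih

/-- Cells other than gaps are single points, so `gap_image` carries all the content. Agreement of
the monotonicity type for `f` and `g` is what lets graphs of order isomorphisms be transported. -/
theorem cell_alternative (h : SameCut a b x y) :
    f '' cutCell a x = cutCell a (f x) ∧ g '' cutCell b y = cutCell b (g y) ∧
    (((f '' cutCell a x).Subsingleton ∧ (g '' cutCell b y).Subsingleton) ∨
      (StrictMonoOn f (cutCell a x) ∧ StrictMonoOn g (cutCell b y)) ∨
      (StrictAntiOn f (cutCell a x) ∧ StrictAntiOn g (cutCell b y))) := by
  rcases M.left.cutClassified x with ⟨i, rfl⟩ | ⟨i, j, hij, hx⟩ | hx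
  · obtain ⟨k, hk, hk'⟩ := M.map i
    rw [(h.eq_iff i).1 rfl, cutCell_apply, cutCell_apply, image_singleton, image_singleton, hk, hk',
      cutCell_apply, cutCell_apply]
    exact ⟨rfl, rfl, Or.inl ⟨subsingleton_singleton, subsingleton_singleton⟩⟩
  · have hij' := Consecutive.congr M.lt_iff hij
    have hy := (sameCut_gap_iff M.lt_iff hij hx).1 h
    rw [cutCell_gap hij hx, cutCell_gap hij' hy]
    rcases M.gap_image hij with ⟨m, hf, hg⟩ | ⟨m, n, hmn, hf, hg, hfg⟩
    · have hf' : f '' Ioo (a i) (a j) = {a m} :=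
        Subset.antisymm (by rintro _ ⟨t, ht, rfl⟩; exact hf t (Ioo_subset_Icc_self ht))
          (by rintro _ rfl; exact ⟨x, hx, hf x (Ioo_subset_Icc_self hx)⟩)
      have hg' : g '' Ioo (b i) (b j) = {b m} :=
        Subset.antisymm (by rintro _ ⟨t, ht, rfl⟩; exact hg t (Ioo_subset_Icc_self ht))
          (by rintro _ rfl; exact ⟨y, hy, hg y (Ioo_subset_Icc_self hy)⟩)
      rw [hf', hg', hf x (Ioo_subset_Icc_self hx), hg y (Ioo_subset_Icc_self hy), cutCell_apply,
        cutCell_apply]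
      exact ⟨rfl, rfl, Or.inl ⟨subsingleton_singleton, subsingleton_singleton⟩⟩
    · have hmn' := Consecutive.congr M.lt_iff hmn
      have hfx : f x ∈ Ioo (a m) (a n) := hf ▸ mem_image_of_mem f hx
      have hgy : g y ∈ Ioo (b m) (b n) := hg ▸ mem_image_of_mem g hy
      rw [cutCell_gap hmn hfx, cutCell_gap hmn' hgy]
      exact ⟨hf, hg, Or.inr hfg⟩
  · have hy := hx.congr M.lt_iff h (M.right.cutClassified y)
    rw [hx.cutCell_eq, hy.cutCell_eq, image_singleton, image_singleton]
    exact ⟨(M.left.cutCell_image_of_twoSided hx).symm, (M.right.cutCell_image_of_twoSided hy).symm,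
      Or.inl ⟨subsingleton_singleton, subsingleton_singleton⟩⟩

/-! ### Equivariant order isomorphisms between cells -/

/-- The order isomorphisms between corresponding cells, as graphs. -/
def _root_.CellIso (a b : ℕ → I) (x y : I) (θ : Set (I × I)) : Prop :=
  Prod.fst '' θ = cutCell a x ∧ Prod.snd '' θ = cutCell b y ∧
    ∀ p ∈ θ, ∀ q ∈ θ, cmp p.1 q.1 = cmp p.2 q.2

theorem cellIso_image (h : SameCut a b x y) {θ : Set (I × I)} (hθ : CellIso a b x y θ) :
    CellIso a b (f x) (g y) (Prod.map f g '' θ) := by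
  obtain ⟨h1, h2, h3⟩ := hθ
  obtain ⟨hf, hg, halt⟩ := M.cell_alternative h
  refine ⟨?_, ?_, ?_⟩
  · rw [image_image, ← hf, ← h1, image_image]
    rfl
  · rw [image_image, ← hg, ← h2, image_image]
    rfl
  · rintro _ ⟨p, hp, rfl⟩ _ ⟨q, hq, rfl⟩
    have hp1 : p.1 ∈ cutCell a x := h1 ▸ mem_image_of_mem _ hp
    have hq1 : q.1 ∈ cutCell a x := h1 ▸ mem_image_of_mem _ hq
    have hp2 : p.2 ∈ cutCell b y := h2 ▸ mem_image_of_mem _ hp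
    have hq2 : q.2 ∈ cutCell b y := h2 ▸ mem_image_of_mem _ hq
    simp only [Prod.map_fst, Prod.map_snd]
    rcases halt with ⟨hs, hs'⟩ | ⟨hm, hm'⟩ | ⟨hm, hm'⟩
    · rw [hs (mem_image_of_mem f hp1) (mem_image_of_mem f hq1),
        hs' (mem_image_of_mem g hp2) (mem_image_of_mem g hq2), cmp_self_eq_eq, cmp_self_eq_eq]
    · rw [hm.cmp_map_eq hp1 hq1, hm'.cmp_map_eq hp2 hq2, h3 p hp q hq]
    · rw [hm.cmp_map_eq hp1 hq1, hm'.cmp_map_eq hp2 hq2, h3 q hq p hp]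

omit M in
theorem _root_.CellIso.congr {x' y' : I} {θ : Set (I × I)} (hθ : CellIso a b x y θ)
    (hx : SameCut a a x x') (hy : SameCut b b y y') : CellIso a b x' y' θ :=
  ⟨hθ.1.trans (cutCell_eq hx), hθ.2.1.trans (cutCell_eq hy), hθ.2.2⟩

omit M in
theorem _root_.CellIso.of_orderIso (e : cutCell a x ≃o cutCell b y) :
    CellIso a b x y (range fun t : cutCell a x => ((t : I), (e t : I))) := by
  refine ⟨?_, ?_, ?_⟩
  · rw [← range_comp]
    exact Subtype.range_coe
  · rw [← range_comp]
    change range (Subtype.val ∘ e) = _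
    rw [range_comp, e.surjective.range_eq, image_univ]
    exact Subtype.range_coe
  · rintro _ ⟨s, rfl⟩ _ ⟨t, rfl⟩
    exact (e.strictMono.cmp_map_eq s t).symm

omit M in
theorem _root_.CellIso.eq_singleton {θ : Set (I × I)} (hθ : CellIso a b x y θ) {s t : I}
    (hs : cutCell a x = {s}) (ht : cutCell b y = {t}) : θ = {(s, t)} := by
  obtain ⟨h1, h2, -⟩ := hθ
  have hsub : θ ⊆ {(s, t)} := by
    intro p hp
    have hp1 : p.1 ∈ cutCell a x := h1 ▸ mem_image_of_mem _ hp
    have hp2 : p.2 ∈ cutCell b y := h2 ▸ mem_image_of_mem _ hp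
    rw [hs] at hp1
    rw [ht] at hp2
    exact Prod.ext hp1 hp2
  refine (subset_singleton_iff_eq.1 hsub).resolve_left fun h => ?_
  rw [h, image_empty, hs] at h1
  exact (singleton_ne_empty s) h1.symm

/-- When the maps are injective on the cells, the lift is the preimage graph. When both collapse the
cells, any graph `θ₀` works, since only one graph exists between the one-point image cells. -/
theorem cellIso_lift (h : SameCut a b x y) {θ : Set (I × I)} (hθ : CellIso a b (f x) (g y) θ)
    {θ₀ : Set (I × I)} (hθ₀ : CellIso a b x y θ₀) :
    ∃ θ', CellIso a b x y θ' ∧ Prod.map f g '' θ' = θ := by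
  obtain ⟨hf, hg, halt⟩ := M.cell_alternative h
  have key : (∀ p ∈ cutCell a x ×ˢ cutCell b y, ∀ q ∈ cutCell a x ×ˢ cutCell b y,
      cmp (f p.1) (f q.1) = cmp (g p.2) (g q.2) → cmp p.1 q.1 = cmp p.2 q.2) →
      ∃ θ', CellIso a b x y θ' ∧ Prod.map f g '' θ' = θ := by
    obtain ⟨h1, h2, h3⟩ := hθ
    intro hcmp
    refine ⟨cutCell a x ×ˢ cutCell b y ∩ Prod.map f g ⁻¹' θ, ⟨?_, ?_, ?_⟩, ?_⟩
    · refine Subset.antisymm (by rintro _ ⟨p, hp, rfl⟩; exact hp.1.1) fun s hs => ?_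
      have : f s ∈ Prod.fst '' θ := by rw [h1, ← hf]; exact mem_image_of_mem f hs
      obtain ⟨q, hq, hqs⟩ := this
      have : q.2 ∈ g '' cutCell b y := by rw [hg, ← h2]; exact mem_image_of_mem _ hq
      obtain ⟨t, ht, htq⟩ := this
      refine ⟨(s, t), ⟨⟨hs, ht⟩, ?_⟩, rfl⟩
      change (f s, g t) ∈ θ
      rw [← hqs, htq]
      exact hq
    · refine Subset.antisymm (by rintro _ ⟨p, hp, rfl⟩; exact hp.1.2) fun t ht => ?_
      have : g t ∈ Prod.snd '' θ := by rw [h2, ← hg]; exact mem_image_of_mem g ht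
      obtain ⟨q, hq, hqt⟩ := this
      have : q.1 ∈ f '' cutCell a x := by rw [hf, ← h1]; exact mem_image_of_mem _ hq
      obtain ⟨s, hs, hsq⟩ := this
      refine ⟨(s, t), ⟨⟨hs, ht⟩, ?_⟩, rfl⟩
      change (f s, g t) ∈ θ
      rw [← hqt, hsq]
      exact hq
    · rintro p ⟨hp, hp'⟩ q ⟨hq, hq'⟩
      exact hcmp p hp q hq (h3 _ hp' _ hq')
    · refine Subset.antisymm (by rintro _ ⟨p, hp, rfl⟩; exact hp.2) fun q hq => ?_
      have : q.1 ∈ f '' cutCell a x := by rw [hf, ← h1]; exact mem_image_of_mem _ hq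
      obtain ⟨s, hs, hsq⟩ := this
      have : q.2 ∈ g '' cutCell b y := by rw [hg, ← h2]; exact mem_image_of_mem _ hq
      obtain ⟨t, ht, htq⟩ := this
      have hst : Prod.map f g (s, t) = q := Prod.ext hsq htq
      exact ⟨(s, t), ⟨⟨hs, ht⟩, by rw [mem_preimage, hst]; exact hq⟩, hst⟩
  rcases halt with ⟨hs, hs'⟩ | ⟨hm, hm'⟩ | ⟨hm, hm'⟩
  · refine ⟨θ₀, hθ₀, ?_⟩
    rw [hf] at hs
    rw [hg] at hs'
    have e1 := hs.eq_singleton_of_mem (mem_cutCell_self a (f x))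
    have e2 := hs'.eq_singleton_of_mem (mem_cutCell_self b (g y))
    rw [hθ.eq_singleton e1 e2, (M.cellIso_image h hθ₀).eq_singleton e1 e2]
  · refine key fun p hp q hq hpq => ?_
    rwa [hm.cmp_map_eq hp.1 hq.1, hm'.cmp_map_eq hp.2 hq.2] at hpq
  · refine key fun p hp q hq hpq => ?_
    rw [hm.cmp_map_eq hp.1 hq.1, hm'.cmp_map_eq hp.2 hq.2] at hpq
    rw [← cmp_swap, hpq, cmp_swap]

end Matched

theorem exists_orderIso_Ioo_real {u v : I} (h : u < v) : Nonempty (Ioo u v ≃o ℝ) := by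
  have h' : (u : ℝ) < v := h
  have e1 : Ioo u v ≃o Ioo (-1 : ℝ) 1 := by
    refine StrictMono.orderIsoOfSurjective
      (fun t => ⟨(2 * (t : I) - u - v) / (v - u), ?_, ?_⟩) ?_ ?_
    · rw [lt_div_iff₀ (sub_pos.2 h')]
      have : (u : ℝ) < (t : I) := t.2.1
      linarith
    · rw [div_lt_iff₀ (sub_pos.2 h')]
      have : ((t : I) : ℝ) < v := t.2.2
      linarith
    · intro s t hst
      have : ((s : I) : ℝ) < (t : I) := hst
      refine Subtype.mk_lt_mk.2 (div_lt_div_of_pos_right ?_ (sub_pos.2 h'))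
      linarith
    · rintro ⟨r, hr1, hr2⟩
      have hu := u.2.1
      have hv := v.2.2
      have hlo : (u : ℝ) < (u + v + r * (v - u)) / 2 := by nlinarith
      have hhi : (u + v + r * (v - u)) / 2 < (v : ℝ) := by nlinarith
      refine ⟨⟨⟨(u + v + r * (v - u)) / 2, ⟨hu.trans hlo.le, hhi.le.trans hv⟩⟩, hlo, hhi⟩,
        Subtype.ext ?_⟩
      have : (v : ℝ) - u ≠ 0 := (sub_pos.2 h').ne'
      simp only
      field_simp
      ring
  exact ⟨e1.trans (orderIsoIooNegOneOne ℝ).symm⟩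

namespace Matched

variable {f g : C(I, I)} {a b : ℕ → I} (M : Matched f g a b) {x y : I}
include M

theorem singleton_or_gap (h : SameCut a b x y) :
    (cutCell a x = {x} ∧ cutCell b y = {y}) ∨
    ∃ i j, Consecutive a i j ∧ Consecutive b i j ∧ cutCell a x = Ioo (a i) (a j) ∧
      cutCell b y = Ioo (b i) (b j) := by
  rcases M.left.cutClassified x with ⟨i, rfl⟩ | ⟨i, j, hij, hx⟩ | hx
  · left
    rw [(h.eq_iff i).1 rfl, cutCell_apply, cutCell_apply]
    exact ⟨rfl, rfl⟩
  · right
    have hij' := Consecutive.congr M.lt_iff hij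
    exact ⟨i, j, hij, hij', cutCell_gap hij hx,
      cutCell_gap hij' ((sameCut_gap_iff M.lt_iff hij hx).1 h)⟩
  · exact Or.inl ⟨hx.cutCell_eq, (hx.congr M.lt_iff h (M.right.cutClassified y)).cutCell_eq⟩

theorem exists_cellIso (h : SameCut a b x y) : ∃ θ, CellIso a b x y θ := by
  rcases M.singleton_or_gap h with ⟨h1, h2⟩ | ⟨i, j, hij, hij', h1, h2⟩
  · refine ⟨{(x, y)}, ?_, ?_, ?_⟩
    · rw [image_singleton, h1]
    · rw [image_singleton, h2]
    · rintro _ rfl _ rfl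
      rw [cmp_self_eq_eq, cmp_self_eq_eq]
  · obtain ⟨e⟩ := exists_orderIso_Ioo_real hij.1
    obtain ⟨e'⟩ := exists_orderIso_Ioo_real hij'.1
    exact ⟨_, CellIso.of_orderIso (((OrderIso.setCongr _ _ h1).trans (e.trans e'.symm)).trans
      (OrderIso.setCongr _ _ h2.symm))⟩

theorem image_iterate_cutCell (n : ℕ) (x : I) : f^[n] '' cutCell a x = cutCell a (f^[n] x) := by
  induction n with
  | zero => simp
  | succ n ih =>
    obtain ⟨y, hy⟩ := M.exists_sameCut (f^[n] x)
    rw [Function.iterate_succ', image_comp, ih, (M.cell_alternative hy).1]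
    rfl

theorem iterate_alternative (n : ℕ) (x : I) :
    (f^[n] '' cutCell a x).Subsingleton ∨ StrictMonoOn f^[n] (cutCell a x) ∨
      StrictAntiOn f^[n] (cutCell a x) := by
  induction n with
  | zero => exact Or.inr (Or.inl fun s _ t _ h => h)
  | succ n ih =>
    obtain ⟨y, hy⟩ := M.exists_sameCut (f^[n] x)
    have halt := (M.cell_alternative hy).2.2
    have hmaps : MapsTo f^[n] (cutCell a x) (cutCell a (f^[n] x)) :=
      M.image_iterate_cutCell n x ▸ mapsTo_image _ _
    rw [Function.iterate_succ']
    rcases halt with ⟨hs, -⟩ | h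
    · left
      rwa [image_comp, M.image_iterate_cutCell]
    rcases ih with hs | ih
    · left
      rw [image_comp]
      exact hs.image _
    right
    rcases ih with ih | ih <;> rcases h with ⟨h, -⟩ | ⟨h, -⟩
    · exact Or.inl (h.comp ih hmaps)
    · exact Or.inr (h.comp_strictMonoOn ih hmaps)
    · exact Or.inr (h.comp_strictAntiOn ih hmaps)
    · exact Or.inl (h.comp ih hmaps)

/-- For consecutive indices in increasing order the second disjunct of `codeRel` is vacuous, so the
relation reads off upward motion alone. -/
theorem up_iff {i j : ℕ} (hij : Consecutive a i j) (n : ℕ) :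
    (∃ t ∈ Ioo (a i) (a j), t < f^[n] t) ↔ ∃ t ∈ Ioo (b i) (b j), t < g^[n] t := by
  have hij' := Consecutive.congr M.lt_iff hij
  have := M.rel (n + 2) i j
  simp only [codeRel] at this
  constructor
  · rintro ⟨t, ht, ht'⟩
    rcases this.1 (Or.inl ⟨t, ht.1, ht.2, ht'⟩) with ⟨s, hs⟩ | ⟨s, hs, hs', -⟩
    · exact ⟨s, ⟨hs.1, hs.2.1⟩, hs.2.2⟩
    · exact (hij'.1.not_gt (hs.trans hs')).elim
  · rintro ⟨t, ht, ht'⟩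
    rcases this.2 (Or.inl ⟨t, ht.1, ht.2, ht'⟩) with ⟨s, hs⟩ | ⟨s, hs, hs', -⟩
    · exact ⟨s, ⟨hs.1, hs.2.1⟩, hs.2.2⟩
    · exact (hij.1.not_gt (hs.trans hs')).elim

theorem down_iff {i j : ℕ} (hij : Consecutive a i j) (n : ℕ) :
    (∃ t ∈ Ioo (a i) (a j), f^[n] t < t) ↔ ∃ t ∈ Ioo (b i) (b j), g^[n] t < t := by
  have hij' := Consecutive.congr M.lt_iff hij
  have := M.rel (n + 2) j i
  simp only [codeRel] at this
  constructor
  · rintro ⟨t, ht, ht'⟩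
    rcases this.1 (Or.inr ⟨t, ht.1, ht.2, ht'⟩) with ⟨s, hs, hs', -⟩ | ⟨s, hs⟩
    · exact (hij'.1.not_gt (hs.trans hs')).elim
    · exact ⟨s, ⟨hs.1, hs.2.1⟩, hs.2.2⟩
  · rintro ⟨t, ht, ht'⟩
    rcases this.2 (Or.inr ⟨t, ht.1, ht.2, ht'⟩) with ⟨s, hs, hs', -⟩ | ⟨s, hs⟩
    · exact (hij.1.not_gt (hs.trans hs')).elim
    · exact ⟨s, ⟨hs.1, hs.2.1⟩, hs.2.2⟩

-- If an iterate has no fixed point in the gap, moving one point up and another down is excluded by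
-- the intermediate value theorem.
omit M in
theorem _root_.Adequate.sign_alternative (h : Adequate f (range a)) {i j : ℕ}
    (hij : Consecutive a i j) (n : ℕ) :
    (∀ t ∈ Ioo (a i) (a j), f^[n] t = t) ∨ (∀ t ∈ Ioo (a i) (a j), t < f^[n] t) ∨
      ∀ t ∈ Ioo (a i) (a j), f^[n] t < t := by
  have hno : ∀ t ∈ Ioo (a i) (a j), t ∉ range a := by
    rintro _ ht ⟨k, rfl⟩
    exact hij.2 k ht
  rcases h.per _ ⟨i, rfl⟩ _ ⟨j, rfl⟩ hij.1 hno n with h | h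
  · exact Or.inl h
  right
  by_contra! hcon
  obtain ⟨⟨s, hs, hs'⟩, t, ht, ht'⟩ := hcon
  have hc : Continuous f^[n] := f.continuous.iterate n
  obtain ⟨r, hr, hr'⟩ := isPreconnected_Ioo.intermediate_value₂ hs ht hc.continuousOn
    continuousOn_id hs' ht'
  exact h r hr hr'

/-- A strictly monotone power of `f` permuting a gap is increasing there. -/
theorem strictMonoOn_of_image_eq {i j : ℕ} (hij : Consecutive a i j) {x : I}
    (hx : x ∈ Ioo (a i) (a j)) {n : ℕ} (h : f^[n] '' Ioo (a i) (a j) = Ioo (a i) (a j)) :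
    StrictMonoOn f^[n] (Ioo (a i) (a j)) := by
  have halt := M.iterate_alternative n x
  rw [cutCell_gap hij hx, h] at halt
  have hnt : ∃ s t, s ∈ Ioo (a i) (a j) ∧ t ∈ Ioo (a i) (a j) ∧ s < t := by
    obtain ⟨s, hs⟩ := exists_between hx.1
    exact ⟨s, x, ⟨hs.1, hs.2.trans hx.2⟩, hx, hs.2⟩
  obtain ⟨s, t, hs, ht, hst⟩ := hnt
  have hmem : ∀ t ∈ Ioo (a i) (a j), f^[n] t ∈ Ioo (a i) (a j) := fun t ht =>
    h ▸ mem_image_of_mem _ ht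
  rcases halt with halt | halt | halt
  · exact (hst.ne (halt hs ht)).elim
  · exact halt
  -- A decreasing return map cannot be the identity. If it moved all points one way, applying it to
  -- `s` and its image would reverse that inequality one step later.
  · rcases M.left.sign_alternative hij n with h' | h' | h'
    · have := halt hs ht hst
      rw [h' s hs, h' t ht] at this
      exact (this.not_gt hst).elim
    · have h1 := h' s hs
      exact ((h' _ (hmem s hs)).not_gt (halt hs (hmem s hs) h1)).elim
    · have h1 := h' s hs
      exact ((h' _ (hmem s hs)).not_gt (halt (hmem s hs) hs h1)).elim

omit M in
theorem _root_.image_prodMap_iterate (n : ℕ) (θ : Set (I × I)) :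
    (image (Prod.map f g))^[n] θ = Prod.map f^[n] g^[n] '' θ := by
  rw [← Set.image_iterate_eq, Prod.map_iterate]

/-- On a periodic gap both return maps are increasing bijections, and the code forces equal signs.
The graph of an order isomorphism conjugating them is invariant. -/
theorem exists_invariant_cellIso (h : SameCut a b x y) {n : ℕ}
    (hn : f^[n] '' cutCell a x = cutCell a x) :
    ∃ θ, CellIso a b x y θ ∧ Prod.map f^[n] g^[n] '' θ = θ := by
  have hx' : SameCut a a x (f^[n] x) := by
    rw [M.image_iterate_cutCell] at hn
    exact sameCut_of_cutCell_eq hn.symm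
  have hy' : SameCut b b y (g^[n] y) := h.symm.trans (hx'.trans (M.sameCut_iterate h n))
  have hn' : g^[n] '' cutCell b y = cutCell b y := by
    rw [M.symm.image_iterate_cutCell, cutCell_eq hy']
  rcases M.singleton_or_gap h with ⟨h1, h2⟩ | ⟨i, j, hij, hij', h1, h2⟩
  · obtain ⟨θ, hθ⟩ := M.exists_cellIso h
    refine ⟨θ, hθ, ?_⟩
    have e1 : f^[n] x ∈ cutCell a x := hx'
    have e2 : g^[n] y ∈ cutCell b y := hy'
    rw [h1] at e1
    rw [h2] at e2
    rw [hθ.eq_singleton h1 h2, image_singleton, Prod.map_apply, e1, e2]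
  · have hxm : x ∈ Ioo (a i) (a j) := h1 ▸ mem_cutCell_self a x
    have hym : y ∈ Ioo (b i) (b j) := h2 ▸ mem_cutCell_self b y
    have hF := M.strictMonoOn_of_image_eq hij hxm (h1 ▸ hn)
    have hG := M.symm.strictMonoOn_of_image_eq hij' hym (h2 ▸ hn')
    rw [← h1] at hF
    rw [← h2] at hG
    obtain ⟨eα⟩ := exists_orderIso_Ioo_real hij.1
    obtain ⟨eβ⟩ := exists_orderIso_Ioo_real hij'.1
    set F : cutCell a x ≃o cutCell a x := (hF.orderIso _ _).trans (OrderIso.setCongr _ _ hn) with hFd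
    set G : cutCell b y ≃o cutCell b y :=
      (hG.orderIso _ _).trans (OrderIso.setCongr _ _ hn') with hGd
    have hGa : ∀ t, (G t : I) = g^[n] t := fun t => rfl
    have hup := M.up_iff hij n
    have hdown := M.down_iff hij n
    obtain ⟨e, he⟩ := OrderIso.exists_conj ((OrderIso.setCongr _ _ h1).trans eα)
        ((OrderIso.setCongr _ _ h2).trans eβ) F G (by
      have mf : ∀ t : cutCell a x, (t : I) ∈ Ioo (a i) (a j) := fun t => h1 ▸ t.2
      have mg : ∀ t : cutCell b y, (t : I) ∈ Ioo (b i) (b j) := fun t => h2 ▸ t.2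
      -- The six mixed sign combinations contradict `hup` or `hdown`.
      rcases M.left.sign_alternative hij n with hs | hs | hs <;>
      rcases M.right.sign_alternative hij' n with hs' | hs' | hs'
      · exact Or.inl ⟨fun t => Subtype.ext (hs t (mf t)), fun t => Subtype.ext (hs' t (mg t))⟩
      · obtain ⟨t, ht, ht'⟩ := hup.2 ⟨y, hym, hs' y hym⟩
        exact (ht'.ne' (hs t ht)).elim
      · obtain ⟨t, ht, ht'⟩ := hdown.2 ⟨y, hym, hs' y hym⟩
        exact (ht'.ne (hs t ht)).elim
      · obtain ⟨t, ht, ht'⟩ := hup.1 ⟨x, hxm, hs x hxm⟩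
        exact (ht'.ne' (hs' t ht)).elim
      · exact Or.inr (Or.inl ⟨fun t => hs t (mf t), fun t => hs' t (mg t)⟩)
      · obtain ⟨t, ht, ht'⟩ := hup.1 ⟨x, hxm, hs x hxm⟩
        exact (ht'.not_gt (hs' t ht)).elim
      · obtain ⟨t, ht, ht'⟩ := hdown.1 ⟨x, hxm, hs x hxm⟩
        exact (ht'.ne (hs' t ht)).elim
      · obtain ⟨t, ht, ht'⟩ := hdown.1 ⟨x, hxm, hs x hxm⟩
        exact (ht'.not_gt (hs' t ht)).elim
      · exact Or.inr (Or.inr ⟨fun t => hs t (mf t), fun t => hs' t (mg t)⟩))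
    refine ⟨_, CellIso.of_orderIso e, ?_⟩
    rw [← range_comp]
    have : (Prod.map f^[n] g^[n] ∘ fun t : cutCell a x => ((t : I), (e t : I))) =
        (fun t : cutCell a x => ((t : I), (e t : I))) ∘ F := by
      funext t
      refine Prod.ext rfl ?_
      change g^[n] (e t) = e (F t)
      rw [he, hGa]
    rw [this, range_comp, F.surjective.range_eq, image_univ]

/-- Maps with the same structure on adequate sequences are conjugate. -/
theorem orientedConjugacy : orientedConjugacy f g := by
  -- The base consists of cells of `a`, the fibres of graphs over them. A section closed under the
  -- product map is an equivariant choice of one graph per cell.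
  obtain ⟨D, hgood, hinv, hinj, hex⟩ := exists_invariant_section
    (image (Prod.map f g)) (image f) (image Prod.fst)
    (fun θ => by simp only [image_image, Prod.map_fst])
    (fun θ => ∃ x y, SameCut a b x y ∧ CellIso a b x y θ)
    (fun θ => by
      rintro ⟨x, y, h, hθ⟩
      exact ⟨f x, g y, M.sameCut_image h, M.cellIso_image h hθ⟩)
    (range (cutCell a))
    (by
      rintro _ ⟨x, rfl⟩
      obtain ⟨y, hy⟩ := M.exists_sameCut x
      exact ⟨f x, (M.cell_alternative hy).1.symm⟩)
    (by
      rintro _ ⟨x, rfl⟩ θ ⟨x', y', h, hθ⟩ hθx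
      obtain ⟨y, hy⟩ := M.exists_sameCut x
      obtain ⟨θ₀, hθ₀⟩ := M.exists_cellIso hy
      rw [(M.cell_alternative hy).1, hθ.1] at hθx
      have hx' := sameCut_of_cutCell_eq hθx
      obtain ⟨θ', hθ', hθ''⟩ := M.cellIso_lift hy
        (hθ.congr hx' (h.symm.trans (hx'.trans (M.sameCut_image hy)))) hθ₀
      exact ⟨θ', ⟨x, y, hy, hθ'⟩, hθ'.1, hθ''⟩)
    (by
      rintro _ ⟨x, rfl⟩
      -- If the cell is eventually periodic, the section starts from an invariant graph over the
      -- periodic cell, so coincidences of cells modulo the period are coincidences of graphs.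
      -- Otherwise all forward images of the cell are distinct and any graph will do.
      by_cases hper : ∃ m, (image f)^[m] (cutCell a x) ∈ Function.periodicPts (image f)
      · obtain ⟨m, hm⟩ := hper
        rw [← Set.image_iterate_eq, M.image_iterate_cutCell] at hm
        obtain ⟨y, hy⟩ := M.exists_sameCut (f^[m] x)
        set K := cutCell a (f^[m] x) with hK
        have hk := Function.isPeriodicPt_minimalPeriod (image f) K
        have hkpos := Function.minimalPeriod_pos_of_mem_periodicPts hm
        set k := Function.minimalPeriod (image f) K with hkd
        have hk' : f^[k] '' K = K := by
          rw [Set.image_iterate_eq]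
          exact hk
        obtain ⟨θ, hθ, hθk⟩ := M.exists_invariant_cellIso hy hk'
        have hθp : Function.IsPeriodicPt (image (Prod.map f g)) k θ := by
          rw [Function.IsPeriodicPt, Function.IsFixedPt, image_prodMap_iterate]
          exact hθk
        refine ⟨m, θ, ⟨_, y, hy, hθ⟩, ?_, ?_⟩
        · rw [hθ.1, ← Set.image_iterate_eq, M.image_iterate_cutCell]
        · intro p q hpq
          rw [hθ.1, ← hK, ← Function.iterate_mod_minimalPeriod_eq (n := p),
            ← Function.iterate_mod_minimalPeriod_eq (n := q),
            Function.iterate_eq_iterate_iff_of_lt_minimalPeriod (Nat.mod_lt _ hkpos)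
              (Nat.mod_lt _ hkpos)] at hpq
          rw [← hθp.iterate_mod_apply p, ← hθp.iterate_mod_apply q, hpq]
      · obtain ⟨y, hy⟩ := M.exists_sameCut x
        obtain ⟨θ, hθ⟩ := M.exists_cellIso hy
        refine ⟨0, θ, ⟨x, y, hy, hθ⟩, hθ.1, ?_⟩
        have aux : ∀ m n, m < n →
            (image f)^[m] (cutCell a x) ≠ (image f)^[n] (cutCell a x) := by
          intro m n hmn h
          refine hper ⟨m, n - m, Nat.sub_pos_of_lt hmn, ?_⟩
          rw [Function.IsPeriodicPt, Function.IsFixedPt, ← Function.iterate_add_apply,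
            Nat.sub_add_cancel hmn.le, h]
        intro m n hmn
        rw [hθ.1] at hmn
        rcases lt_trichotomy m n with h | h | h
        · exact (aux m n h hmn).elim
        · rw [h]
        · exact (aux n m h hmn.symm).elim)
  have htot : ∀ x, ∃ y, ∃ θ ∈ D, (x, y) ∈ θ := by
    intro x
    obtain ⟨θ, hθ, hθx⟩ := hex _ ⟨x, rfl⟩
    have : x ∈ Prod.fst '' θ := hθx ▸ mem_cutCell_self a x
    obtain ⟨p, hp, rfl⟩ := this
    exact ⟨p.2, θ, hθ, hp⟩
  choose h T hT hmem using htot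
  have hcell : ∀ θ ∈ D, ∀ x y, (x, y) ∈ θ → SameCut a b x y ∧ CellIso a b x y θ := by
    intro θ hθ x y hxy
    obtain ⟨x', y', h', hθ'⟩ := hgood θ hθ
    have h1 : SameCut a a x' x := by
      have : x ∈ cutCell a x' := hθ'.1 ▸ mem_image_of_mem _ hxy
      exact this
    have h2 : SameCut b b y' y := by
      have : y ∈ cutCell b y' := hθ'.2.1 ▸ mem_image_of_mem _ hxy
      exact this
    exact ⟨h1.symm.trans (h'.trans h2), hθ'.congr h1 h2⟩
  have hsame : ∀ x, SameCut a b x (h x) := fun x => (hcell _ (hT x) _ _ (hmem x)).1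
  have huniq : ∀ θ ∈ D, ∀ θ' ∈ D, ∀ x x' y y', (x, y) ∈ θ → (x', y') ∈ θ' → SameCut a a x x' →
      θ = θ' := by
    intro θ hθ θ' hθ' x x' y y' h1 h2 h3
    refine hinj hθ hθ' ?_
    rw [(hcell θ hθ _ _ h1).2.1, (hcell θ' hθ' _ _ h2).2.1, cutCell_eq h3]
  have hmono : StrictMono h := by
    intro s t hst
    -- Within one cell the chosen graph preserves order. Distinct cells are separated by a
    -- comparison with some `a i`, which `h` respects.
    by_cases hc : SameCut a a s t
    · have e := huniq _ (hT s) _ (hT t) _ _ _ _ (hmem s) (hmem t) hc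
      have := (hcell _ (hT s) _ _ (hmem s)).2.2.2 _ (hmem s) _ (e ▸ hmem t)
      rwa [(cmp_eq_lt_iff _ _).2 hst, eq_comm, cmp_eq_lt_iff] at this
    · simp only [SameCut, not_forall] at hc
      obtain ⟨i, hi⟩ := hc
      have hs := hsame s i
      have ht := hsame t i
      by_contra hle
      have hle := not_lt.1 hle
      refine hi ⟨⟨fun h' => h'.trans hst, fun h' => hs.1.2 ?_⟩,
        ⟨fun h' => ht.2.2 ?_, fun h' => hst.trans h'⟩⟩
      · exact (ht.1.1 h').trans_le hle
      · exact hle.trans_lt (hs.2.1 h')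
  have hsurj : Function.Surjective h := by
    intro y
    obtain ⟨x, hx⟩ := M.symm.exists_sameCut y
    have h1 : y ∈ cutCell b (h x) := (hsame x).symm.trans hx.symm
    rw [← (hcell _ (hT x) _ _ (hmem x)).2.2.1] at h1
    obtain ⟨⟨s, t⟩, hst, rfl⟩ := h1
    refine ⟨s, ?_⟩
    have e := huniq _ (hT s) _ (hT x) _ _ _ _ (hmem s) hst (SameCut.refl a s)
    have := (hcell _ (hT x) _ _ (hmem x)).2.2.2 _ (e ▸ hmem s) _ hst
    rwa [cmp_self_eq_eq, eq_comm, cmp_eq_eq_iff] at this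
  refine ⟨(hmono.orderIsoOfSurjective h hsurj).toHomeomorph, hmono, fun x => ?_⟩
  change h (f x) = g (h x)
  have hmem' : (f x, g (h x)) ∈ Prod.map f g '' T x := ⟨_, hmem x, rfl⟩
  have e := huniq _ (hT (f x)) _ (hinv _ (hT x)) _ _ _ _ (hmem (f x)) hmem' (SameCut.refl a _)
  have := (hcell _ (hT (f x)) _ _ (hmem (f x))).2.2.2 _ (hmem (f x)) _ (e ▸ hmem')
  rwa [cmp_self_eq_eq, eq_comm, cmp_eq_eq_iff] at this

end Matched

/-! ### Borel selection of the ends of closed sets and gaps -/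

section Ends

variable {X : Type*} [LinearOrder X]

/-- `w` is a point of `K` isolated from the right in `K`. -/
def LowerEnd (K : Set X) (w : X) : Prop := w ∈ K ∧ ∃ z, w < z ∧ ∀ t, w < t → t ≤ z → t ∉ K

/-- `w` is a point of `K` isolated from the left in `K`. -/
def UpperEnd (K : Set X) (w : X) : Prop := w ∈ K ∧ ∃ z, z < w ∧ ∀ t, t < w → z ≤ t → t ∉ K

theorem LowerEnd.image {K K' : Set X} {w : X} (h : LowerEnd K w) (e : X ≃o X)
    (he : ∀ x, e x ∈ K' ↔ x ∈ K) : LowerEnd K' (e w) := by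
  obtain ⟨hw, z, hz, hK⟩ := h
  refine ⟨(he w).2 hw, e z, e.strictMono hz, fun t ht ht' hK' => ?_⟩
  rw [← e.apply_symm_apply t] at hK'
  exact hK _ (e.lt_symm_apply.2 ht) (e.symm_apply_le.2 ht') ((he _).1 hK')

theorem UpperEnd.image {K K' : Set X} {w : X} (h : UpperEnd K w) (e : X ≃o X)
    (he : ∀ x, e x ∈ K' ↔ x ∈ K) : UpperEnd K' (e w) :=
  LowerEnd.image (X := Xᵒᵈ) h e.dual he

end Ends

section Selectors

variable {X : Type*} [CompleteLinearOrder X]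

open Classical in
/-- For `p ∉ K`, the largest point of `K` below `p`. -/
noncomputable def lowerSel (K : Set X) (p : X) : X := if p ∈ K then ⊥ else sSup (K ∩ Iic p)

open Classical in
/-- For `p ∉ K`, the least point of `K` above `p`. -/
noncomputable def upperSel (K : Set X) (p : X) : X := if p ∈ K then ⊤ else sInf (K ∩ Ici p)

variable [TopologicalSpace X] [OrderTopology X]

/-- Compactness makes the supremum attained, and `p` witnesses isolation from the right. The
fallback value `⊥` is harmless because it is canonical anyway. -/
theorem lowerSel_eq_bot_or_lowerEnd {K : Set X} (hK : IsClosed K) (p : X) :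
    lowerSel K p = ⊥ ∨ LowerEnd K (lowerSel K p) := by
  unfold lowerSel
  split_ifs with hp
  · exact Or.inl rfl
  rcases (K ∩ Iic p).eq_empty_or_nonempty with h | h
  · left
    rw [h, sSup_empty]
  · right
    have hc : IsCompact (K ∩ Iic p) := (hK.inter isClosed_Iic).isCompact
    obtain ⟨h1, h2⟩ := hc.sSup_mem h
    refine ⟨h1, p, lt_of_le_of_ne h2 fun h => hp (h ▸ h1), fun t ht ht' htK => ?_⟩
    exact ht.not_ge (le_sSup ⟨htK, ht'⟩)

theorem upperSel_eq_top_or_upperEnd {K : Set X} (hK : IsClosed K) (p : X) :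
    upperSel K p = ⊤ ∨ UpperEnd K (upperSel K p) :=
  lowerSel_eq_bot_or_lowerEnd (X := Xᵒᵈ) hK p

/-- Every point of the free interval to the right of `w` selects `w`, so one from a dense sequence
does. -/
theorem LowerEnd.exists_lowerSel [DenselyOrdered X] {K : Set X} {w : X} (h : LowerEnd K w)
    {d : ℕ → X} (hd : DenseRange d) : ∃ n, lowerSel K (d n) = w := by
  obtain ⟨hw, z, hz, hK⟩ := h
  obtain ⟨n, hn⟩ := hd.exists_mem_open (isOpen_Ioo (a := w) (b := z)) (nonempty_Ioo.2 hz)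
  refine ⟨n, ?_⟩
  rw [lowerSel, if_neg (hK _ hn.1 hn.2.le)]
  refine le_antisymm (sSup_le fun t ht => ?_) (le_sSup ⟨hw, hn.1.le⟩)
  exact not_lt.1 fun h => hK t h (le_trans ht.2 hn.2.le) ht.1

theorem UpperEnd.exists_upperSel [DenselyOrdered X] {K : Set X} {w : X} (h : UpperEnd K w)
    {d : ℕ → X} (hd : DenseRange d) : ∃ n, upperSel K (d n) = w :=
  LowerEnd.exists_lowerSel (X := Xᵒᵈ) h hd

/-- Attainment of the supremum turns the condition that it be at least `r` into the projection of a
closed set along a compact factor, which is closed. -/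
theorem measurable_lowerSel [MeasurableSpace X] [BorelSpace X] [SecondCountableTopology X]
    {Z : Type*} [TopologicalSpace Z] [MeasurableSpace Z] [OpensMeasurableSpace Z]
    {G : Set (Z × X)} (hG : IsClosed G) (p : X) :
    Measurable fun z => lowerSel {x | (z, x) ∈ G} p := by
  classical
  have hsec : ∀ z, IsClosed {x | (z, x) ∈ G} := fun z => hG.preimage (by fun_prop)
  refine Measurable.ite (p := fun z => p ∈ {x | (z, x) ∈ G})
    (IsClosed.measurableSet (hG.preimage (f := fun z : Z => (z, p)) (by fun_prop)))
    measurable_const ?_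
  refine measurable_of_Ici fun r => ?_
  -- The empty supremum is `⊥`, so at `r = ⊥` the projection formula could fail while the condition
  -- is trivial.
  rcases eq_or_ne r ⊥ with rfl | hr
  · simp
  have : (fun z => sSup ({x | (z, x) ∈ G} ∩ Iic p)) ⁻¹' Ici r =
      Prod.fst '' (G ∩ Prod.snd ⁻¹' Icc r p) := by
    ext z
    constructor
    · intro hz
      have hz : r ≤ sSup ({x | (z, x) ∈ G} ∩ Iic p) := hz
      rcases ({x | (z, x) ∈ G} ∩ Iic p).eq_empty_or_nonempty with h | h
      · rw [h, sSup_empty] at hz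
        exact (hr (le_bot_iff.1 hz)).elim
      · have hc : IsCompact ({x | (z, x) ∈ G} ∩ Iic p) := ((hsec z).inter isClosed_Iic).isCompact
        obtain ⟨h1, h2⟩ := hc.sSup_mem h
        exact ⟨(z, _), ⟨h1, hz, h2⟩, rfl⟩
    · rintro ⟨⟨z, x⟩, ⟨h1, h2⟩, rfl⟩
      exact h2.1.trans (le_sSup ⟨h1, h2.2⟩)
  rw [this]
  exact (isClosedMap_fst_of_compactSpace _
    (hG.inter (isClosed_Icc.preimage continuous_snd))).measurableSet

theorem measurable_upperSel [MeasurableSpace X] [BorelSpace X] [SecondCountableTopology X]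
    {Z : Type*} [TopologicalSpace Z] [MeasurableSpace Z] [OpensMeasurableSpace Z]
    {G : Set (Z × X)} (hG : IsClosed G) (p : X) :
    Measurable fun z => upperSel {x | (z, x) ∈ G} p :=
  measurable_lowerSel (X := Xᵒᵈ) hG p

/-- The supremum of the points of `a` up to `p`. -/
noncomputable def supBelow {T : Type*} (a : T → X) (p : X) : X :=
  ⨆ t, if a t ≤ p then a t else ⊥

/-- The infimum of the points of `a` from `p` on. -/
noncomputable def infAbove {T : Type*} (a : T → X) (p : X) : X :=
  ⨅ t, if p ≤ a t then a t else ⊤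

/-- The lower endpoint of the gap of `a` containing `p`. -/
noncomputable def gapLower {T : Type*} (a : T → X) (p : X) : X :=
  if supBelow a p < p ∧ p < infAbove a p then supBelow a p else ⊥

/-- The upper endpoint of the gap of `a` containing `p`. -/
noncomputable def gapUpper {T : Type*} (a : T → X) (p : X) : X :=
  if p < infAbove a p ∧ supBelow a p < p then infAbove a p else ⊤

section

omit [TopologicalSpace X] [OrderTopology X]
variable {T : Type*} {a : T → X} {p : X}

theorem le_supBelow {t : T} (h : a t ≤ p) : a t ≤ supBelow a p :=
  (if_pos h).symm.le.trans (le_iSup (fun t => if a t ≤ p then a t else ⊥) t)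

theorem supBelow_le {w : X} (h : ∀ t, a t ≤ p → a t ≤ w) : supBelow a p ≤ w :=
  iSup_le fun t => by
    split_ifs with ht
    exacts [h t ht, bot_le]

theorem infAbove_le {t : T} (h : p ≤ a t) : infAbove a p ≤ a t := le_supBelow (X := Xᵒᵈ) h

theorem le_infAbove {w : X} (h : ∀ t, p ≤ a t → w ≤ a t) : w ≤ infAbove a p :=
  supBelow_le (X := Xᵒᵈ) h

end

/-- The supremum is a limit of terms of `a`, except when it may be an empty supremum. Then it equals
`⊥`, which `ha` makes a term. -/
theorem gapLower_eq_bot_or_lowerEnd {T : Type*} {a : T → X} (ha : ∃ t, a t = ⊥) (p : X) :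
    gapLower a p = ⊥ ∨ LowerEnd (closure (range a)) (gapLower a p) := by
  unfold gapLower
  split_ifs with hp
  · right
    refine ⟨?_, p, hp.1, fun t ht ht' hcl => ?_⟩
    · rw [mem_closure_iff_nhds]
      intro U hU
      rcases eq_or_ne (supBelow a p) ⊥ with h | h
      · obtain ⟨t, ht⟩ := ha
        exact ⟨a t, by rw [ht, ← h]; exact mem_of_mem_nhds hU, t, rfl⟩
      · obtain ⟨l, hl, hlU⟩ := exists_Ioc_subset_of_mem_nhds hU ⟨⊥, bot_lt_iff_ne_bot.2 h⟩
        by_contra hcon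
        refine hl.not_ge (supBelow_le fun t ht => not_lt.1 fun hlt => hcon ?_)
        exact ⟨a t, hlU ⟨hlt, le_supBelow ht⟩, t, rfl⟩
    · obtain ⟨_, hs, s, rfl⟩ := mem_closure_iff.1 hcl _ isOpen_Ioo
        (show t ∈ Ioo (supBelow a p) (infAbove a p) from ⟨ht, ht'.trans_lt hp.2⟩)
      rcases le_total (a s) p with h | h
      · exact hs.1.not_ge (le_supBelow h)
      · exact hs.2.not_ge (infAbove_le h)
  · exact Or.inl rfl

theorem gapUpper_eq_top_or_upperEnd {T : Type*} {a : T → X} (ha : ∃ t, a t = ⊤) (p : X) :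
    gapUpper a p = ⊤ ∨ UpperEnd (closure (range a)) (gapUpper a p) :=
  gapLower_eq_bot_or_lowerEnd (X := Xᵒᵈ) ha p

theorem LowerEnd.exists_gapLower [DenselyOrdered X] {T : Type*} {a : T → X} {w : X}
    (h : LowerEnd (closure (range a)) w) {d : ℕ → X} (hd : DenseRange d) :
    ∃ n, gapLower a (d n) = w := by
  obtain ⟨hw, z, hz, hK⟩ := h
  obtain ⟨n, hn⟩ := hd.exists_mem_open (isOpen_Ioo (a := w) (b := z)) (nonempty_Ioo.2 hz)
  have hno : ∀ t, w < a t → z < a t := fun t ht =>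
    not_le.1 fun h => hK _ ht h (subset_closure ⟨t, rfl⟩)
  have hsup : supBelow a (d n) = w := by
    refine le_antisymm (supBelow_le fun t ht => not_lt.1 fun h => ?_) (not_lt.1 fun h => ?_)
    · exact (hno t h).not_ge (ht.trans hn.2.le)
    · obtain ⟨_, hs, s, rfl⟩ := mem_closure_iff.1 hw _ isOpen_Ioo ⟨h, hn.1⟩
      exact hs.1.not_ge (le_supBelow hs.2.le)
  refine ⟨n, ?_⟩
  rw [gapLower, if_pos, hsup]
  rw [hsup]
  exact ⟨hn.1, hn.2.trans_le (le_infAbove fun t ht => (hno t (hn.1.trans_le ht)).le)⟩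

theorem UpperEnd.exists_gapUpper [DenselyOrdered X] {T : Type*} {a : T → X} {w : X}
    (h : UpperEnd (closure (range a)) w) {d : ℕ → X} (hd : DenseRange d) :
    ∃ n, gapUpper a (d n) = w :=
  LowerEnd.exists_gapLower (X := Xᵒᵈ) h hd

theorem measurable_supBelow [MeasurableSpace X] [BorelSpace X] [SecondCountableTopology X]
    {T Z : Type*} [Countable T] [MeasurableSpace Z] {a : Z → T → X}
    (ha : ∀ t, Measurable fun z => a z t) (p : X) : Measurable fun z => supBelow (a z) p :=
  Measurable.iSup fun t => Measurable.ite (measurableSet_le (ha t) measurable_const) (ha t)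
    measurable_const

theorem measurable_infAbove [MeasurableSpace X] [BorelSpace X] [SecondCountableTopology X]
    {T Z : Type*} [Countable T] [MeasurableSpace Z] {a : Z → T → X}
    (ha : ∀ t, Measurable fun z => a z t) (p : X) : Measurable fun z => infAbove (a z) p :=
  measurable_supBelow (X := Xᵒᵈ) ha p

theorem measurable_gapLower [MeasurableSpace X] [BorelSpace X] [SecondCountableTopology X]
    {T Z : Type*} [Countable T] [MeasurableSpace Z] {a : Z → T → X}
    (ha : ∀ t, Measurable fun z => a z t) (p : X) : Measurable fun z => gapLower (a z) p :=
  Measurable.ite ((measurableSet_lt (measurable_supBelow ha p) measurable_const).inter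
    (measurableSet_lt measurable_const (measurable_infAbove ha p))) (measurable_supBelow ha p)
    measurable_const

theorem measurable_gapUpper [MeasurableSpace X] [BorelSpace X] [SecondCountableTopology X]
    {T Z : Type*} [Countable T] [MeasurableSpace Z] {a : Z → T → X}
    (ha : ∀ t, Measurable fun z => a z t) (p : X) : Measurable fun z => gapUpper (a z) p :=
  measurable_gapLower (X := Xᵒᵈ) ha p

end Selectors

/-! ### Local extreme values -/

section Peaks

variable {X Y : Type*} [LinearOrder X]

/-- `w` is a value of `f` at an interior local maximum. -/
def PeakValue [LE Y] (f : X → Y) (w : Y) : Prop :=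
  ∃ u v x, u < x ∧ x < v ∧ f x = w ∧ ∀ t, u < t → t < v → f t ≤ w

/-- `w` is a value of `f` at an interior local minimum. -/
def PitValue [LE Y] (f : X → Y) (w : Y) : Prop :=
  ∃ u v x, u < x ∧ x < v ∧ f x = w ∧ ∀ t, u < t → t < v → w ≤ f t

theorem PeakValue.conj [Preorder Y] {f g : X → Y} {w : Y} (h : PeakValue f w) (e : X ≃o X)
    (e' : Y ≃o Y) (he : ∀ x, e' (f x) = g (e x)) : PeakValue g (e' w) := by
  obtain ⟨u, v, x, hu, hv, hx, hle⟩ := h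
  refine ⟨e u, e v, e x, e.strictMono hu, e.strictMono hv, by rw [← he, hx], fun t ht ht' => ?_⟩
  rw [← e.apply_symm_apply t, ← he]
  exact e'.monotone (hle _ (e.lt_symm_apply.2 ht) (e.symm_apply_lt.2 ht'))

theorem PitValue.conj [Preorder Y] {f g : X → Y} {w : Y} (h : PitValue f w) (e : X ≃o X)
    (e' : Y ≃o Y) (he : ∀ x, e' (f x) = g (e x)) : PitValue g (e' w) :=
  PeakValue.conj (Y := Yᵒᵈ) h e e'.dual he

open Classical in
/-- The maximum of `f` on `[p, q]`, if it is attained on `[p', q']`, an interval inside `(p, q)`. -/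
noncomputable def peakSel [CompleteLattice Y] (f : X → Y) (p p' q' q : X) : Y :=
  if p < p' ∧ p' ≤ q' ∧ q' < q ∧ sSup (f '' Icc p q) = sSup (f '' Icc p' q') then
    sSup (f '' Icc p q) else ⊥

open Classical in
/-- The minimum of `f` on `[p, q]`, if it is attained on `[p', q']`, an interval inside `(p, q)`. -/
noncomputable def pitSel [CompleteLattice Y] (f : X → Y) (p p' q' q : X) : Y :=
  if p < p' ∧ p' ≤ q' ∧ q' < q ∧ sInf (f '' Icc p q) = sInf (f '' Icc p' q') then
    sInf (f '' Icc p q) else ⊤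

variable [CompleteLinearOrder Y]

/-- Two nested intervals around the extremum, with ends in the dense sequence, have the same maximum
`w`. -/
theorem PeakValue.exists_peakSel [TopologicalSpace X] [OrderTopology X] [DenselyOrdered X]
    {f : X → Y} {w : Y} (h : PeakValue f w) {d : ℕ → X} (hd : DenseRange d) :
    ∃ i j k l, peakSel f (d i) (d j) (d k) (d l) = w := by
  obtain ⟨u, v, x, hu, hv, hx, hle⟩ := h
  have pick : ∀ {s t : X}, s < t → ∃ n, d n ∈ Ioo s t := fun h =>
    hd.exists_mem_open isOpen_Ioo (nonempty_Ioo.2 h)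
  obtain ⟨i, hi⟩ := pick hu
  obtain ⟨j, hj⟩ := pick hi.2
  obtain ⟨l, hl⟩ := pick hv
  obtain ⟨k, hk⟩ := pick hl.1
  have hsup : ∀ {s t : X}, u < s → s ≤ x → x ≤ t → t < v → sSup (f '' Icc s t) = w := by
    intro s t h1 h2 h3 h4
    refine le_antisymm (sSup_le ?_) (le_sSup ⟨x, ⟨h2, h3⟩, hx⟩)
    rintro _ ⟨r, hr, rfl⟩
    exact hle r (h1.trans_le hr.1) (hr.2.trans_lt h4)
  have e1 := hsup hi.1 hi.2.le hl.1.le hl.2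
  have e2 := hsup (hi.1.trans hj.1) hj.2.le hk.1.le (hk.2.trans hl.2)
  refine ⟨i, j, k, l, ?_⟩
  rw [peakSel, if_pos ⟨hj.1, hj.2.le.trans hk.1.le, hk.2, e1.trans e2.symm⟩, e1]

theorem PitValue.exists_pitSel [TopologicalSpace X] [OrderTopology X] [DenselyOrdered X]
    {f : X → Y} {w : Y} (h : PitValue f w) {d : ℕ → X} (hd : DenseRange d) :
    ∃ i j k l, pitSel f (d i) (d j) (d k) (d l) = w :=
  PeakValue.exists_peakSel (Y := Yᵒᵈ) h hd

variable [TopologicalSpace X] [CompactIccSpace X] [TopologicalSpace Y] [OrderTopology Y]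

/-- Equality of the two suprema forces the maximum over `[p, q]` to be attained on `[p', q']`, hence
away from the ends. -/
theorem peakSel_eq_bot_or_peakValue {f : X → Y} (hf : Continuous f) (p p' q' q : X) :
    peakSel f p p' q' q = ⊥ ∨ PeakValue f (peakSel f p p' q' q) := by
  unfold peakSel
  split_ifs with h
  · right
    obtain ⟨h1, h2, h3, h4⟩ := h
    have hc : IsCompact (f '' Icc p' q') := isCompact_Icc.image hf
    obtain ⟨x, hx, hx'⟩ := hc.sSup_mem ⟨f p', mem_image_of_mem f (left_mem_Icc.2 h2)⟩
    exact ⟨p, q, x, h1.trans_le hx.1, hx.2.trans_lt h3, hx'.trans h4.symm,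
      fun t ht ht' => le_sSup ⟨t, ⟨ht.le, ht'.le⟩, rfl⟩⟩
  · exact Or.inl rfl

theorem pitSel_eq_top_or_pitValue {f : X → Y} (hf : Continuous f) (p p' q' q : X) :
    pitSel f p p' q' q = ⊤ ∨ PitValue f (pitSel f p p' q' q) :=
  peakSel_eq_bot_or_peakValue (Y := Yᵒᵈ) hf p p' q' q

theorem measurable_peakSel [MeasurableSpace Y] [BorelSpace Y] [SecondCountableTopology Y]
    {Z : Type*} [TopologicalSpace Z] [MeasurableSpace Z] [OpensMeasurableSpace Z]
    {f : Z → X → Y} (hf : Continuous ↿f) (p p' q' q : X) :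
    Measurable fun z => peakSel (f z) p p' q' q := by
  have hm : ∀ s t : X, Measurable fun z => sSup (f z '' Icc s t) := fun s t =>
    (isCompact_Icc.continuous_sSup hf).measurable
  refine Measurable.ite ?_ (hm p q) measurable_const
  by_cases h : p < p' ∧ p' ≤ q' ∧ q' < q
  · simp only [h, true_and]
    exact measurableSet_eq_fun (hm p q) (hm p' q')
  · simp only [← and_assoc] at h ⊢
    simp [h]

theorem measurable_pitSel [MeasurableSpace Y] [BorelSpace Y] [SecondCountableTopology Y]
    {Z : Type*} [TopologicalSpace Z] [MeasurableSpace Z] [OpensMeasurableSpace Z]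
    {f : Z → X → Y} (hf : Continuous ↿f) (p p' q' q : X) :
    Measurable fun z => pitSel (f z) p p' q' q :=
  measurable_peakSel (Y := Yᵒᵈ) hf p p' q' q

end Peaks

/-! ### The countable set attached to a map -/

/-- The points of `I` generated from the dynamics of `f`. -/
inductive Canonical (f : C(I, I)) : I → Prop
  | zero : Canonical f ⊥
  | one : Canonical f ⊤
  -- Values are taken rather than locations: a continuous map may have uncountably many extremal
  -- points, but only countably many extreme values.
  | peak {w : I} : PeakValue f w → Canonical f w
  | pit {w : I} : PitValue f w → Canonical f w
  | map {v : I} : Canonical f v → Canonical f (f v)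
  -- Only the ends of level sets enter, as a full level set may be uncountable. The same holds for
  -- the fixed-point sets below.
  | lowerPre {v w : I} : Canonical f v → LowerEnd {x | f x = v} w → Canonical f w
  | upperPre {v w : I} : Canonical f v → UpperEnd {x | f x = v} w → Canonical f w
  | lowerFix {n : ℕ} {w : I} : LowerEnd {x | f^[n] x = x} w → Canonical f w
  | upperFix {n : ℕ} {w : I} : UpperEnd {x | f^[n] x = x} w → Canonical f w

/-- The generated points and the endpoints of the gaps of their closure. -/
def structuralSet (f : C(I, I)) : Set I :=
  {w | Canonical f w ∨ LowerEnd (closure {w | Canonical f w}) w ∨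
    UpperEnd (closure {w | Canonical f w}) w}

section Conj

variable {f g : C(I, I)} {e : I ≃o I}

theorem Canonical.conj (he : ∀ x, e (f x) = g (e x)) {w : I} (h : Canonical f w) :
    Canonical g (e w) := by
  induction h with
  | zero => rw [e.map_bot]; exact .zero
  | one => rw [e.map_top]; exact .one
  | peak h => exact .peak (h.conj e e he)
  | pit h => exact .pit (h.conj e e he)
  | map _ ih => rw [he]; exact .map ih
  | lowerPre _ h ih =>
    refine .lowerPre ih (h.image e fun x => ?_)
    simp only [mem_ofPred_eq, ← he, e.injective.eq_iff]
  | upperPre _ h ih =>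
    refine .upperPre ih (h.image e fun x => ?_)
    simp only [mem_ofPred_eq, ← he, e.injective.eq_iff]
  | @lowerFix n _ h =>
    refine .lowerFix (n := n) (h.image e fun x => ?_)
    have := (Function.Semiconj.iterate_right (f := e) (ga := f) (gb := g) he n) x
    simp only [mem_ofPred_eq, ← this, e.injective.eq_iff]
  | @upperFix n _ h =>
    refine .upperFix (n := n) (h.image e fun x => ?_)
    have := (Function.Semiconj.iterate_right (f := e) (ga := f) (gb := g) he n) x
    simp only [mem_ofPred_eq, ← this, e.injective.eq_iff]

theorem symm_conj (he : ∀ x, e (f x) = g (e x)) (x : I) : e.symm (g x) = f (e.symm x) := by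
  rw [e.symm_apply_eq, he, e.apply_symm_apply]

theorem canonical_conj_iff (he : ∀ x, e (f x) = g (e x)) {w : I} :
    Canonical g (e w) ↔ Canonical f w := by
  refine ⟨fun h => ?_, Canonical.conj he⟩
  have := h.conj (symm_conj he)
  rwa [e.symm_apply_apply] at this

theorem structuralSet_conj (he : ∀ x, e (f x) = g (e x)) {w : I} (h : w ∈ structuralSet f) :
    e w ∈ structuralSet g := by
  have hcl : ∀ x, e x ∈ closure {w | Canonical g w} ↔ x ∈ closure {w | Canonical f w} := by
    intro x
    have : {w | Canonical f w} = e.toHomeomorph ⁻¹' {w | Canonical g w} := by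
      ext w
      exact (canonical_conj_iff he).symm
    rw [this, ← e.toHomeomorph.preimage_closure]
    rfl
  rcases h with h | h | h
  · exact Or.inl (h.conj he)
  · exact Or.inr (Or.inl (h.image e hcl))
  · exact Or.inr (Or.inr (h.image e hcl))

theorem image_structuralSet (he : ∀ x, e (f x) = g (e x)) :
    e '' structuralSet f = structuralSet g := by
  refine Subset.antisymm (by rintro _ ⟨w, hw, rfl⟩; exact structuralSet_conj he hw) fun w hw => ?_
  exact ⟨e.symm w, structuralSet_conj (symm_conj he) hw, e.apply_symm_apply w⟩

end Conj

section Adequacy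

variable {f : C(I, I)}

/-- Between a point of `K` and a point outside it there is an end of `K`, which would be a canonical
point in the interval. -/
theorem subset_or_disjoint_of_ends {K : Set I} (hK : IsClosed K)
    (hl : ∀ w, LowerEnd K w → Canonical f w) (hu : ∀ w, UpperEnd K w → Canonical f w) {u v : I}
    (huv : ∀ t ∈ Ioo u v, ¬Canonical f t) : (∀ t ∈ Ioo u v, t ∈ K) ∨ ∀ t ∈ Ioo u v, t ∉ K := by
  by_contra! hcon
  obtain ⟨⟨z, hz, hzK⟩, x, hx, hxK⟩ := hcon
  rcases lt_or_gt_of_ne (show x ≠ z from fun h => hzK (h ▸ hxK)) with h | h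
  · have hw := lowerSel_eq_bot_or_lowerEnd hK z
    have hle : x ≤ lowerSel K z := by
      rw [lowerSel, if_neg hzK]
      exact le_sSup ⟨hxK, h.le⟩
    have hle' : lowerSel K z ≤ z := by
      rw [lowerSel, if_neg hzK]
      exact sSup_le fun t ht => ht.2
    refine huv _ ⟨hx.1.trans_le hle, hle'.trans_lt hz.2⟩ ?_
    rcases hw with hw | hw
    · rw [hw]
      exact .zero
    · exact hl _ hw
  · have hw := upperSel_eq_top_or_upperEnd hK z
    have hle : upperSel K z ≤ x := by
      rw [upperSel, if_neg hzK]
      exact sInf_le ⟨hxK, h.le⟩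
    have hle' : z ≤ upperSel K z := by
      rw [upperSel, if_neg hzK]
      exact le_sInf fun t ht => ht.2
    refine huv _ ⟨hz.1.trans_le hle', hle.trans_lt hx.2⟩ ?_
    rcases hw with hw | hw
    · rw [hw]
      exact .one
    · exact hu _ hw

/-- An interior extremum of a continuous map between two points with the same value. -/
theorem exists_peak_or_pit {x y : I} (hxy : x < y) (h : f x = f y) :
    ∃ t ∈ Ioo x y, PeakValue f (f t) ∨ PitValue f (f t) := by
  have hne : (Icc x y).Nonempty := nonempty_Icc.2 hxy.le
  obtain ⟨s, hs, hsmax⟩ := isCompact_Icc.exists_isMaxOn hne f.continuous.continuousOn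
  obtain ⟨r, hr, hrmin⟩ := isCompact_Icc.exists_isMinOn hne f.continuous.continuousOn
  have hmax : ∀ t ∈ Icc x y, f t ≤ f s := fun t ht => hsmax ht
  have hmin : ∀ t ∈ Icc x y, f r ≤ f t := fun t ht => hrmin ht
  by_cases hs' : s ∈ Ioo x y
  · exact ⟨s, hs', Or.inl ⟨x, y, s, hs'.1, hs'.2, rfl, fun t h1 h2 => hmax t ⟨h1.le, h2.le⟩⟩⟩
  by_cases hr' : r ∈ Ioo x y
  · exact ⟨r, hr', Or.inr ⟨x, y, r, hr'.1, hr'.2, rfl, fun t h1 h2 => hmin t ⟨h1.le, h2.le⟩⟩⟩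
  have hend : ∀ t ∈ Icc x y, t ∉ Ioo x y → f t = f x := by
    intro t ht ht'
    rcases ht.1.eq_or_lt with e | e
    · rw [e]
    · rw [le_antisymm ht.2 (not_lt.1 fun e' => ht' ⟨e, e'⟩), h]
  obtain ⟨t, ht⟩ := exists_between hxy
  have ht' : f t = f s := le_antisymm (hmax t ⟨ht.1.le, ht.2.le⟩)
    (by rw [hend s hs hs', ← hend r hr hr']; exact hmin t ⟨ht.1.le, ht.2.le⟩)
  refine ⟨t, ht, Or.inl ⟨x, y, t, ht.1, ht.2, rfl, fun t' h1 h2 => ?_⟩⟩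
  rw [ht']
  exact hmax t' ⟨h1.le, h2.le⟩

theorem eqOn_Icc_of_eqOn_Ioo {F G : I → I} (hF : Continuous F) (hG : Continuous G) {u v : I}
    (huv : u < v) (h : ∀ t ∈ Ioo u v, F t = G t) : ∀ t ∈ Icc u v, F t = G t := by
  intro t ht
  rw [← closure_Ioo huv.ne] at ht
  exact closure_minimal (t := {t | F t = G t}) h (isClosed_eq hF hG) ht

/-- If a canonical value is taken inside, its level set has canonical ends and so fills the
interval. If none is taken, `f` is injective there, since equal values would enclose a local extreme
value, and extreme values are canonical. -/
theorem interval_alternative {u v : I} (huv : u < v) (h : ∀ t ∈ Ioo u v, ¬Canonical f t) :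
    (∃ c, Canonical f c ∧ ∀ x ∈ Icc u v, f x = c) ∨
      ((StrictMonoOn f (Icc u v) ∨ StrictAntiOn f (Icc u v)) ∧
        ∀ x ∈ Ioo u v, f x ∉ closure {w | Canonical f w}) := by
  by_cases hhit : ∃ x ∈ Ioo u v, Canonical f (f x)
  · left
    obtain ⟨x, hx, hfx⟩ := hhit
    refine ⟨f x, hfx, eqOn_Icc_of_eqOn_Ioo f.continuous continuous_const huv ?_⟩
    have := subset_or_disjoint_of_ends (K := {t | f t = f x})
      (isClosed_eq f.continuous continuous_const) (fun w => .lowerPre hfx)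
      (fun w => .upperPre hfx) h
    exact this.resolve_right fun h' => h' x hx rfl
  · right
    push Not at hhit
    have hinj : InjOn f (Icc u v) := by
      have aux : ∀ x ∈ Icc u v, ∀ y ∈ Icc u v, x < y → f x ≠ f y := by
        intro x hx y hy hxy he
        obtain ⟨t, ht, ht'⟩ := exists_peak_or_pit hxy he
        exact hhit t ⟨hx.1.trans_lt ht.1, ht.2.trans_le hy.2⟩ (ht'.elim .peak .pit)
      intro x hx y hy he
      by_contra hne
      rcases lt_or_gt_of_ne hne with h' | h'
      · exact aux x hx y hy h' he
      · exact aux y hy x hx h' he.symm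
    have hmono := f.continuous.continuousOn.strictMonoOn_of_injOn_Icc' huv.le hinj
    refine ⟨hmono, fun x hx hcl => ?_⟩
    obtain ⟨r, hr⟩ := exists_between hx.1
    obtain ⟨s, hs⟩ := exists_between hx.2
    have mem : ∀ t, r ≤ t → t ≤ s → t ∈ Ioo u v := fun t h1 h2 =>
      ⟨hr.1.trans_le h1, h2.trans_lt hs.2⟩
    have hrm := Ioo_subset_Icc_self (mem r le_rfl (hr.2.le.trans hs.1.le))
    have hsm := Ioo_subset_Icc_self (mem s (hr.2.le.trans hs.1.le) le_rfl)
    have hxm := Ioo_subset_Icc_self hx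
    rcases hmono with hm | hm
    -- A value in the closure would have a canonical point near it, and monotonicity makes that
    -- point a value too.
    · obtain ⟨w, hw, hwc⟩ := mem_closure_iff.1 hcl _ (isOpen_Ioo (a := f r) (b := f s))
        ⟨hm hrm hxm hr.2, hm hxm hsm hs.1⟩
      obtain ⟨t, ht, rfl⟩ := intermediate_value_Ioo (hr.2.le.trans hs.1.le)
        f.continuous.continuousOn hw
      exact hhit t (mem t ht.1.le ht.2.le) hwc
    · obtain ⟨w, hw, hwc⟩ := mem_closure_iff.1 hcl _ (isOpen_Ioo (a := f s) (b := f r))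
        ⟨hm hxm hsm hs.1, hm hrm hxm hr.2⟩
      obtain ⟨t, ht, rfl⟩ := intermediate_value_Ioo' (hr.2.le.trans hs.1.le)
        f.continuous.continuousOn hw
      exact hhit t (mem t ht.1.le ht.2.le) hwc

theorem canonical_subset_structuralSet : {w | Canonical f w} ⊆ structuralSet f := fun _ => Or.inl

theorem structuralSet_subset_closure :
    structuralSet f ⊆ closure {w | Canonical f w} := by
  rintro w (h | h | h)
  exacts [subset_closure h, h.1, h.1]

theorem closure_structuralSet : closure (structuralSet f) = closure {w | Canonical f w} :=
  Subset.antisymm (closure_minimal structuralSet_subset_closure isClosed_closure)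
    (closure_mono canonical_subset_structuralSet)

theorem map_mem_closure_canonical {x : I} (hx : x ∈ closure {w | Canonical f w}) :
    f x ∈ closure {w | Canonical f w} :=
  closure_mono (image_subset_iff.2 fun _ => Canonical.map)
    (image_closure_subset_closure_image f.continuous (mem_image_of_mem f hx))

theorem notMem_closure_of_between {u v r s y : I} {F : C(I, I)} (hrs : r < s) {C : Set I}
    (hF : ∀ t ∈ Ioo u v, F t ∉ C) (hsub : Ioo r s ⊆ Ioo u v)
    (hy : y ∈ Ioo (F r) (F s) ∨ y ∈ Ioo (F s) (F r)) : y ∉ C := by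
  rcases hy with hy | hy
  · obtain ⟨t, ht, rfl⟩ := intermediate_value_Ioo hrs.le F.continuous.continuousOn hy
    exact hF t (hsub ht)
  · obtain ⟨t, ht, rfl⟩ := intermediate_value_Ioo' hrs.le F.continuous.continuousOn hy
    exact hF t (hsub ht)

/-- A gap on which `f` is constant has a canonical value. Otherwise the image of the gap avoids the
closure and abuts the image of its end, which is therefore again an end of a gap. -/
theorem map_mem_structuralSet_of_ends {u v w : I} (huv : u < v)
    (h : ∀ t ∈ Ioo u v, ¬Canonical f t) (hw : w ∈ closure {w | Canonical f w})
    (hwuv : w = u ∨ w = v) : f w ∈ structuralSet f := by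
  have hwm : w ∈ Icc u v := by
    rcases hwuv with rfl | rfl
    exacts [left_mem_Icc.2 huv.le, right_mem_Icc.2 huv.le]
  rcases interval_alternative huv h with ⟨c, hc, hfc⟩ | ⟨hmono, hno⟩
  · exact Or.inl ((hfc w hwm).symm ▸ hc)
  · obtain ⟨z, hz⟩ := exists_between huv
    obtain ⟨z', hz'⟩ := exists_between huv
    have hfw := map_mem_closure_canonical hw
    have hzm := Ioo_subset_Icc_self hz
    have hno' : ∀ y, (y ∈ Ioo (f u) (f z) ∨ y ∈ Ioo (f z) (f u)) ∨
        (y ∈ Ioo (f z) (f v) ∨ y ∈ Ioo (f v) (f z)) ∨ y = f z →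
        y ∉ closure {w | Canonical f w} := by
      rintro y (hy | hy | rfl)
      · exact notMem_closure_of_between hz.1 hno (Ioo_subset_Ioo_right hz.2.le) hy
      · exact notMem_closure_of_between hz.2 hno (Ioo_subset_Ioo_left hz.1.le) hy
      · exact hno z hz
    have hl := left_mem_Icc.2 huv.le
    have hr := right_mem_Icc.2 huv.le
    rcases hwuv with rfl | rfl <;> rcases hmono with hm | hm
    · refine Or.inr (Or.inl ⟨hfw, f z, hm hl hzm hz.1, fun t h1 h2 => hno' t ?_⟩)
      rcases h2.eq_or_lt with h2 | h2
      exacts [Or.inr (Or.inr h2), Or.inl (Or.inl ⟨h1, h2⟩)]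
    · refine Or.inr (Or.inr ⟨hfw, f z, hm hl hzm hz.1, fun t h1 h2 => hno' t ?_⟩)
      rcases h2.eq_or_lt with h2 | h2
      exacts [Or.inr (Or.inr h2.symm), Or.inl (Or.inr ⟨h2, h1⟩)]
    · refine Or.inr (Or.inr ⟨hfw, f z, hm hzm hr hz.2, fun t h1 h2 => hno' t ?_⟩)
      rcases h2.eq_or_lt with h2 | h2
      exacts [Or.inr (Or.inr h2.symm), Or.inr (Or.inl (Or.inl ⟨h2, h1⟩))]
    · refine Or.inr (Or.inl ⟨hfw, f z, hm hzm hr hz.2, fun t h1 h2 => hno' t ?_⟩)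
      rcases h2.eq_or_lt with h2 | h2
      exacts [Or.inr (Or.inr h2), Or.inr (Or.inl (Or.inr ⟨h1, h2⟩))]

theorem adequate_structuralSet (f : C(I, I)) : Adequate f (structuralSet f) where
  zero_mem := Or.inl .zero
  one_mem := Or.inl .one
  map_mem := by
    rintro w (h | ⟨hw, z, hz, hK⟩ | ⟨hw, z, hz, hK⟩)
    · exact Or.inl (.map h)
    · exact map_mem_structuralSet_of_ends hz
        (fun t ht ht' => hK t ht.1 ht.2.le (subset_closure ht')) hw (Or.inl rfl)
    · exact map_mem_structuralSet_of_ends hz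
        (fun t ht ht' => hK t ht.2 ht.1.le (subset_closure ht')) hw (Or.inr rfl)
  gap := by
    intro x hx
    rw [closure_structuralSet] at hx
    have hcl : IsClosed (closure {w | Canonical f w}) := isClosed_closure
    have h0 : ⊥ ∈ closure {w | Canonical f w} := subset_closure .zero
    have h1 : ⊤ ∈ closure {w | Canonical f w} := subset_closure .one
    have hl := lowerSel_eq_bot_or_lowerEnd hcl x
    have hu := upperSel_eq_top_or_upperEnd hcl x
    set p := lowerSel (closure {w | Canonical f w}) x with hp
    set q := upperSel (closure {w | Canonical f w}) x with hq
    have hpm : p ∈ structuralSet f := hl.elim (fun h => h ▸ Or.inl .zero) fun h => Or.inr (Or.inl h)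
    have hqm : q ∈ structuralSet f := hu.elim (fun h => h ▸ Or.inl .one) fun h => Or.inr (Or.inr h)
    have hpx : p ≤ x := by
      rw [hp, lowerSel, if_neg hx]
      exact sSup_le fun t ht => ht.2
    have hxq : x ≤ q := by
      rw [hq, upperSel, if_neg hx]
      exact le_sInf fun t ht => ht.2
    refine ⟨p, hpm, q, hqm, ⟨lt_of_le_of_ne hpx fun h => hx ?_, lt_of_le_of_ne hxq fun h => hx ?_⟩,
      fun t ht htm => ?_⟩
    · exact h ▸ structuralSet_subset_closure hpm
    · exact h ▸ structuralSet_subset_closure hqm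
    · have htm := structuralSet_subset_closure htm
      rcases le_total t x with h | h
      · refine ht.1.not_ge ?_
        rw [hp, lowerSel, if_neg hx]
        exact le_sSup ⟨htm, h⟩
      · refine ht.2.not_ge ?_
        rw [hq, upperSel, if_neg hx]
        exact sInf_le ⟨htm, h⟩
  mono := by
    intro u _ v _ huv hno
    rcases interval_alternative huv fun t ht h => hno t ht (Or.inl h) with ⟨c, -, hc⟩ | ⟨hm, hn⟩
    · exact Or.inl fun x hx => (hc x hx).trans (hc u (left_mem_Icc.2 huv.le)).symm
    · exact Or.inr ⟨hm, fun x hx h => hn x hx (structuralSet_subset_closure h)⟩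
  per := by
    intro u _ v _ huv hno n
    exact subset_or_disjoint_of_ends (K := {x | f^[n] x = x})
      (isClosed_eq (f.continuous.iterate n) continuous_id) (fun w => .lowerFix)
      (fun w => .upperFix) fun t ht h => hno t ht (Or.inl h)

end Adequacy

/-! ### Borel enumeration of the structural set -/

/-- The operations generating the canonical points. -/
inductive PointOp
  | one
  | peak (i j k l : ℕ)
  | pit (i j k l : ℕ)
  | map
  | lowerPre (i : ℕ)
  | upperPre (i : ℕ)
  | lowerFix (n i : ℕ)
  | upperFix (n i : ℕ)
  deriving Countable

instance intervalMapBorelSpace : BorelSpace C(I, I) := ⟨rfl⟩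

/-- A dense sequence in `I`. -/
noncomputable def ratPoint : ℕ → I := TopologicalSpace.denseSeq I

theorem denseRange_ratPoint : DenseRange ratPoint := TopologicalSpace.denseRange_denseSeq I

/-- Evaluation of an operation. -/
noncomputable def PointOp.eval : PointOp → C(I, I) × I → I
  | one, _ => ⊤
  | peak i j k l, z => peakSel z.1 (ratPoint i) (ratPoint j) (ratPoint k) (ratPoint l)
  | pit i j k l, z => pitSel z.1 (ratPoint i) (ratPoint j) (ratPoint k) (ratPoint l)
  | map, z => z.1 z.2
  | lowerPre i, z => lowerSel {x | z.1 x = z.2} (ratPoint i)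
  | upperPre i, z => upperSel {x | z.1 x = z.2} (ratPoint i)
  | lowerFix n i, z => lowerSel {x | z.1^[n] x = x} (ratPoint i)
  | upperFix n i, z => upperSel {x | z.1^[n] x = x} (ratPoint i)

theorem continuous_eval_iterate (n : ℕ) :
    Continuous fun q : C(I, I) × I => q.1^[n] q.2 := by
  induction n with
  | zero => exact continuous_snd
  | succ n ih =>
    simp only [Function.iterate_succ_apply']
    exact ContinuousEval.continuous_eval.comp (continuous_fst.prodMk ih)

theorem PointOp.measurable_eval (o : PointOp) : Measurable o.eval := by
  have hpre : IsClosed {q : (C(I, I) × I) × I | q.1.1 q.2 = q.1.2} :=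
    isClosed_eq (ContinuousEval.continuous_eval.comp (by fun_prop :
      Continuous fun q : (C(I, I) × I) × I => (q.1.1, q.2))) (by fun_prop)
  have hfix : ∀ n, IsClosed {q : (C(I, I) × I) × I | q.1.1^[n] q.2 = q.2} := fun n =>
    isClosed_eq ((continuous_eval_iterate n).comp (by fun_prop :
      Continuous fun q : (C(I, I) × I) × I => (q.1.1, q.2))) (by fun_prop)
  have hev : Continuous ↿fun z : C(I, I) × I => (z.1 : I → I) :=
    ContinuousEval.continuous_eval.comp (by fun_prop :
      Continuous fun q : (C(I, I) × I) × I => (q.1.1, q.2))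
  cases o with
  | one => exact measurable_const
  | peak i j k l => exact measurable_peakSel hev _ _ _ _
  | pit i j k l => exact measurable_pitSel hev _ _ _ _
  | map => exact ContinuousEval.continuous_eval.measurable
  | lowerPre i => exact measurable_lowerSel hpre _
  | upperPre i => exact measurable_upperSel hpre _
  | lowerFix n i => exact measurable_lowerSel (hfix n) _
  | upperFix n i => exact measurable_upperSel (hfix n) _

/-- The point of `I` obtained by applying a list of operations. -/
noncomputable def canonicalPoint (f : C(I, I)) : List PointOp → I
  | [] => ⊥
  | o :: l => o.eval (f, canonicalPoint f l)

theorem measurable_canonicalPoint (l : List PointOp) :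
    Measurable fun f : C(I, I) => canonicalPoint f l := by
  induction l with
  | nil => exact measurable_const
  | cons o l ih => exact o.measurable_eval.comp (measurable_id.prodMk ih)

/-- Each rule generating canonical points has at most one canonical premise, so derivations are
words in the operations. The selectors' fallback values `⊥` and `⊤` add nothing. -/
theorem range_canonicalPoint (f : C(I, I)) : range (canonicalPoint f) = {w | Canonical f w} := by
  apply Subset.antisymm
  · rintro _ ⟨l, rfl⟩
    induction l with
    | nil => exact .zero
    | cons o l ih =>
      have hpre : IsClosed {x | f x = canonicalPoint f l} :=
        isClosed_eq f.continuous continuous_const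
      have hfix : ∀ n, IsClosed {x | f^[n] x = x} := fun n =>
        isClosed_eq (f.continuous.iterate n) continuous_id
      have bot : ∀ {w : I}, w = ⊥ → Canonical f w := fun h => h ▸ .zero
      have top : ∀ {w : I}, w = ⊤ → Canonical f w := fun h => h ▸ .one
      cases o with
      | one => exact .one
      | peak i j k l => exact (peakSel_eq_bot_or_peakValue f.continuous _ _ _ _).elim bot .peak
      | pit i j k l => exact (pitSel_eq_top_or_pitValue f.continuous _ _ _ _).elim top .pit
      | map => exact .map ih
      | lowerPre i => exact (lowerSel_eq_bot_or_lowerEnd hpre _).elim bot (.lowerPre ih)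
      | upperPre i => exact (upperSel_eq_top_or_upperEnd hpre _).elim top (.upperPre ih)
      | lowerFix n i => exact (lowerSel_eq_bot_or_lowerEnd (hfix n) _).elim bot .lowerFix
      | upperFix n i => exact (upperSel_eq_top_or_upperEnd (hfix n) _).elim top .upperFix
  · intro w hw
    have hd := denseRange_ratPoint
    induction hw with
    | zero => exact ⟨[], rfl⟩
    | one => exact ⟨[.one], rfl⟩
    | peak h =>
      obtain ⟨i, j, k, l, h⟩ := h.exists_peakSel hd
      exact ⟨[.peak i j k l], h⟩
    | pit h =>
      obtain ⟨i, j, k, l, h⟩ := h.exists_pitSel hd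
      exact ⟨[.pit i j k l], h⟩
    | map _ ih =>
      obtain ⟨l, rfl⟩ := ih
      exact ⟨.map :: l, rfl⟩
    | lowerPre _ h ih =>
      obtain ⟨l, rfl⟩ := ih
      obtain ⟨i, h⟩ := h.exists_lowerSel hd
      exact ⟨.lowerPre i :: l, h⟩
    | upperPre _ h ih =>
      obtain ⟨l, rfl⟩ := ih
      obtain ⟨i, h⟩ := h.exists_upperSel hd
      exact ⟨.upperPre i :: l, h⟩
    | @lowerFix n _ h =>
      obtain ⟨i, h⟩ := h.exists_lowerSel hd
      exact ⟨[.lowerFix n i], h⟩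
    | @upperFix n _ h =>
      obtain ⟨i, h⟩ := h.exists_upperSel hd
      exact ⟨[.upperFix n i], h⟩

/-- An indexing of the structural set. -/
noncomputable def structuralPoint (f : C(I, I)) : List PointOp ⊕ ℕ ⊕ ℕ → I
  | .inl l => canonicalPoint f l
  | .inr (.inl n) => gapLower (canonicalPoint f) (ratPoint n)
  | .inr (.inr n) => gapUpper (canonicalPoint f) (ratPoint n)

theorem measurable_structuralPoint (t : List PointOp ⊕ ℕ ⊕ ℕ) :
    Measurable fun f : C(I, I) => structuralPoint f t := by
  rcases t with l | n | n
  · exact measurable_canonicalPoint l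
  · exact measurable_gapLower measurable_canonicalPoint _
  · exact measurable_gapUpper measurable_canonicalPoint _

theorem range_structuralPoint (f : C(I, I)) : range (structuralPoint f) = structuralSet f := by
  have hr := range_canonicalPoint f
  have mem : ∀ w, w ∈ range (canonicalPoint f) ↔ Canonical f w := fun w => by rw [hr]; rfl
  apply Subset.antisymm
  · rintro _ ⟨l | n | n, rfl⟩
    · exact Or.inl ((mem _).1 ⟨l, rfl⟩)
    · rcases gapLower_eq_bot_or_lowerEnd (a := canonicalPoint f) ((mem _).2 .zero) (ratPoint n)
        with h | h
      · exact Or.inl (by rw [structuralPoint, h]; exact .zero)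
      · exact Or.inr (Or.inl (by rwa [hr] at h))
    · rcases gapUpper_eq_top_or_upperEnd (a := canonicalPoint f) ((mem _).2 .one) (ratPoint n)
        with h | h
      · exact Or.inl (by rw [structuralPoint, h]; exact .one)
      · exact Or.inr (Or.inr (by rwa [hr] at h))
  · rintro w (h | h | h)
    · obtain ⟨l, rfl⟩ := (mem w).2 h
      exact ⟨.inl l, rfl⟩
    · rw [← hr] at h
      obtain ⟨n, hn⟩ := h.exists_gapLower denseRange_ratPoint
      exact ⟨.inr (.inl n), hn⟩
    · rw [← hr] at h
      obtain ⟨n, hn⟩ := h.exists_gapUpper denseRange_ratPoint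
      exact ⟨.inr (.inr n), hn⟩

/-! ### Reduction of conjugacy to isomorphism -/

/-- Infinite repetition erases multiplicities, so enumerations of corresponding sets differ only by
a permutation of the indices. -/
theorem exists_infinite_fibers (T : Type*) [Countable T] [Nonempty T] :
    ∃ e : ℕ → T, ∀ t, (e ⁻¹' {t}).Infinite := by
  obtain ⟨s, hs⟩ := exists_surjective_nat T
  refine ⟨fun n => s n.unpair.1, fun t => ?_⟩
  obtain ⟨k, rfl⟩ := hs t
  refine infinite_of_injective_forall_mem (f := fun m => Nat.pair k m) (fun m m' h => ?_)
    fun m => ?_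
  · exact (Nat.pair_eq_pair.1 h).2
  · simp

/-- Two sequences with the same range and infinite fibers differ by a permutation. -/
theorem exists_perm_of_infinite_fibers {X : Type*} {u v : ℕ → X} (h : range u = range v)
    (hu : ∀ n, (u ⁻¹' {u n}).Infinite) (hv : ∀ n, (v ⁻¹' {v n}).Infinite) :
    ∃ π : Equiv.Perm ℕ, ∀ n, v (π n) = u n := by
  have key : ∀ x, Nonempty ({n // u n = x} ≃ {n // v n = x}) := by
    intro x
    by_cases hx : x ∈ range u
    · obtain ⟨m, hm⟩ := h ▸ hx
      obtain ⟨n, hn⟩ := hx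
      have h1 : Infinite {n // u n = x} := by
        have := hu n
        rw [hn] at this
        exact this.to_subtype
      have h2 : Infinite {n // v n = x} := by
        have := hv m
        rw [hm] at this
        exact this.to_subtype
      exact nonempty_equiv_of_countable
    · have h1 : IsEmpty {n // u n = x} := ⟨fun n => hx ⟨n, n.2⟩⟩
      have h2 : IsEmpty {n // v n = x} := ⟨fun n => hx (h ▸ ⟨n, n.2⟩)⟩
      exact ⟨Equiv.equivOfIsEmpty _ _⟩
  let e := fun x => (key x).some
  exact ⟨Equiv.ofFiberEquiv e, fun n => Equiv.ofFiberEquiv_map e n⟩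

/-- The points `t` witnessing motion form an open set, so a dense sequence suffices and the relation
is a countable union of Borel conditions. -/
theorem measurableSet_codeRel {a b : C(I, I) → I} (ha : Measurable a) (hb : Measurable b) (n : ℕ) :
    MeasurableSet {f | codeRel f n (a f) (b f)} := by
  match n with
  | 0 => exact measurableSet_lt ha hb
  | 1 =>
    exact measurableSet_eq_fun
      (ContinuousEval.continuous_eval.measurable.comp (measurable_id.prodMk ha)) hb
  | n + 2 =>
    have hc : Continuous fun q : C(I, I) × I => q.1^[n] q.2 := continuous_eval_iterate n
    have dense : ∀ (f : C(I, I)) (U : Set I), IsOpen U →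
        ((∃ t, t ∈ U) ↔ ∃ k, ratPoint k ∈ U) := fun f U hU =>
      ⟨fun ⟨t, ht⟩ => denseRange_ratPoint.exists_mem_open hU ⟨t, ht⟩, fun ⟨k, hk⟩ => ⟨_, hk⟩⟩
    have hit : ∀ k, Measurable fun f : C(I, I) => f^[n] (ratPoint k) := fun k =>
      (hc.comp (by fun_prop : Continuous fun f : C(I, I) => (f, ratPoint k))).measurable
    have heq : {f : C(I, I) | codeRel f (n + 2) (a f) (b f)} =
        (⋃ k, {f | a f < ratPoint k} ∩ ({f | ratPoint k < b f} ∩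
          {f | ratPoint k < f^[n] (ratPoint k)})) ∪
        ⋃ k, {f | b f < ratPoint k} ∩ ({f | ratPoint k < a f} ∩
          {f | f^[n] (ratPoint k) < ratPoint k}) := by
      ext f
      have hf : Continuous f^[n] := f.continuous.iterate n
      have h1 := dense f (Ioi (a f) ∩ (Iio (b f) ∩ {t | t < f^[n] t}))
        (isOpen_Ioi.inter (isOpen_Iio.inter (isOpen_lt continuous_id hf)))
      have h2 := dense f (Ioi (b f) ∩ (Iio (a f) ∩ {t | f^[n] t < t}))
        (isOpen_Ioi.inter (isOpen_Iio.inter (isOpen_lt hf continuous_id)))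
      simp only [mem_inter_iff, mem_Ioi, mem_Iio, mem_ofPred_eq] at h1 h2
      simp only [codeRel, mem_union, mem_iUnion, mem_inter_iff, mem_ofPred_eq, h1, h2]
    rw [heq]
    refine (MeasurableSet.iUnion fun k => ?_).union (MeasurableSet.iUnion fun k => ?_)
    · exact (measurableSet_lt ha measurable_const).inter
        ((measurableSet_lt measurable_const hb).inter (measurableSet_lt measurable_const (hit k)))
    · exact (measurableSet_lt hb measurable_const).inter
        ((measurableSet_lt measurable_const ha).inter (measurableSet_lt (hit k) measurable_const))

theorem codeRel_conj {f g : C(I, I)} {e : I ≃o I} (he : ∀ x, e (f x) = g (e x)) (n : ℕ) (x y : I) :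
    codeRel f n x y ↔ codeRel g n (e x) (e y) := by
  match n with
  | 0 => exact e.lt_iff_lt.symm
  | 1 =>
    change f x = y ↔ g (e x) = e y
    rw [← he, e.injective.eq_iff]
  | n + 2 =>
    have hn : ∀ x, e (f^[n] x) = g^[n] (e x) := fun x =>
      (Function.Semiconj.iterate_right (f := e) (ga := f) (gb := g) he n) x
    simp only [codeRel]
    rw [e.surjective.exists (p := fun t => e x < t ∧ t < e y ∧ t < g^[n] t),
      e.surjective.exists (p := fun t => e y < t ∧ t < e x ∧ g^[n] t < t)]
    simp only [← hn, e.lt_iff_lt]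

open Classical in
/-- The structure of a sequence of points for `f`. -/
noncomputable def codeStructure (f : C(I, I)) (a : ℕ → I) : RelStructure := fun p =>
  match p.2 with
  | [i, j] => decide (codeRel f p.1 (a i) (a j))
  | _ => false

theorem borelReducible_orientedConjugacy_iso :
    BorelReducible orientedConjugacy RelStructure.iso := by
  obtain ⟨e, he⟩ := exists_infinite_fibers (List PointOp ⊕ ℕ ⊕ ℕ)
  have hsurj : Function.Surjective e := fun t => (he t).nonempty
  have hrange : ∀ f, range (fun n => structuralPoint f (e n)) = structuralSet f := fun f => by
    rw [← range_structuralPoint, ← hsurj.range_comp]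
    rfl
  have hinf : ∀ f n, ((fun n => structuralPoint f (e n)) ⁻¹' {structuralPoint f (e n)}).Infinite :=
    fun f n => (he (e n)).mono fun m hm => congrArg (structuralPoint f) hm
  refine ⟨fun f => codeStructure f fun n => structuralPoint f (e n), ?_, fun f g => ?_⟩
  · refine measurable_pi_lambda _ fun p => ?_
    obtain ⟨n, s⟩ := p
    match s with
    | [] => exact measurable_const
    | [_] => exact measurable_const
    | [i, j] =>
      refine measurable_to_bool ?_
      have := measurableSet_codeRel (measurable_structuralPoint (e i))
        (measurable_structuralPoint (e j)) n
      convert this using 1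
      ext f
      simp [codeStructure]
    | _ :: _ :: _ :: _ => exact measurable_const
  · rw [RelStructure.iso_iff]
    constructor
    · rintro ⟨h, hm, hc⟩
      set E : I ≃o I := hm.orderIsoOfSurjective h h.surjective with hE
      have hE' : ∀ x, E (f x) = g (E x) := hc
      have h1 := image_structuralSet hE'
      rw [← hrange, ← hrange, ← range_comp] at h1
      obtain ⟨π, hπ⟩ := exists_perm_of_infinite_fibers h1
        (fun n => (hinf f n).mono fun m hm => congrArg E hm) (hinf g)
      refine ⟨π, fun n s => ?_⟩
      match s with
      | [] => rfl
      | [_] => rfl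
      | [i, j] =>
        simp only [codeStructure, List.map_cons, List.map_nil, decide_eq_decide]
        have e1 := hπ i
        have e2 := hπ j
        rw [e1, e2]
        exact codeRel_conj hE' n _ _
      | _ :: _ :: _ :: _ => rfl
    · rintro ⟨π, hπ⟩
      -- Reindexing the second enumeration by `π` keeps its range and makes corresponding points
      -- share an index.
      refine Matched.orientedConjugacy (a := fun n => structuralPoint f (e n))
        (b := fun n => structuralPoint g (e (π n))) ⟨?_, ?_, fun n i j => ?_⟩
      · rw [hrange]
        exact adequate_structuralSet f
      · have : range (fun n => structuralPoint g (e (π n))) = structuralSet g := by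
          rw [← hrange, ← π.surjective.range_comp (fun n => structuralPoint g (e n))]
          rfl
        rw [this]
        exact adequate_structuralSet g
      · have := hπ n [i, j]
        simpa only [codeStructure, List.map_cons, List.map_nil, decide_eq_decide] using this

/-! ### Back and forth, and a densely coloured order -/

section BackAndForth

/-- Back and forth: a family of finite partial correspondences with the extension property contains
an increasing sequence with full domain and range. -/
theorem exists_backAndForth {α β : Type*} [Countable α] [Countable β] [Nonempty α] [Nonempty β]
    (P : List (α × β) → Prop) (h0 : P [])
    (forth : ∀ l, P l → ∀ a, ∃ b, P (l ++ [(a, b)]))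
    (back : ∀ l, P l → ∀ b, ∃ a, P (l ++ [(a, b)])) :
    ∃ u : ℕ → α × β, (∀ n, P ((List.range n).map u)) ∧ (∀ a, ∃ n, (u n).1 = a) ∧
      ∀ b, ∃ n, (u n).2 = b := by
  obtain ⟨ea, ha⟩ := exists_surjective_nat α
  obtain ⟨eb, hb⟩ := exists_surjective_nat β
  -- Even stages add the next element to the domain, odd stages to the range.
  have step : ∀ (n : ℕ) (l : {l // P l}), ∃ p : α × β, P (l.1 ++ [p]) ∧
      (n % 2 = 0 → p.1 = ea (n / 2)) ∧ (n % 2 = 1 → p.2 = eb (n / 2)) := by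
    rintro n ⟨l, hl⟩
    rcases Nat.mod_two_eq_zero_or_one n with h | h
    · obtain ⟨b, hb⟩ := forth l hl (ea (n / 2))
      exact ⟨(_, b), hb, fun _ => rfl, fun h' => by omega⟩
    · obtain ⟨a, ha⟩ := back l hl (eb (n / 2))
      exact ⟨(a, _), ha, fun h' => by omega, fun _ => rfl⟩
  choose f hf hf0 hf1 using step
  let L : ℕ → {l // P l} := fun n => Nat.rec ⟨[], h0⟩ (fun n l => ⟨l.1 ++ [f n l], hf n l⟩) n
  refine ⟨fun n => f n (L n), fun n => ?_, fun a => ?_, fun b => ?_⟩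
  · have : (List.range n).map (fun n => f n (L n)) = (L n).1 := by
      induction n with
      | zero => rfl
      | succ n ih =>
        rw [List.range_succ, List.map_append, ih]
        rfl
    rw [this]
    exact (L n).2
  · obtain ⟨k, rfl⟩ := ha a
    exact ⟨2 * k, by rw [hf0 (2 * k) _ (by omega)]; congr 1; omega⟩
  · obtain ⟨k, rfl⟩ := hb b
    exact ⟨2 * k + 1, by rw [hf1 (2 * k + 1) _ (by omega)]; congr 1; omega⟩

end BackAndForth

/-- A countable linear order with colours in `ℕ`, all of them dense: the pair `(q, n)` stands for
the number `q + n * √2`. -/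
def ColoredRat : Type := ℚ × ℕ

namespace ColoredRat

/-- The value of a coloured rational. -/
noncomputable def val (x : ColoredRat) : ℝ := x.1 + x.2 * √2

/-- The colour of a coloured rational. -/
def color (x : ColoredRat) : ℕ := x.2

/-- Irrationality of `√2` makes the colour classes, each a translate of the rationals, pairwise
disjoint. -/
theorem val_injective : Function.Injective val := by
  rintro ⟨q, m⟩ ⟨r, n⟩ h
  simp only [val] at h
  by_cases hmn : m = n
  · subst hmn
    have h' : q = r := by simpa using h
    rw [h']
  · exfalso
    have h1 : ((m : ℤ) - n : ℤ) ≠ 0 := sub_ne_zero.2 (by exact_mod_cast hmn)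
    refine (irrational_sqrt_two.intCast_mul h1) ⟨r - q, ?_⟩
    push_cast
    linarith

noncomputable instance : LinearOrder ColoredRat := LinearOrder.lift' val val_injective

instance : Countable ColoredRat := inferInstanceAs (Countable (ℚ × ℕ))

instance : Nonempty ColoredRat := ⟨(0, 0)⟩

theorem lt_iff {x y : ColoredRat} : x < y ↔ val x < val y := Iff.rfl

theorem exists_val_mem (n : ℕ) {r s : ℝ} (h : r < s) :
    ∃ z : ColoredRat, color z = n ∧ r < val z ∧ val z < s := by
  obtain ⟨q, hq, hq'⟩ := exists_rat_btwn (sub_lt_sub_right h (n * √2))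
  exact ⟨(q, n), rfl, by simp only [val]; linarith, by simp only [val]; linarith⟩

theorem exists_between_color (n : ℕ) {x y : ColoredRat} (h : x < y) :
    ∃ z, color z = n ∧ x < z ∧ z < y := exists_val_mem n (lt_iff.1 h)

instance : DenselyOrdered ColoredRat :=
  ⟨fun _ _ h => (exists_between_color 0 h).imp fun _ => And.right⟩

instance : NoMaxOrder ColoredRat :=
  ⟨fun x => (exists_val_mem 0 (lt_add_one (val x))).imp fun _ h => h.2.1⟩

instance : NoMinOrder ColoredRat :=
  ⟨fun x => (exists_val_mem 0 (sub_one_lt (val x))).imp fun _ h => h.2.2⟩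

theorem exists_color (n : ℕ) : ∃ x, color x = n := ⟨(0, n), rfl⟩

theorem exists_between_finsets_color (n : ℕ) (A B : Finset ColoredRat)
    (h : ∀ x ∈ A, ∀ y ∈ B, x < y) : ∃ z, color z = n ∧ (∀ x ∈ A, x < z) ∧ ∀ y ∈ B, z < y := by
  -- Two separating points are found so that the prescribed colour can be placed between them. This
  -- also covers empty `A` or `B`.
  obtain ⟨z₁, hA, hB⟩ := Order.exists_between_finsets A B h
  obtain ⟨z₂, hA', hB'⟩ := Order.exists_between_finsets (insert z₁ A) B (by
    intro x hx y hy
    rcases Finset.mem_insert.1 hx with rfl | hx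
    exacts [hB y hy, h x hx y hy])
  obtain ⟨z, hz, h1, h2⟩ := exists_between_color n (hA' z₁ (Finset.mem_insert_self _ _))
  exact ⟨z, hz, fun x hx => (hA x hx).trans h1, fun y hy => h2.trans (hB' y hy)⟩

/-- The partial isomorphisms inducing the permutation `π` on colours. -/
def PartialShuffle (π : Equiv.Perm ℕ) (l : List (ColoredRat × ColoredRat)) : Prop :=
  (∀ p ∈ l, color p.2 = π (color p.1)) ∧ ∀ p ∈ l, ∀ q ∈ l, cmp p.1 q.1 = cmp p.2 q.2

/-- A point already in the domain must reuse its partner. A new point has a free interval between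
finitely many images, where the required colour is dense. -/
theorem PartialShuffle.forth {π : Equiv.Perm ℕ} {l : List (ColoredRat × ColoredRat)}
    (h : PartialShuffle π l) (a : ColoredRat) : ∃ b, PartialShuffle π (l ++ [(a, b)]) := by
  obtain ⟨hc, hl⟩ := h
  have key : ∀ b, color b = π (color a) → (∀ p ∈ l, cmp p.1 a = cmp p.2 b) →
      PartialShuffle π (l ++ [(a, b)]) := by
    intro b hb hcmp
    constructor
    · intro p hp
      rcases List.mem_append.1 hp with hp | hp
      · exact hc p hp
      · rw [List.mem_singleton.1 hp]
        exact hb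
    · intro p hp q hq
      rcases List.mem_append.1 hp with hp | hp <;> rcases List.mem_append.1 hq with hq | hq
      · exact hl p hp q hq
      · rw [List.mem_singleton.1 hq]
        exact hcmp p hp
      · rw [List.mem_singleton.1 hp, ← cmp_swap, hcmp q hq, cmp_swap]
      · rw [List.mem_singleton.1 hp, List.mem_singleton.1 hq, cmp_self_eq_eq, cmp_self_eq_eq]
  by_cases hex : ∃ p ∈ l, p.1 = a
  · obtain ⟨p, hp, rfl⟩ := hex
    exact ⟨p.2, key _ (hc p hp) fun q hq => hl q hq p hp⟩
  · push Not at hex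
    obtain ⟨b, hb, h1, h2⟩ := exists_between_finsets_color (π (color a))
      ((l.filter fun p => p.1 < a).map Prod.snd).toFinset
      ((l.filter fun p => a < p.1).map Prod.snd).toFinset (by
        intro x hx y hy
        simp only [List.mem_toFinset, List.mem_map, List.mem_filter, decide_eq_true_eq] at hx hy
        obtain ⟨p, ⟨hp, hp'⟩, rfl⟩ := hx
        obtain ⟨q, ⟨hq, hq'⟩, rfl⟩ := hy
        exact (cmp_eq_lt_iff _ _).1
          ((hl p hp q hq).symm.trans ((cmp_eq_lt_iff _ _).2 (hp'.trans hq'))))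
    refine ⟨b, key b hb fun p hp => ?_⟩
    rcases lt_or_gt_of_ne (hex p hp) with h | h
    · rw [(cmp_eq_lt_iff _ _).2 h, eq_comm, cmp_eq_lt_iff]
      refine h1 _ (List.mem_toFinset.2 (List.mem_map.2 ⟨p, List.mem_filter.2 ⟨hp, ?_⟩, rfl⟩))
      simpa using h
    · rw [(cmp_eq_gt_iff _ _).2 h, eq_comm, cmp_eq_gt_iff]
      refine h2 _ (List.mem_toFinset.2 (List.mem_map.2 ⟨p, List.mem_filter.2 ⟨hp, ?_⟩, rfl⟩))
      simpa using h

theorem PartialShuffle.swap {π : Equiv.Perm ℕ} {l : List (ColoredRat × ColoredRat)}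
    (h : PartialShuffle π l) : PartialShuffle π⁻¹ (l.map Prod.swap) := by
  constructor
  · intro p hp
    obtain ⟨q, hq, rfl⟩ := List.mem_map.1 hp
    simp [h.1 q hq]
  · intro p hp q hq
    obtain ⟨p', hp', rfl⟩ := List.mem_map.1 hp
    obtain ⟨q', hq', rfl⟩ := List.mem_map.1 hq
    exact (h.2 p' hp' q' hq').symm

theorem PartialShuffle.back {π : Equiv.Perm ℕ} {l : List (ColoredRat × ColoredRat)}
    (h : PartialShuffle π l) (b : ColoredRat) : ∃ a, PartialShuffle π (l ++ [(a, b)]) := by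
  obtain ⟨a, ha⟩ := h.swap.forth b
  refine ⟨a, ?_⟩
  have := ha.swap
  simpa [Function.comp_def] using this

/-- Every permutation of the colours is induced by an automorphism. -/
theorem exists_orderIso_color (π : Equiv.Perm ℕ) :
    ∃ ψ : ColoredRat ≃o ColoredRat, ∀ x, color (ψ x) = π (color x) := by
  obtain ⟨u, hu, hs, hs'⟩ := exists_backAndForth (PartialShuffle π) ⟨by simp, by simp⟩
    (fun l h a => h.forth a) (fun l h b => h.back b)
  have hcmp : ∀ m n, cmp (u m).1 (u n).1 = cmp (u m).2 (u n).2 := fun m n =>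
    (hu (m + n + 1)).2 _ (List.mem_map.2 ⟨m, List.mem_range.2 (by omega), rfl⟩) _
      (List.mem_map.2 ⟨n, List.mem_range.2 (by omega), rfl⟩)
  have hcol : ∀ n, color (u n).2 = π (color (u n).1) := fun n =>
    (hu (n + 1)).1 _ (List.mem_map.2 ⟨n, by simp, rfl⟩)
  choose k hk using hs
  have hmono : StrictMono fun x => (u (k x)).2 := fun x y hxy => by
    have := hcmp (k x) (k y)
    rwa [hk, hk, (cmp_eq_lt_iff _ _).2 hxy, eq_comm, cmp_eq_lt_iff] at this
  have hsurj : Function.Surjective fun x => (u (k x)).2 := fun y => by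
    obtain ⟨n, rfl⟩ := hs' y
    refine ⟨(u n).1, ?_⟩
    have := hcmp (k (u n).1) n
    rwa [hk, cmp_self_eq_eq, eq_comm, cmp_eq_eq_iff] at this
  refine ⟨hmono.orderIsoOfSurjective _ hsurj, fun x => ?_⟩
  have := hcol (k x)
  rwa [hk] at this

end ColoredRat

/-! ### The lexicographic order on finite sequences -/

section ListOrder

variable {Q : Type*} [LinearOrder Q]

theorem List.lt_append_singleton (s : List Q) (q : Q) : s < s ++ [q] := by
  induction s with
  | nil => simp
  | cons a s ih =>
    rw [List.cons_append, List.cons_lt_cons_iff]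
    exact Or.inr ⟨rfl, ih⟩

/-- This characterizes parents by order and length: `s` is the greatest sequence of its length below
`s ++ [q]`. -/
theorem List.le_of_lt_append_singleton {s t : List Q} {q : Q} (h : t < s ++ [q])
    (hl : t.length = s.length) : t ≤ s := by
  induction s generalizing t with
  | nil => rw [List.length_eq_zero_iff.1 hl]
  | cons a s ih =>
    cases t with
    | nil => simp at hl
    | cons b t =>
      rw [List.cons_append, List.cons_lt_cons_iff] at h
      rcases h with h | ⟨rfl, h⟩
      · exact le_of_lt (List.cons_lt_cons_iff.2 (Or.inl h))
      · rcases (ih h (by simpa using hl)).eq_or_lt with h | h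
        · rw [h]
        · exact le_of_lt (List.cons_lt_cons_iff.2 (Or.inr ⟨rfl, h⟩))

theorem List.map_strictMono_of_strictMono {Q' : Type*} [LinearOrder Q'] {φ : Q → Q'}
    (hφ : StrictMono φ) : StrictMono (List.map φ) := by
  intro s t h
  induction s generalizing t with
  | nil =>
    cases t with
    | nil => exact (lt_irrefl _ h).elim
    | cons b t => simp
  | cons a s ih =>
    cases t with
    | nil => simp at h
    | cons b t =>
      rw [List.map_cons, List.map_cons]
      rw [List.cons_lt_cons_iff] at h ⊢
      exact h.imp (fun h => hφ h) fun h => ⟨congrArg φ h.1, ih h.2⟩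

instance List.instDenselyOrderedOfNoMinOrder [NoMinOrder Q] : DenselyOrdered (List Q) := by
  refine ⟨fun s t h => ?_⟩
  induction s generalizing t with
  | nil =>
    cases t with
    | nil => exact (lt_irrefl _ h).elim
    | cons b t =>
      obtain ⟨c, hc⟩ := exists_lt b
      exact ⟨[c], by simp, List.cons_lt_cons_iff.2 (Or.inl hc)⟩
  | cons a s ih =>
    cases t with
    | nil => simp at h
    | cons b t =>
      rcases List.cons_lt_cons_iff.1 h with h | ⟨rfl, h'⟩
      · exact ⟨a :: s ++ [a], List.lt_append_singleton _ _, List.cons_lt_cons_iff.2 (Or.inl h)⟩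
      · obtain ⟨r, h1, h2⟩ := ih _ h'
        exact ⟨a :: r, List.cons_lt_cons_iff.2 (Or.inr ⟨rfl, h1⟩),
          List.cons_lt_cons_iff.2 (Or.inr ⟨rfl, h2⟩)⟩

/-- Length preserving automorphisms of the lexicographic order preserve the tree structure. -/
theorem exists_orderIso_append_singleton {Ψ : List Q ≃o List Q}
    (hΨ : ∀ s, (Ψ s).length = s.length) (s : List Q) (q : Q) : ∃ q', Ψ (s ++ [q]) = Ψ s ++ [q'] := by
  obtain ⟨r, q', hr⟩ : ∃ r q', Ψ (s ++ [q]) = r ++ [q'] := by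
    rcases (Ψ (s ++ [q])).eq_nil_or_concat with h | ⟨r, q', h⟩
    · have := hΨ (s ++ [q])
      simp [h] at this
    · exact ⟨r, q', by rw [h, List.concat_eq_append]⟩
  refine ⟨q', ?_⟩
  have hlen : r.length = s.length := by
    have := hΨ (s ++ [q])
    simpa [hr] using this
  rw [hr]
  congr 1
  refine le_antisymm ?_ (List.le_of_lt_append_singleton (q := q') ?_ (by rw [hΨ, hlen]))
  · rw [← Ψ.symm_apply_le]
    refine List.le_of_lt_append_singleton (q := q) ?_ ?_
    · rw [Ψ.symm_apply_lt, hr]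
      exact List.lt_append_singleton _ _
    · rw [← hlen, ← hΨ, Ψ.apply_symm_apply]
  · rw [← hr]
    exact Ψ.strictMono (List.lt_append_singleton _ _)

end ListOrder

/-! ### Coding structures by coloured linear orders -/

namespace RelStructure

/-- Expansion of a structure by equality. -/
def withEq (M : RelStructure) : ℕ → List ℕ → Bool
  | 0, [i, j] => decide (i = j)
  | 0, _ => false
  | k + 1, s => M (k, s)

/-- The truth value of the `m`-th atomic formula at the tuple `t`. -/
def atomicValue (M : RelStructure) (t : List ℕ) (m : ℕ) : Bool :=
  if ∀ j ∈ (Denumerable.ofNat (ℕ × List ℕ) m).2, j < t.length then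
    M.withEq (Denumerable.ofNat (ℕ × List ℕ) m).1
      ((Denumerable.ofNat (ℕ × List ℕ) m).2.map fun j => t.getD j 0)
  else false

/-- The initial part of the atomic type of a tuple. -/
def atomicType (M : RelStructure) (t : List ℕ) : List Bool :=
  -- Truncating at the length keeps the colour finite and makes it reveal the length. Every atomic
  -- formula still appears once the tuple is long enough.
  (List.range t.length).map (M.atomicValue t)

/-- The colour of a node of the tree of tuples. -/
def nodeColor (M : RelStructure) (s : List ColoredRat) : ℕ :=
  Encodable.encode (M.atomicType (s.map ColoredRat.color))

theorem withEq_map {M N : RelStructure} {π : Equiv.Perm ℕ}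
    (h : ∀ n s, M (n, s) = N (n, s.map π)) (k : ℕ) (s : List ℕ) :
    N.withEq k (s.map π) = M.withEq k s := by
  match k, s with
  | 0, [] => rfl
  | 0, [_] => rfl
  | 0, [i, j] => simp [withEq]
  | 0, _ :: _ :: _ :: _ => rfl
  | k + 1, s => exact (h k s).symm

theorem atomicType_map {M N : RelStructure} {π : Equiv.Perm ℕ}
    (h : ∀ n s, M (n, s) = N (n, s.map π)) (t : List ℕ) :
    N.atomicType (t.map π) = M.atomicType t := by
  unfold atomicType
  rw [List.length_map]
  refine List.map_congr_left fun m _ => ?_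
  unfold atomicValue
  rw [List.length_map]
  split_ifs with hm
  · rw [← withEq_map h, List.map_map]
    congr 1
    refine List.map_congr_left fun j hj => ?_
    have := hm j hj
    simp [List.getD_eq_getElem?_getD, this]
  · rfl

/-- An isomorphism permutes the colours of `ColoredRat`. An automorphism inducing that permutation,
applied entrywise, respects atomic types. -/
theorem exists_orderIso_of_iso {M N : RelStructure} (h : iso M N) :
    ∃ Ψ : List ColoredRat ≃o List ColoredRat, ∀ s, N.nodeColor (Ψ s) = M.nodeColor s := by
  obtain ⟨π, hπ⟩ := iso_iff.1 h
  obtain ⟨ψ, hψ⟩ := ColoredRat.exists_orderIso_color π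
  refine ⟨(List.map_strictMono_of_strictMono ψ.strictMono).orderIsoOfSurjective _
    (List.map_surjective_iff.2 ψ.surjective), fun s => ?_⟩
  change N.nodeColor (s.map ψ) = _
  unfold nodeColor
  rw [← atomicType_map hπ, List.map_map, List.map_map]
  congr 3
  funext x
  exact hψ x

theorem atomicValue_eq_of_atomicType_eq {M N : RelStructure} {t t' : List ℕ}
    (h : M.atomicType t = N.atomicType t') {m : ℕ} (hm : m < t.length) :
    M.atomicValue t m = N.atomicValue t' m := by
  have hl : t.length = t'.length := by simpa [atomicType] using congrArg List.length h
  have := congrArg (fun l => l[m]?) h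
  simpa [atomicType, hm, hl ▸ hm] using this

/-- The automorphism preserves length, hence parents. Pairing the tuples underlying `s` and `Ψ s`
then gives a back-and-forth system, and the node colours guarantee that all relations agree along
it. -/
theorem iso_of_orderIso {M N : RelStructure} (Ψ : List ColoredRat ≃o List ColoredRat)
    (hΨ : ∀ s, N.nodeColor (Ψ s) = M.nodeColor s) : iso M N := by
  have htype : ∀ s, N.atomicType ((Ψ s).map ColoredRat.color) =
      M.atomicType (s.map ColoredRat.color) := fun s => Encodable.encode_injective (hΨ s)
  have hlen : ∀ s, (Ψ s).length = s.length := fun s => by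
    simpa [atomicType] using congrArg List.length (htype s)
  have hlen' : ∀ s, (Ψ.symm s).length = s.length := fun s => by
    rw [← hlen, Ψ.apply_symm_apply]
  obtain ⟨u, hu, hs, hs'⟩ := exists_backAndForth (α := ℕ) (β := ℕ)
    (fun l => ∃ s : List ColoredRat, s.map ColoredRat.color = l.map Prod.fst ∧
      (Ψ s).map ColoredRat.color = l.map Prod.snd)
    ⟨[], rfl, by rw [List.length_eq_zero_iff.1 (hlen [])]; rfl⟩
    (by
      rintro l ⟨s, h1, h2⟩ a
      obtain ⟨q, hq⟩ := ColoredRat.exists_color a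
      obtain ⟨q', hq'⟩ := exists_orderIso_append_singleton hlen s q
      refine ⟨q'.color, s ++ [q], ?_, ?_⟩
      · simp [h1, hq]
      · simp [hq', h2])
    (by
      rintro l ⟨s, h1, h2⟩ b
      obtain ⟨q', hq'⟩ := ColoredRat.exists_color b
      obtain ⟨q, hq⟩ := exists_orderIso_append_singleton hlen' (Ψ s) q'
      rw [Ψ.symm_apply_apply] at hq
      refine ⟨q.color, s ++ [q], ?_, ?_⟩
      · simp [h1]
      · rw [← hq, Ψ.apply_symm_apply]
        simp [h2, hq'])
  have hrel : ∀ k (idx : List ℕ), M.withEq k (idx.map fun i => (u i).1) =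
      N.withEq k (idx.map fun i => (u i).2) := by
    intro k idx
    set m := Encodable.encode (k, idx) with hm
    obtain ⟨b, hb⟩ : ∃ b, ∀ j ∈ idx, j < b :=
      ⟨idx.sum + 1, fun j hj => Nat.lt_succ_of_le (List.le_sum_of_mem hj)⟩
    -- Long enough for formula `m` to be among those listed and for all its variables to be within
    -- the tuple.
    set n := m + b + 1 with hn
    obtain ⟨s, h1, h2⟩ := hu n
    have ht := htype s
    rw [h1, h2, List.map_map, List.map_map] at ht
    have hv := atomicValue_eq_of_atomicType_eq ht.symm (m := m) (by simp; omega)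
    unfold atomicValue at hv
    rw [hm, Denumerable.ofNat_encode] at hv
    simp only [List.length_map, List.length_range] at hv
    rw [if_pos fun j hj => by have := hb j hj; omega,
      if_pos fun j hj => by have := hb j hj; omega] at hv
    have hget : ∀ (v : ℕ → ℕ), ∀ j ∈ idx, ((List.range n).map v).getD j 0 = v j := by
      intro v j hj
      have : j < n := by have := hb j hj; omega
      simp [List.getD_eq_getElem?_getD, this]
    rw [List.map_congr_left (hget _), List.map_congr_left (hget _)] at hv
    exact hv
  have heq : ∀ i j, (u i).1 = (u j).1 ↔ (u i).2 = (u j).2 := fun i j => by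
    simpa [withEq] using hrel 0 [i, j]
  choose k hk using hs
  -- The sequence `u` may repeat elements. Equality among the recorded relations makes the
  -- correspondence a well-defined injective function.
  have hku : ∀ i, (u (k (u i).1)).2 = (u i).2 := fun i => (heq _ _).1 (hk _)
  have hbij : Function.Bijective fun n => (u (k n)).2 := by
    constructor
    · intro i j hij
      have := (heq (k i) (k j)).2 hij
      rwa [hk, hk] at this
    · intro y
      obtain ⟨i, rfl⟩ := hs' y
      exact ⟨(u i).1, hku i⟩
  refine iso_iff.2 ⟨Equiv.ofBijective _ hbij, fun n s => ?_⟩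
  -- The shift is due to `withEq` reserving index `0` for equality.
  have := hrel (n + 1) (s.map k)
  simp only [withEq, List.map_map, Function.comp_def, hk] at this
  rw [List.map_id'] at this
  exact this

theorem continuous_withEq (k : ℕ) (s : List ℕ) : Continuous fun M : RelStructure => M.withEq k s := by
  match k, s with
  | 0, [] => exact continuous_const
  | 0, [_] => exact continuous_const
  | 0, [i, j] => exact continuous_const
  | 0, _ :: _ :: _ :: _ => exact continuous_const
  | k + 1, s => exact continuous_apply (A := fun _ : ℕ × List ℕ => Bool) (k, s)

/-- A colour depends on finitely many coordinates of the structure, so it is locally constant. -/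
theorem continuous_nodeColor (s : List ColoredRat) :
    Continuous fun M : RelStructure => M.nodeColor s := by
  have hval : ∀ m, Continuous fun M : RelStructure => M.atomicValue (s.map ColoredRat.color) m := by
    intro m
    unfold atomicValue
    split_ifs
    · exact continuous_withEq _ _
    · exact continuous_const
  have hloc : IsLocallyConstant fun M : RelStructure => M.nodeColor s := by
    rw [IsLocallyConstant.iff_eventually_eq]
    intro M
    have : ∀ᶠ N in 𝓝 M, ∀ m ∈ Finset.range (s.map ColoredRat.color).length,
        N.atomicValue (s.map ColoredRat.color) m = M.atomicValue (s.map ColoredRat.color) m := by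
      rw [Filter.eventually_all_finset]
      intro m _
      exact ((IsLocallyConstant.iff_continuous _).2 (hval m)).eventually_eq M
    filter_upwards [this] with N hN
    unfold nodeColor atomicType
    congr 1
    exact List.map_congr_left fun m hm => hN m (Finset.mem_range.2 (List.mem_range.1 hm))
  exact hloc.continuous

end RelStructure

/-! ### Bumps with a prescribed number of zeros -/

/-- A bump on `[0, 1]` with exactly `n` zeros in the interior. -/
noncomputable def bump (n : ℕ) (u : ℝ) : ℝ :=
  u * (1 - u) * ∏ j ∈ Finset.range n, (u - ((j + 2 : ℕ) : ℝ)⁻¹) ^ 2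

/-- The convention `0⁻¹ = 0` lets one formula list all zeros: `j = 0` and `j = 1` are the endpoints,
and the others are interior. -/
theorem bump_eq_zero_iff {n : ℕ} {u : ℝ} : bump n u = 0 ↔ ∃ j < n + 2, u = (j : ℝ)⁻¹ := by
  rw [bump, mul_eq_zero, mul_eq_zero, Finset.prod_eq_zero_iff]
  constructor
  · rintro ((h | h) | ⟨j, hj, h⟩)
    · exact ⟨0, by omega, by simpa using h⟩
    · exact ⟨1, by omega, by simp; linarith⟩
    · exact ⟨j + 2, by have := Finset.mem_range.1 hj; omega,
        sub_eq_zero.1 (pow_eq_zero_iff two_ne_zero |>.1 h)⟩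
  · rintro ⟨j, hj, rfl⟩
    match j, hj with
    | 0, _ => simp
    | 1, _ => simp
    | j + 2, hj => exact Or.inr ⟨j, Finset.mem_range.2 (by omega), by simp⟩

theorem bump_nonneg {n : ℕ} {u : ℝ} (h0 : 0 ≤ u) (h1 : u ≤ 1) : 0 ≤ bump n u :=
  mul_nonneg (mul_nonneg h0 (sub_nonneg.2 h1)) (Finset.prod_nonneg fun _ _ => sq_nonneg _)

/-- The bound `1 - u` is what keeps `u + bump n u` inside the unit interval. -/
theorem bump_le {n : ℕ} {u : ℝ} (h0 : 0 ≤ u) (h1 : u ≤ 1) : bump n u ≤ 1 - u := by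
  have h2 : ∏ j ∈ Finset.range n, (u - ((j + 2 : ℕ) : ℝ)⁻¹) ^ 2 ≤ 1 := by
    refine Finset.prod_le_one (fun _ _ => sq_nonneg _) fun j _ => ?_
    have h3 : (0 : ℝ) ≤ ((j + 2 : ℕ) : ℝ)⁻¹ := by positivity
    have h4 : ((j + 2 : ℕ) : ℝ)⁻¹ ≤ 1 := Nat.cast_inv_le_one _
    rw [sq_le_one_iff_abs_le_one, abs_le]
    constructor <;> linarith
  have h5 : 0 ≤ 1 - u := sub_nonneg.2 h1
  calc bump n u ≤ u * (1 - u) * 1 := mul_le_mul_of_nonneg_left h2 (mul_nonneg h0 h5)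
    _ ≤ 1 - u := by nlinarith

theorem continuous_bump (n : ℕ) : Continuous (bump n) := by
  unfold bump
  fun_prop

/-- Truncation to `[0, 1]`. -/
noncomputable def clamp (u : ℝ) : ℝ := max 0 (min 1 u)

theorem clamp_nonneg (u : ℝ) : 0 ≤ clamp u := le_max_left _ _

theorem clamp_le_one (u : ℝ) : clamp u ≤ 1 := max_le zero_le_one (min_le_left _ _)

theorem clamp_of_mem {u : ℝ} (h : u ∈ Icc (0 : ℝ) 1) : clamp u = u := by
  rw [clamp, min_eq_right h.2, max_eq_right h.1]

theorem clamp_of_nonpos {u : ℝ} (h : u ≤ 0) : clamp u = 0 :=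
  max_eq_left ((min_le_right _ _).trans h)

theorem clamp_of_one_le {u : ℝ} (h : 1 ≤ u) : clamp u = 1 := by
  rw [clamp, min_eq_left h, max_eq_right zero_le_one]

theorem clamp_mono : Monotone clamp := fun _ _ h => max_le_max_left _ (min_le_min_left _ h)

theorem continuous_clamp : Continuous clamp := by
  unfold clamp
  fun_prop

theorem bump_clamp_eq_zero (n : ℕ) {u : ℝ} (h : u ∉ Ioo (0 : ℝ) 1) : bump n (clamp u) = 0 := by
  rw [bump_eq_zero_iff]
  rcases le_or_gt u 0 with h0 | h0
  · exact ⟨0, by omega, by simp [clamp_of_nonpos h0]⟩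
  · exact ⟨1, by omega, by simp [clamp_of_one_le (not_lt.1 fun h1 => h ⟨h0, h1⟩)]⟩

/-! ### Interval maps from coloured linear orders -/

/-- Positive weights with sum one on a linear order. -/
structure Weighting (L : Type*) where
  w : L → ℝ
  pos : ∀ l, 0 < w l
  sum : HasSum w 1

theorem Weighting.nonempty (L : Type*) [Countable L] [Infinite L] : Nonempty (Weighting L) := by
  obtain ⟨e⟩ : Nonempty (L ≃ ℕ) := nonempty_equiv_of_countable
  have h : HasSum ((fun n : ℕ => (1 : ℝ) / 2 / 2 ^ n) ∘ e) 1 :=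
    e.hasSum_iff.2 (hasSum_geometric_two' 1)
  exact ⟨⟨_, fun l => by simp only [Function.comp_apply]; positivity, h⟩⟩

namespace Weighting

variable {L : Type*} (W : Weighting L)

theorem summable_of_abs_le {F : L → ℝ} (h : ∀ l, |F l| ≤ W.w l) : Summable F :=
  Summable.of_norm_bounded W.sum.summable h

theorem summable_ite (p : L → Prop) [DecidablePred p] : Summable fun l' => if p l' then W.w l' else 0 :=
  W.summable_of_abs_le fun l' => by
    split_ifs
    · rw [abs_of_pos (W.pos l')]
    · rw [abs_zero]
      exact (W.pos l').le

variable [LinearOrder L]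

/-- The left endpoint of the interval assigned to `l`. -/
noncomputable def start (l : L) : ℝ := ∑' l', if l' < l then W.w l' else 0

/-- The right endpoint of the interval assigned to `l`. -/
noncomputable def finish (l : L) : ℝ := W.start l + W.w l

theorem start_lt_finish (l : L) : W.start l < W.finish l := lt_add_of_pos_right _ (W.pos l)

theorem hasSum_finish (l : L) : HasSum (fun l' => if l' ≤ l then W.w l' else 0) (W.finish l) := by
  have h := ((W.summable_ite (· < l)).hasSum).add (hasSum_ite_eq l (W.w l))
  convert h using 1
  swap
  · rfl
  funext l'
  rcases lt_trichotomy l' l with h | rfl | h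
  · simp [h.le, h, h.ne]
  · simp
  · simp [h.not_ge, h.not_gt, h.ne']

theorem finish_le_start {l l' : L} (h : l < l') : W.finish l ≤ W.start l' := by
  rw [← (W.hasSum_finish l).tsum_eq]
  refine Summable.tsum_le_tsum (fun m => ?_) (W.hasSum_finish l).summable (W.summable_ite _)
  split_ifs with h1 h2 h2
  · exact le_rfl
  · exact (h2 (h1.trans_lt h)).elim
  · exact (W.pos m).le
  · exact le_rfl

theorem start_nonneg (l : L) : 0 ≤ W.start l :=
  tsum_nonneg fun m => by
    split_ifs
    exacts [(W.pos m).le, le_rfl]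

theorem finish_le_one (l : L) : W.finish l ≤ 1 := by
  rw [← (W.hasSum_finish l).tsum_eq, ← W.sum.tsum_eq]
  refine Summable.tsum_le_tsum (fun m => ?_) (W.hasSum_finish l).summable W.sum.summable
  split_ifs
  exacts [le_rfl, (W.pos m).le]

theorem eq_of_mem {l l' : L} {x : ℝ} (h : x ∈ Ioo (W.start l) (W.finish l))
    (h' : x ∈ Icc (W.start l') (W.finish l')) : l = l' := by
  rcases lt_trichotomy l l' with hl | hl | hl
  · exact ((h.2.trans_le ((W.finish_le_start hl).trans h'.1)).ne rfl).elim
  · exact hl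
  · exact ((h.1.trans_le' (h'.2.trans (W.finish_le_start hl))).ne rfl).elim

theorem start_strictMono : StrictMono W.start := fun l _ h =>
  (W.start_lt_finish l).trans_le (W.finish_le_start h)

/-- The position of `x` relative to the interval of `l`. -/
noncomputable def coord (l : L) (x : ℝ) : ℝ := (x - W.start l) / W.w l

theorem coord_mem_Icc {l : L} {x : ℝ} :
    W.coord l x ∈ Icc (0 : ℝ) 1 ↔ x ∈ Icc (W.start l) (W.finish l) := by
  rw [coord, mem_Icc, mem_Icc, le_div_iff₀ (W.pos l), div_le_iff₀ (W.pos l), finish]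
  constructor <;> rintro ⟨h1, h2⟩ <;> constructor <;> linarith

theorem coord_mem_Ioo {l : L} {x : ℝ} :
    W.coord l x ∈ Ioo (0 : ℝ) 1 ↔ x ∈ Ioo (W.start l) (W.finish l) := by
  rw [coord, mem_Ioo, mem_Ioo, lt_div_iff₀ (W.pos l), div_lt_iff₀ (W.pos l), finish]
  constructor <;> rintro ⟨h1, h2⟩ <;> constructor <;> linarith

theorem coord_nonpos {l : L} {x : ℝ} (h : x ≤ W.start l) : W.coord l x ≤ 0 :=
  div_nonpos_of_nonpos_of_nonneg (sub_nonpos.2 h) (W.pos l).le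

theorem one_le_coord {l : L} {x : ℝ} (h : W.finish l ≤ x) : 1 ≤ W.coord l x := by
  rw [coord, le_div_iff₀ (W.pos l), one_mul, le_sub_iff_add_le']
  exact h

theorem coord_strictMono (l : L) : StrictMono (W.coord l) := fun _ _ h =>
  div_lt_div_of_pos_right (sub_lt_sub_right h _) (W.pos l)

theorem continuous_coord (l : L) : Continuous (W.coord l) := by
  unfold coord
  fun_prop

theorem start_add_coord (l : L) (x : ℝ) : W.start l + W.w l * W.coord l x = x := by
  rw [coord, mul_div_cancel₀ _ (W.pos l).ne', add_sub_cancel]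

theorem coord_start_add (l : L) (u : ℝ) : W.coord l (W.start l + W.w l * u) = u := by
  rw [coord, add_sub_cancel_left, mul_div_cancel_left₀ _ (W.pos l).ne']

/-- The intervals are dense. -/
theorem exists_mem_Ioo [Countable L] {x y : ℝ} (hx : 0 ≤ x) (hxy : x < y) (hy : y ≤ 1) :
    ∃ l, ∃ z ∈ Ioo x y, z ∈ Ioo (W.start l) (W.finish l) := by
  by_contra! hcon
  have hdisj : Pairwise (Function.onFun Disjoint fun l => Ioo (W.start l) (W.finish l)) := by
    intro l l' hne
    rw [Function.onFun, Set.disjoint_left]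
    exact fun z hz hz' => hne (W.eq_of_mem hz (Ioo_subset_Icc_self hz'))
  -- Disjoint intervals of total length one leave no room for a further interval in `[0, 1]`.
  have hvol : MeasureTheory.volume (⋃ l, Ioo (W.start l) (W.finish l)) = 1 := by
    rw [MeasureTheory.measure_iUnion hdisj fun l => measurableSet_Ioo]
    simp only [Real.volume_Ioo, finish, add_sub_cancel_left]
    rw [← ENNReal.ofReal_tsum_of_nonneg (fun l => (W.pos l).le) W.sum.summable, W.sum.tsum_eq,
      ENNReal.ofReal_one]
  have hdisj' : Disjoint (⋃ l, Ioo (W.start l) (W.finish l)) (Ioo x y) := by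
    rw [Set.disjoint_left]
    intro z hz hz'
    obtain ⟨l, hl⟩ := mem_iUnion.1 hz
    exact hcon l z hz' hl
  have hsub : (⋃ l, Ioo (W.start l) (W.finish l)) ∪ Ioo x y ⊆ Icc 0 1 := by
    refine union_subset (iUnion_subset fun l z hz => ?_) fun z hz => ?_
    · exact ⟨(W.start_nonneg l).trans hz.1.le, hz.2.le.trans (W.finish_le_one l)⟩
    · exact ⟨hx.trans hz.1.le, hz.2.le.trans hy⟩
  have := MeasureTheory.measure_mono (μ := MeasureTheory.volume) hsub
  rw [MeasureTheory.measure_union hdisj' measurableSet_Ioo, hvol, Real.volume_Ioo, Real.volume_Icc,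
    sub_zero, ENNReal.ofReal_one] at this
  have h0 : ENNReal.ofReal (y - x) = 0 := by
    have h1 : (1 : ENNReal) + ENNReal.ofReal (y - x) ≤ 1 + 0 := by rwa [add_zero]
    exact le_zero_iff.1 ((ENNReal.add_le_add_iff_left ENNReal.one_ne_top).1 h1)
  rw [ENNReal.ofReal_eq_zero] at h0
  linarith

/-- The map moving the points of the interval of `l` along a bump with `k l` interior zeros. -/
noncomputable def bumpFun (k : L → ℕ) (x : ℝ) : ℝ :=
  x + ∑' l, W.w l * bump (k l) (clamp (W.coord l x))

theorem bumpFun_of_mem (k : L → ℕ) {l : L} {x : ℝ} (h : x ∈ Icc (W.start l) (W.finish l)) :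
    W.bumpFun k x = x + W.w l * bump (k l) (W.coord l x) := by
  rw [bumpFun, tsum_eq_single l, clamp_of_mem (W.coord_mem_Icc.2 h)]
  intro l' hl'
  rw [bump_clamp_eq_zero, mul_zero]
  exact fun h' => hl' (W.eq_of_mem (W.coord_mem_Ioo.1 h') h)

theorem bumpFun_of_notMem (k : L → ℕ) {x : ℝ} (h : ∀ l, x ∉ Ioo (W.start l) (W.finish l)) :
    W.bumpFun k x = x := by
  rw [bumpFun]
  convert add_zero x
  rw [← tsum_zero (α := ℝ) (β := L)]
  congr 1
  funext l
  rw [bump_clamp_eq_zero, mul_zero]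
  exact fun h' => h l (W.coord_mem_Ioo.1 h')

theorem bumpFun_mem (k : L → ℕ) {l : L} {x : ℝ} (h : x ∈ Icc (W.start l) (W.finish l)) :
    W.bumpFun k x ∈ Icc (W.start l) (W.finish l) := by
  have hc := W.coord_mem_Icc.2 h
  rw [W.bumpFun_of_mem k h]
  have h1 := mul_nonneg (W.pos l).le (bump_nonneg (n := k l) hc.1 hc.2)
  have h2 := mul_le_mul_of_nonneg_left (bump_le (n := k l) hc.1 hc.2) (W.pos l).le
  have h3 := W.start_add_coord l x
  refine ⟨h.1.trans (le_add_of_nonneg_right h1), ?_⟩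
  rw [finish]
  nlinarith

theorem bumpFun_mem_unitInterval (k : L → ℕ) {x : ℝ} (h : x ∈ I) : W.bumpFun k x ∈ I := by
  by_cases hx : ∃ l, x ∈ Ioo (W.start l) (W.finish l)
  · obtain ⟨l, hl⟩ := hx
    have := W.bumpFun_mem k (Ioo_subset_Icc_self hl)
    exact ⟨(W.start_nonneg l).trans this.1, this.2.trans (W.finish_le_one l)⟩
  · rw [W.bumpFun_of_notMem k (not_exists.1 hx)]
    exact h

/-- The series converges uniformly by comparison with the weights. Joint continuity in the colouring
makes the reduction Borel. -/
theorem continuous_bumpFun {Z : Type*} [TopologicalSpace Z] {K : Z → L → ℕ}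
    (hK : ∀ l, Continuous fun z => K z l) : Continuous fun p : Z × ℝ => W.bumpFun (K p.1) p.2 := by
  have hb : Continuous fun q : ℕ × ℝ => bump q.1 q.2 :=
    continuous_prod_of_discrete_left.2 continuous_bump
  refine continuous_snd.add (continuous_tsum (fun l => ?_) W.sum.summable fun l p => ?_)
  · exact continuous_const.mul (hb.comp (((hK l).comp continuous_fst).prodMk
      (continuous_clamp.comp ((W.continuous_coord l).comp continuous_snd))))
  · have h0 := clamp_nonneg (W.coord l p.2)
    have h1 := clamp_le_one (W.coord l p.2)
    have h2 := bump_nonneg (n := K p.1 l) h0 h1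
    have h3 := bump_le (n := K p.1 l) h0 h1
    rw [Real.norm_eq_abs, abs_of_nonneg (mul_nonneg (W.pos l).le h2)]
    exact mul_le_of_le_one_right (W.pos l).le (by linarith)

/-- The interval map of a coloured linear order. -/
noncomputable def bumpMap (k : L → ℕ) : C(I, I) where
  toFun x := ⟨W.bumpFun k x, W.bumpFun_mem_unitInterval k x.2⟩
  continuous_toFun := by
    have := W.continuous_bumpFun (Z := Unit) (K := fun _ => k) fun l => continuous_const
    exact (this.comp (continuous_const.prodMk continuous_subtype_val :
      Continuous fun x : I => ((), (x : ℝ)))).subtype_mk _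

theorem coe_bumpMap (k : L → ℕ) (x : I) : (W.bumpMap k x : ℝ) = W.bumpFun k x := rfl

theorem continuous_bumpMap {Z : Type*} [TopologicalSpace Z] {K : Z → L → ℕ}
    (hK : ∀ l, Continuous fun z => K z l) : Continuous fun z => W.bumpMap (K z) := by
  refine ContinuousMap.continuous_of_continuous_uncurry _ ?_
  exact ((W.continuous_bumpFun hK).comp (continuous_fst.prodMk
    (continuous_subtype_val.comp continuous_snd))).subtype_mk _

/-- The homeomorphism induced by an automorphism of the linear order. -/
noncomputable def transport (Ψ : L ≃o L) (x : ℝ) : ℝ := ∑' l, W.w (Ψ l) * clamp (W.coord l x)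

variable (Ψ : L ≃o L)

theorem hasSum_perm : HasSum (fun l => W.w (Ψ l)) 1 := Ψ.toEquiv.hasSum_iff.2 W.sum

theorem summable_transport (x : ℝ) : Summable fun l => W.w (Ψ l) * clamp (W.coord l x) :=
  Summable.of_norm_bounded (W.hasSum_perm Ψ).summable fun l => by
    rw [Real.norm_eq_abs, abs_of_nonneg (mul_nonneg (W.pos _).le (clamp_nonneg _))]
    exact mul_le_of_le_one_right (W.pos _).le (clamp_le_one _)

/-- Intervals to the left of `l` contribute their full transported weight and those to the right
nothing, so the map is affine from the interval of `l` onto that of `Ψ l`. -/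
theorem transport_of_mem {l : L} {x : ℝ} (h : x ∈ Icc (W.start l) (W.finish l)) :
    W.transport Ψ x = W.start (Ψ l) + W.w (Ψ l) * W.coord l x := by
  have h1 : HasSum (fun l' => if Ψ l' < Ψ l then W.w (Ψ l') else 0) (W.start (Ψ l)) :=
    Ψ.toEquiv.hasSum_iff.2 (W.summable_ite (· < Ψ l)).hasSum
  have h2 := h1.add (hasSum_ite_eq l (W.w (Ψ l) * W.coord l x))
  rw [← h2.tsum_eq, transport]
  congr 1
  funext l'
  rcases lt_trichotomy l' l with hl | rfl | hl
  · rw [if_pos (Ψ.strictMono hl), if_neg hl.ne, add_zero,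
      clamp_of_one_le (W.one_le_coord ((W.finish_le_start hl).trans h.1)), mul_one]
  · rw [if_neg (lt_irrefl _), if_pos rfl, zero_add, clamp_of_mem (W.coord_mem_Icc.2 h)]
  · rw [if_neg (Ψ.strictMono hl).not_gt, if_neg hl.ne', add_zero,
      clamp_of_nonpos (W.coord_nonpos (h.2.trans (W.finish_le_start hl))), mul_zero]

/-- Some interval has a point between `x` and `y` because the intervals are dense, and its term
increases strictly. -/
theorem transport_lt [Countable L] {x y : ℝ} (hx : 0 ≤ x) (hxy : x < y) (hy : y ≤ 1) :
    W.transport Ψ x < W.transport Ψ y := by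
  obtain ⟨l, z, hz, hzl⟩ := W.exists_mem_Ioo hx hxy hy
  refine Summable.tsum_lt_tsum (i := l) (fun m => ?_) ?_ (W.summable_transport Ψ x)
    (W.summable_transport Ψ y)
  · exact mul_le_mul_of_nonneg_left (clamp_mono ((W.coord_strictMono m).monotone hxy.le))
      (W.pos _).le
  · have hc := W.coord_mem_Ioo.2 hzl
    refine mul_lt_mul_of_pos_left ?_ (W.pos _)
    have h1 := W.coord_strictMono l hz.1
    have h2 := W.coord_strictMono l hz.2
    exact (max_lt hc.1 ((min_le_right _ _).trans_lt h1)).trans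
      (lt_max_of_lt_right (lt_min hc.2 h2))

theorem transport_zero : W.transport Ψ 0 = 0 := by
  refine (tsum_congr fun l => ?_).trans tsum_zero
  rw [clamp_of_nonpos (W.coord_nonpos (W.start_nonneg l)), mul_zero]

theorem transport_one : W.transport Ψ 1 = 1 := by
  refine (tsum_congr fun l => ?_).trans (W.hasSum_perm Ψ).tsum_eq
  rw [clamp_of_one_le (W.one_le_coord (W.finish_le_one l)), mul_one]

theorem continuous_transport : Continuous (W.transport Ψ) := by
  refine continuous_tsum (fun l => ?_) (W.hasSum_perm Ψ).summable fun l x => ?_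
  · exact continuous_const.mul (continuous_clamp.comp (W.continuous_coord l))
  · rw [Real.norm_eq_abs, abs_of_nonneg (mul_nonneg (W.pos _).le (clamp_nonneg _))]
    exact mul_le_of_le_one_right (W.pos _).le (clamp_le_one _)

theorem transport_bumpFun [Countable L] {k k' : L → ℕ} (hk : ∀ l, k' (Ψ l) = k l) {x : ℝ}
    (hx : x ∈ I) : W.transport Ψ (W.bumpFun k x) = W.bumpFun k' (W.transport Ψ x) := by
  have hmem : ∀ l x, x ∈ Icc (W.start l) (W.finish l) → x ∈ I := fun l x h =>
    ⟨(W.start_nonneg l).trans h.1, h.2.trans (W.finish_le_one l)⟩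
  have himg : ∀ {l x}, x ∈ Icc (W.start l) (W.finish l) →
      W.transport Ψ x ∈ Icc (W.start (Ψ l)) (W.finish (Ψ l)) := by
    intro l x h
    rw [W.transport_of_mem Ψ h, ← W.coord_mem_Icc, W.coord_start_add]
    exact W.coord_mem_Icc.2 h
  by_cases h : ∃ l, x ∈ Ioo (W.start l) (W.finish l)
  · obtain ⟨l, hl⟩ := h
    have hl := Ioo_subset_Icc_self hl
    rw [W.transport_of_mem Ψ (W.bumpFun_mem k hl), W.bumpFun_of_mem k' (himg hl),
      W.transport_of_mem Ψ hl, W.coord_start_add, hk, W.bumpFun_of_mem k hl, add_assoc, ← mul_add]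
    congr 2
    rw [coord, coord, add_sub_right_comm, add_div, mul_div_cancel_left₀ _ (W.pos l).ne']
  · rw [W.bumpFun_of_notMem k (not_exists.1 h), W.bumpFun_of_notMem k' fun m hm => h ?_]
    obtain ⟨l, rfl⟩ := Ψ.surjective m
    -- A point outside all intervals cannot be transported into one: the image would also be the
    -- image of `z`, and transport is injective.
    set z := W.start l + W.w l * W.coord (Ψ l) (W.transport Ψ x) with hz
    have hzl : z ∈ Ioo (W.start l) (W.finish l) := by
      rw [← W.coord_mem_Ioo, hz, W.coord_start_add]
      exact W.coord_mem_Ioo.2 hm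
    have hzx : W.transport Ψ z = W.transport Ψ x := by
      rw [W.transport_of_mem Ψ (Ioo_subset_Icc_self hzl), hz, W.coord_start_add, W.start_add_coord]
    have hzI := hmem l z (Ioo_subset_Icc_self hzl)
    have : x = z := by
      rcases lt_trichotomy x z with h' | h' | h'
      · exact ((W.transport_lt Ψ hx.1 h' hzI.2).ne' hzx).elim
      · exact h'
      · exact ((W.transport_lt Ψ hzI.1 h' hx.2).ne hzx).elim
    exact ⟨l, this ▸ hzl⟩

theorem orientedConjugacy_of_orderIso [Countable L] {k k' : L → ℕ} (hk : ∀ l, k' (Ψ l) = k l) :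
    orientedConjugacy (W.bumpMap k) (W.bumpMap k') := by
  have hmono : ∀ x y : I, x < y → W.transport Ψ x < W.transport Ψ y := fun x y h =>
    W.transport_lt Ψ x.2.1 h y.2.2
  have hmem : ∀ x : I, W.transport Ψ x ∈ I := by
    intro x
    constructor
    · rw [← W.transport_zero Ψ]
      rcases x.2.1.eq_or_lt with h | h
      · rw [← h]
      · exact (W.transport_lt Ψ le_rfl h x.2.2).le
    · rw [← W.transport_one Ψ]
      rcases x.2.2.eq_or_lt with h | h
      · rw [h]
      · exact (W.transport_lt Ψ x.2.1 h le_rfl).le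
  let h : I → I := fun x => ⟨W.transport Ψ x, hmem x⟩
  have hm : StrictMono h := fun x y hxy => hmono x y hxy
  have hs : Function.Surjective h := by
    intro y
    have := intermediate_value_Icc (zero_le_one (α := ℝ)) (W.continuous_transport Ψ).continuousOn
    rw [W.transport_zero, W.transport_one] at this
    obtain ⟨x, hx, hxy⟩ := this y.2
    exact ⟨⟨x, hx⟩, Subtype.ext hxy⟩
  refine ⟨(hm.orderIsoOfSurjective h hs).toHomeomorph, hm, fun x => Subtype.ext ?_⟩
  exact W.transport_bumpFun Ψ hk x.2

end Weighting

/-! ### Recovering the coloured order from the map -/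

/-- There are only finitely many fixed points between `x` and `y`. -/
def FinitelyLinked (f : I → I) (x y : I) : Prop := {z | f z = z ∧ z ∈ uIcc x y}.Finite

theorem finitelyLinked_conj {f g : I → I} {e : I ≃o I} (he : ∀ x, e (f x) = g (e x)) (x y : I) :
    FinitelyLinked g (e x) (e y) ↔ FinitelyLinked f x y := by
  have : {z | g z = z ∧ z ∈ uIcc (e x) (e y)} = e '' {z | f z = z ∧ z ∈ uIcc x y} := by
    ext z
    obtain ⟨z, rfl⟩ := e.surjective z
    rw [e.injective.mem_set_image]
    simp only [mem_ofPred_eq, ← he, e.injective.eq_iff, mem_uIcc, e.le_iff_le]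
  rw [FinitelyLinked, FinitelyLinked, this, finite_image_iff e.injective.injOn]

namespace Weighting

variable {L : Type*} [LinearOrder L] (W : Weighting L) {k : L → ℕ}

theorem bumpMap_eq_iff_of_mem {l : L} {x : I} (h : (x : ℝ) ∈ Icc (W.start l) (W.finish l)) :
    W.bumpMap k x = x ↔ ∃ j < k l + 2, (x : ℝ) = W.start l + W.w l * (j : ℝ)⁻¹ := by
  rw [← Subtype.coe_inj, coe_bumpMap, W.bumpFun_of_mem k h, add_eq_left, mul_eq_zero,
    or_iff_right (W.pos l).ne', bump_eq_zero_iff]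
  refine exists_congr fun j => and_congr_right fun _ => ⟨fun h' => ?_, fun h' => ?_⟩
  · rw [← h', W.start_add_coord]
  · rw [h', W.coord_start_add]

theorem mem_of_eq_start_add (l : L) (j : ℕ) :
    W.start l + W.w l * (j : ℝ)⁻¹ ∈ Icc (W.start l) (W.finish l) := by
  rw [← W.coord_mem_Icc, W.coord_start_add]
  exact ⟨by positivity, Nat.cast_inv_le_one _⟩

theorem mem_unitInterval_of_mem {l : L} {x : ℝ} (h : x ∈ Icc (W.start l) (W.finish l)) : x ∈ I :=
  ⟨(W.start_nonneg l).trans h.1, h.2.trans (W.finish_le_one l)⟩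

theorem image_fixed (l : L) :
    Subtype.val '' {x : I | W.bumpMap k x = x ∧ (x : ℝ) ∈ Icc (W.start l) (W.finish l)} =
      (fun j : ℕ => W.start l + W.w l * (j : ℝ)⁻¹) '' Iio (k l + 2) := by
  apply Subset.antisymm
  · rintro _ ⟨x, ⟨hx, hxl⟩, rfl⟩
    obtain ⟨j, hj, h⟩ := (W.bumpMap_eq_iff_of_mem hxl).1 hx
    exact ⟨j, hj, h.symm⟩
  · rintro _ ⟨j, hj, rfl⟩
    have hm := W.mem_of_eq_start_add l j
    exact ⟨⟨_, W.mem_unitInterval_of_mem hm⟩,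
      ⟨(W.bumpMap_eq_iff_of_mem hm).2 ⟨j, hj, rfl⟩, hm⟩, rfl⟩

theorem finite_fixed (l : L) :
    {x : I | W.bumpMap k x = x ∧ (x : ℝ) ∈ Icc (W.start l) (W.finish l)}.Finite := by
  rw [← finite_image_iff Subtype.val_injective.injOn, image_fixed]
  exact (finite_Iio _).image _

theorem ncard_fixed (l : L) :
    {x : I | W.bumpMap k x = x ∧ (x : ℝ) ∈ Icc (W.start l) (W.finish l)}.ncard = k l + 2 := by
  rw [← ncard_image_of_injective _ Subtype.val_injective, image_fixed, ncard_image_of_injective]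
  · rw [ncard_eq_toFinset_card']
    simp
  · intro i j h
    simpa [(W.pos l).ne'] using h

theorem finitelyLinked_of_mem {l : L} {x y : I} (hx : (x : ℝ) ∈ Icc (W.start l) (W.finish l))
    (hy : (y : ℝ) ∈ Icc (W.start l) (W.finish l)) : FinitelyLinked (W.bumpMap k) x y := by
  refine (W.finite_fixed (k := k) l).subset fun z hz => ⟨hz.1, ?_⟩
  rcases mem_uIcc.1 hz.2 with ⟨h1, h2⟩ | ⟨h1, h2⟩
  · exact ⟨hx.1.trans h1, le_trans (b := (y : ℝ)) h2 hy.2⟩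
  · exact ⟨hy.1.trans h1, le_trans (b := (x : ℝ)) h2 hx.2⟩

/-- Density of `L` puts infinitely many intervals between the two, and their left ends are fixed. -/
theorem infinite_fixed_of_lt [DenselyOrdered L] {l l' : L} (h : l < l') :
    {z : I | W.bumpMap k z = z ∧ W.finish l ≤ z ∧ (z : ℝ) ≤ W.start l'}.Infinite := by
  have hm : ∀ m, W.start m ∈ Icc (W.start m) (W.finish m) := fun m =>
    left_mem_Icc.2 (W.start_lt_finish m).le
  refine ((Ioo_infinite h).image (f := fun m =>
    (⟨W.start m, W.mem_unitInterval_of_mem (hm m)⟩ : I)) ?_).mono ?_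
  · intro m _ n _ hmn
    exact W.start_strictMono.injective (congrArg Subtype.val hmn)
  · rintro _ ⟨m, hm', rfl⟩
    refine ⟨(W.bumpMap_eq_iff_of_mem (hm m)).2 ⟨0, by omega, by simp⟩, W.finish_le_start hm'.1, ?_⟩
    exact W.start_strictMono.monotone hm'.2.le

variable [Countable L] [DenselyOrdered L]

/-- A point outside the interval of `l` is separated from it by part of another interval, and
between two intervals there are infinitely many fixed points. Finite linkage thus detects the
interval in conjugacy-invariant terms. -/
theorem mem_of_finitelyLinked {l : L} {x y : I} (hx : (x : ℝ) ∈ Icc (W.start l) (W.finish l))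
    (h : FinitelyLinked (W.bumpMap k) x y) : (y : ℝ) ∈ Icc (W.start l) (W.finish l) := by
  constructor
  · by_contra hlt
    obtain ⟨m, z, hz, hzm⟩ := W.exists_mem_Ioo y.2.1 (not_le.1 hlt)
      ((W.start_lt_finish l).le.trans (W.finish_le_one l))
    have hml : m < l := by
      rcases lt_trichotomy m l with h' | rfl | h'
      · exact h'
      · exact (hz.2.not_gt hzm.1).elim
      · exact ((hz.2.trans (W.start_strictMono h')).not_gt hzm.1).elim
    refine Set.Infinite.mono (fun t ht => (⟨ht.1, ?_⟩ :
      t ∈ {z | W.bumpMap k z = z ∧ z ∈ uIcc x y})) (W.infinite_fixed_of_lt (k := k) hml) h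
    refine mem_uIcc.2 (Or.inr ⟨?_, ?_⟩)
    · exact (hz.1.trans (hzm.2.trans_le ht.2.1)).le
    · exact ht.2.2.trans hx.1
  · by_contra hlt
    obtain ⟨m, z, hz, hzm⟩ := W.exists_mem_Ioo ((W.start_nonneg l).trans (W.start_lt_finish l).le)
      (not_le.1 hlt) y.2.2
    have hml : l < m := by
      rcases lt_trichotomy l m with h' | rfl | h'
      · exact h'
      · exact (hz.1.not_gt hzm.2).elim
      · exact ((hzm.2.trans_le (W.finish_le_start h')).not_gt
          ((W.start_lt_finish l).trans hz.1)).elim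
    refine Set.Infinite.mono (fun t ht => (⟨ht.1, ?_⟩ :
      t ∈ {z | W.bumpMap k z = z ∧ z ∈ uIcc x y})) (W.infinite_fixed_of_lt (k := k) hml) h
    refine mem_uIcc.2 (Or.inl ⟨?_, ?_⟩)
    · exact hx.2.trans ht.2.1
    · exact ((ht.2.2.trans hzm.1.le).trans hz.2.le)

/-- A point of the interval of `l` which is not fixed. -/
noncomputable def mid (l : L) : I :=
  -- The fixed points have relative positions `0`, `1` and reciprocals at most `1 / 2`, so `3 / 4`
  -- avoids them for every colour.
  ⟨W.start l + W.w l * (3 / 4), by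
    refine W.mem_unitInterval_of_mem (l := l) ?_
    rw [← W.coord_mem_Icc, W.coord_start_add]
    norm_num⟩

omit [Countable L] [DenselyOrdered L] in
theorem mid_mem (l : L) : (W.mid l : ℝ) ∈ Ioo (W.start l) (W.finish l) := by
  rw [← W.coord_mem_Ioo, mid, W.coord_start_add]
  norm_num

omit [Countable L] [DenselyOrdered L] in
theorem bumpMap_mid_ne (l : L) : W.bumpMap k (W.mid l) ≠ W.mid l := by
  rw [ne_eq, W.bumpMap_eq_iff_of_mem (Ioo_subset_Icc_self (W.mid_mem l))]
  rintro ⟨j, -, h⟩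
  simp only [mid, add_right_inj, mul_eq_mul_left_iff, (W.pos l).ne', or_false] at h
  rcases j with _ | _ | j
  · norm_num at h
  · norm_num at h
  · have : ((j + 1 + 1 : ℕ) : ℝ)⁻¹ ≤ 2⁻¹ := by
      refine inv_anti₀ two_pos ?_
      push_cast
      linarith [(Nat.cast_nonneg j : (0 : ℝ) ≤ j)]
    rw [← h] at this
    norm_num at this

omit [Countable L] [DenselyOrdered L] in
theorem exists_mem_of_ne {x : I} (h : W.bumpMap k x ≠ x) :
    ∃ l, (x : ℝ) ∈ Ioo (W.start l) (W.finish l) := by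
  by_contra hcon
  exact h (Subtype.ext (W.bumpFun_of_notMem k (not_exists.1 hcon)))

theorem ncard_linked {l : L} {x : I} (hx : (x : ℝ) ∈ Icc (W.start l) (W.finish l)) :
    {z | W.bumpMap k z = z ∧ FinitelyLinked (W.bumpMap k) x z}.ncard = k l + 2 := by
  rw [← W.ncard_fixed (k := k) l]
  congr 1
  ext z
  exact and_congr_right fun _ => ⟨W.mem_of_finitelyLinked hx, W.finitelyLinked_of_mem hx⟩

/-- Moved points go to moved points, so each chosen midpoint lands in some interval. Finite linkage
makes the induced map on `L` an order isomorphism, and counting the linked fixed points, two more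
than the colour, shows that colours are preserved. -/
theorem exists_orderIso_of_orientedConjugacy {k k' : L → ℕ}
    (h : orientedConjugacy (W.bumpMap k) (W.bumpMap k')) :
    ∃ Ψ : L ≃o L, ∀ l, k' (Ψ l) = k l := by
  obtain ⟨h, hm, hc⟩ := h
  set e : I ≃o I := hm.orderIsoOfSurjective h h.surjective with he
  have hc : ∀ x, e (W.bumpMap k x) = W.bumpMap k' (e x) := hc
  have hmid : ∀ l, ∃ m, (e (W.mid l) : ℝ) ∈ Ioo (W.start m) (W.finish m) := fun l => by
    refine W.exists_mem_of_ne (k := k') fun h' => W.bumpMap_mid_ne (k := k) l ?_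
    rw [← hc] at h'
    exact e.injective h'
  have hmid' : ∀ m, ∃ l, (e.symm (W.mid m) : ℝ) ∈ Ioo (W.start l) (W.finish l) := fun m => by
    refine W.exists_mem_of_ne (k := k) fun h' => W.bumpMap_mid_ne (k := k') m ?_
    have := congrArg e h'
    rwa [hc, e.apply_symm_apply] at this
  choose Ψ hΨ using hmid
  have hmono : StrictMono Ψ := by
    intro l l' hll
    have h1 : W.mid l < W.mid l' :=
      Subtype.coe_lt_coe.1 ((W.mid_mem l).2.trans ((W.finish_le_start hll).trans_lt (W.mid_mem l').1))
    have h2 : (e (W.mid l) : ℝ) < e (W.mid l') := e.strictMono h1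
    rcases lt_trichotomy (Ψ l) (Ψ l') with h' | h' | h'
    · exact h'
    · have h3 := W.finitelyLinked_of_mem (k := k') (Ioo_subset_Icc_self (hΨ l))
        (h' ▸ Ioo_subset_Icc_self (hΨ l'))
      rw [finitelyLinked_conj hc] at h3
      have h4 := W.mem_of_finitelyLinked (Ioo_subset_Icc_self (W.mid_mem l)) h3
      exact (hll.ne (W.eq_of_mem (W.mid_mem l') h4).symm).elim
    · exact ((h2.trans (hΨ l').2).not_ge ((W.finish_le_start h').trans (hΨ l).1.le)).elim
  have hsurj : Function.Surjective Ψ := by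
    intro m
    obtain ⟨l, hl⟩ := hmid' m
    refine ⟨l, ?_⟩
    have h1 := W.finitelyLinked_of_mem (k := k) (Ioo_subset_Icc_self hl)
      (Ioo_subset_Icc_self (W.mid_mem l))
    rw [← finitelyLinked_conj hc, e.apply_symm_apply] at h1
    exact W.eq_of_mem (hΨ l) (W.mem_of_finitelyLinked (Ioo_subset_Icc_self (W.mid_mem m)) h1)
  refine ⟨hmono.orderIsoOfSurjective Ψ hsurj, fun l => ?_⟩
  change k' (Ψ l) = k l
  have h1 := W.ncard_linked (k := k) (Ioo_subset_Icc_self (W.mid_mem l))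
  have h2 := W.ncard_linked (k := k') (Ioo_subset_Icc_self (hΨ l))
  have h3 : {z | W.bumpMap k' z = z ∧ FinitelyLinked (W.bumpMap k') (e (W.mid l)) z} =
      e '' {z | W.bumpMap k z = z ∧ FinitelyLinked (W.bumpMap k) (W.mid l) z} := by
    ext z
    obtain ⟨z, rfl⟩ := e.surjective z
    rw [e.injective.mem_set_image]
    simp only [mem_ofPred_eq, ← hc, e.injective.eq_iff, finitelyLinked_conj hc]
  rw [h3, ncard_image_of_injective _ e.injective, h1] at h2
  omega

end Weighting

theorem borelReducible_iso_orientedConjugacy :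
    BorelReducible RelStructure.iso orientedConjugacy := by
  have : Infinite (List ColoredRat) := inferInstance
  obtain ⟨W⟩ := Weighting.nonempty (List ColoredRat)
  refine ⟨fun M => W.bumpMap M.nodeColor,
    (W.continuous_bumpMap RelStructure.continuous_nodeColor).measurable, fun M N => ⟨fun h => ?_,
      fun h => ?_⟩⟩
  · obtain ⟨Ψ, hΨ⟩ := RelStructure.exists_orderIso_of_iso h
    exact W.orientedConjugacy_of_orderIso Ψ hΨ
  · obtain ⟨Ψ, hΨ⟩ := W.exists_orderIso_of_orientedConjugacy h
    exact RelStructure.iso_of_orderIso Ψ hΨ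

theorem mainTheorem2 :
    (∃ (Y : Type) (_ : MeasurableSpace Y) (E : Setoid Y), IsUniversalSInftyOrbitRel E) ∧
    ∀ (Y : Type) [MeasurableSpace Y] (E : Setoid Y), IsUniversalSInftyOrbitRel E →
      BorelBireducible orientedConjugacy E :=
  ⟨⟨RelStructure, inferInstance, RelStructure.iso, RelStructure.isUniversalSInftyOrbitRel_iso⟩,
    fun _ _ _ hE =>
      ⟨borelReducible_orientedConjugacy_iso.trans (hE.2 _ _ RelStructure.isSInftyOrbitRel_iso),
        (RelStructure.borelReducible_iso hE.1).trans borelReducible_iso_orientedConjugacy⟩⟩
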